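/- Let $3\le p<5$ and let $u:\mathbb R^3\times\mathbb R\to\mathbb R$ be a radial solution with finite energy of the defocusing wave equation $\partial_t^2u-\Delta u=-|u|^{p-1}u$. Here a solution means that $(u,u_t)\in C(\mathbb R;\dot H^1\times L^2(\mathbb R^3))$, that $|u|^{p-1}u\in L^1_{loc}(\mathbb R;L^2(\mathbb R^3))$, and that the equation holds in the sense of distributions on $\mathbb R^3\times\mathbb R$; finite energy means that in addition $u(\cdot,0)\in L^{p+1}(\mathbb R^3)$. Write $u(r,t)$ for the value of $u(x,t)$ at $|x|=r$, put $w(r,t)=r\,u(r,t)$ for $r>0$, and define the inward and outward energies \[ E_{\mp}(t)=\pi\int_0^\infty\left(|w_r(r,t)\pm w_t(r,t)|^2+\frac{2}{p+1}\cdot\frac{|w(r,t)|^{p+1}}{r^{p-1}}\right)dr, \] where the sign $+$ in the integrand gives $E_-$, the sign $-$ gives $E_+$, and $w_r$ is the weak derivative on $(0,\infty)$. Then, for every $t\in\mathbb R$, the weak derivative $w_r(\cdot,t)$ exists, both integrals are finite, and $u(\cdot,t)\in L^{p+1}(\mathbb R^3)$. The function $E_-(t)$ is non-increasing and $E_+(t)$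 is non-decreasing in $t\in\mathbb R$. Moreover \[ \lim_{t\to+\infty}E_-(t)=0,\qquad \lim_{t\to-\infty}E_+(t)=0, \] and, as a consequence, $\displaystyle\lim_{t\to\pm\infty}\int_{\mathbb R^3}|u(x,t)|^{p+1}\,dx=0$. -/

import Mathlib

open MeasureTheory Set Filter Topology
open scoped ContDiff

noncomputable section

namespace RadialWave

/-- Three-dimensional Euclidean space. -/
abbrev E3 : Type := EuclideanSpace ℝ (Fin 3)

/-- `g` is the weak (distributional) gradient of `f` on `ℝ³`. -/
structure IsWeakGradient (f : E3 → ℝ) (g : E3 → E3) : Prop where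
  locallyIntegrable : LocallyIntegrable f
  locallyIntegrable_grad : LocallyIntegrable g
  integral_eq : ∀ φ : E3 → ℝ, ContDiff ℝ ∞ φ → HasCompactSupport φ →
    ∫ x, f x • gradient φ x = - ∫ x, φ x • g x

/-- `(u, ut)` belongs to `C(ℝ; Ḣ¹ × L²(ℝ³))`, where `Ḣ¹(ℝ³)` is the space of all functions in
`L⁶(ℝ³)` whose weak gradient is in `L²(ℝ³)`, with the norm `‖∇f‖_{L²}`. -/
structure InEnergySpace (u ut : ℝ → E3 → ℝ) : Prop where
  memLp_six : ∀ t, MemLp (u t) 6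
  exists_grad : ∃ G : ℝ → E3 → E3,
    (∀ t, IsWeakGradient (u t) (G t)) ∧ (∀ t, MemLp (G t) 2) ∧
    ∀ t₀, Tendsto (fun t => eLpNorm (G t - G t₀) 2) (𝓝 t₀) (𝓝 0)
  memLp_time : ∀ t, MemLp (ut t) 2
  continuous_time : ∀ t₀, Tendsto (fun t => eLpNorm (ut t - ut t₀) 2) (𝓝 t₀) (𝓝 0)

/-- `u`, with time derivative `ut`, is a global solution of the defocusing wave equation
`∂ₜ²u - Δu = -|u|^{p-1}u` on `ℝ³ × ℝ` in the energy space: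
* `(u, ut) ∈ C(ℝ; Ḣ¹ × L²)`;
* the nonlinearity belongs to `L¹_loc(ℝ; L²(ℝ³))`, so that Duhamel's formula makes sense in the
  energy space;
* `∂ₜu = ut` and the wave equation hold in the sense of distributions on `ℝ × ℝ³`. -/
structure IsSolution (p : ℝ) (u ut : ℝ → E3 → ℝ) : Prop where
  inEnergySpace : InEnergySpace u ut
  nonlinearity : ∀ a b : ℝ, ∫⁻ t in Icc a b, eLpNorm (fun x => |u t x| ^ p) 2 < ⊤
  time_deriv : ∀ φ : ℝ × E3 → ℝ, ContDiff ℝ ∞ φ → HasCompactSupport φ →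
    ∫ t, ∫ x, u t x * deriv (fun s => φ (s, x)) t = - ∫ t, ∫ x, ut t x * φ (t, x)
  wave_eq : ∀ φ : ℝ × E3 → ℝ, ContDiff ℝ ∞ φ → HasCompactSupport φ →
    ∫ t, ∫ x, u t x *
        (iteratedDeriv 2 (fun s => φ (s, x)) t - Laplacian.laplacian (fun y => φ (t, y)) x) =
      - ∫ t, ∫ x, |u t x| ^ (p - 1) * u t x * φ (t, x)

/-- The value of a function on `ℝ³` at distance `r` from the origin is a function of `r` only. -/
def IsRadial (f : E3 → ℝ) : Prop := ∀ x y : E3, ‖x‖ = ‖y‖ → f x = f y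

/-- For radial `f`, the value `f(r)` of `f` at the points with `|x| = r` (for `r ≥ 0`). -/
def profile (f : E3 → ℝ) (r : ℝ) : ℝ := f (EuclideanSpace.single 0 r)

/-- `r * f(r)`. For `f = u t` this is `w(r, t)`, and for `f = ut t` it is `w_t(r, t)`. -/
def reduced (f : E3 → ℝ) (r : ℝ) : ℝ := r * profile f r

/-- `g` is the weak derivative of `f` on `(0, ∞)`. -/
structure IsWeakDeriv (f g : ℝ → ℝ) : Prop where
  locallyIntegrableOn : LocallyIntegrableOn f (Ioi 0)
  locallyIntegrableOn_deriv : LocallyIntegrableOn g (Ioi 0)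
  integral_eq : ∀ φ : ℝ → ℝ, ContDiff ℝ ∞ φ → HasCompactSupport φ → tsupport φ ⊆ Ioi 0 →
    ∫ r in Ioi 0, f r * deriv φ r = - ∫ r in Ioi 0, g r * φ r

open Classical in
/-- The weak derivative of `f` on `(0, ∞)` (unique almost everywhere), or `0` if `f` has none. -/
def weakDeriv (f : ℝ → ℝ) : ℝ → ℝ := if h : ∃ g, IsWeakDeriv f g then h.choose else 0

/-- `|w_r + w_t|² + 2/(p+1) * |w|^{p+1} / r^{p-1}` at time `t`. -/
def inwardDensity (p : ℝ) (u ut : ℝ → E3 → ℝ) (t r : ℝ) : ℝ :=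
  |weakDeriv (reduced (u t)) r + reduced (ut t) r| ^ 2 +
    2 / (p + 1) * (|reduced (u t) r| ^ (p + 1) / r ^ (p - 1))

/-- `|w_r - w_t|² + 2/(p+1) * |w|^{p+1} / r^{p-1}` at time `t`. -/
def outwardDensity (p : ℝ) (u ut : ℝ → E3 → ℝ) (t r : ℝ) : ℝ :=
  |weakDeriv (reduced (u t)) r - reduced (ut t) r| ^ 2 +
    2 / (p + 1) * (|reduced (u t) r| ^ (p + 1) / r ^ (p - 1))

/-- The inward energy `E₋(t)`. -/
def inwardEnergy (p : ℝ) (u ut : ℝ → E3 → ℝ) (t : ℝ) : ℝ :=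
  Real.pi * ∫ r in Ioi 0, inwardDensity p u ut t r

/-- The outward energy `E₊(t)`. -/
def outwardEnergy (p : ℝ) (u ut : ℝ → E3 → ℝ) (t : ℝ) : ℝ :=
  Real.pi * ∫ r in Ioi 0, outwardDensity p u ut t r

end RadialWave

end

/-! For radial `u` the function `w = r u` solves `w_tt - w_rr = -|w|^{p-1} w r^{1-p}` on the half
line. With `V = w_r + w_t` this factors into two transport equations, `(∂ₜ + ∂ᵣ) w = V` and `(∂ₜ -
∂ᵣ) V = -|w|^{p-1} w r^{1-p}`. If the density `V² + 2/(p+1) |w|^{p+1} r^{1-p}` is integrated against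
a weight `ψ(r) Θ(r + t)`, the interaction terms cancel. What remains in the time derivative is `-ψ'
Θ V²`, together with `2/(p+1) |w|^{p+1}` times `(ψ r^{1-p})' Θ + 2 ψ r^{1-p} Θ'`
(`InwardWave.hasDerivAt_energy`). For nondecreasing `ψ` the first term has a good sign. For `ψ = 1`
the second is nonpositive as soon as `2 r Θ' ≤ (p - 1) Θ`, so `Θ` may grow like a small power of `r
+ t`.

Two consequences follow. The weight `Θ = 1` gives the monotonicity of `E₋`. For decay, `growthWeight
R` lies in `[0, 1]`, tends to `0` pointwise as `R → ∞`, and is at least `1/2` beyond `R`. The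
weighted energy at time `t₀` is then small for large `R`, and at every time `t ≥ t₀ + R` it controls
half of `E₋(t)` (`InwardWave.tendsto_lintegral_density`). The outward energy is the inward energy of
the time-reversed wave, and each energy dominates the `L^{p+1}` norm.

The boundary `r = 0` is handled by `radialWeight δ l`, a cutoff at scale `δ` times `1 - exp(-l r)`.
The Sobolev-type bound `|w| ≤ √r N(t)` gives a potential density of order `r^{(3-p)/2}`. The factor
`1 - exp(-l r) ≤ l r` absorbs the `1/δ` from the cutoff, so the error is of order `δ^{(5-p)/2}`,
which vanishes since `p < 5`. Sending `δ → 0` and then `l → ∞` removes the weight. The factor costs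
one unit of `p - 1`, since `r σ' ≤ σ` for `σ = 1 - exp(-l r)`. With `2 r Θ' ≤ Θ` costing another, `p
≥ 3` is ample.

Only energy regularity is available, so nothing is differentiated pointwise. A transport equation in
`L²` becomes, after translation along characteristics, a strongly differentiable curve
(`Transport.hasDerivAt_shift`), and integrals of nonlinear functions of such a curve are
differentiated by a quadratic Taylor estimate (`hasDerivAt_integral_nonlinear`). The passage from
`ℝ³` to the half line writes a radial `Ḣ¹` function as `-∫_r^∞ h(s)/s ds` with `h ∈ L²`. Hardy's
inequality then puts `w_r` in `L²`, and testing with `a(t) β(|x|)/|x|` turns the three-dimensional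
equation into the one-dimensional one (`IsSolution.exists_lineWave`). -/

namespace RadialWave

/-! ### Curves in `L²(ℝ)` and transport along characteristics -/

/-- A curve in a Hilbert space that is weakly differentiable with continuous derivative is
strongly differentiable. -/
theorem hasDerivAt_of_inner {H : Type*} [NormedAddCommGroup H] [InnerProductSpace ℝ H]
    [CompleteSpace H] {D : Set H} (hD : ∀ x, (∀ b ∈ D, inner ℝ b x = 0) → x = 0)
    {X G : ℝ → H} (hG : Continuous G)
    (h : ∀ b ∈ D, ∀ t, HasDerivAt (fun s => inner ℝ b (X s)) (inner ℝ b (G t)) t) (t : ℝ) :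
    HasDerivAt X (G t) t := by
  have hI : ∀ s, HasDerivAt (fun u => ∫ x in (0 : ℝ)..u, G x) (G s) s := fun s =>
    intervalIntegral.integral_hasDerivAt_right (hG.intervalIntegrable _ _)
      hG.stronglyMeasurable.stronglyMeasurableAtFilter hG.continuousAt
  have key : ∀ s, X s = X 0 + ∫ x in (0 : ℝ)..s, G x := by
    intro s
    rw [← sub_eq_zero]
    refine hD _ fun b hb => ?_
    have hd : ∀ s, HasDerivAt (fun s => inner ℝ b (X s - (X 0 + ∫ x in (0 : ℝ)..s, G x))) 0 s := by
      intro s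
      have h1 := h b hb s
      have h2 : HasDerivAt (fun s => inner ℝ b (∫ x in (0 : ℝ)..s, G x)) (inner ℝ b (G s)) s := by
        simpa using (hasDerivAt_const s b).inner ℝ (hI s)
      have h3 := (h1.sub_const (inner ℝ b (X 0))).sub h2
      rw [sub_self] at h3
      refine h3.congr_of_eventuallyEq (Eventually.of_forall fun u => ?_)
      simp only [inner_sub_right, inner_add_right, Pi.sub_apply]
      ring
    have := is_const_of_deriv_eq_zero (fun s => (hd s).differentiableAt) (fun s => (hd s).deriv) s 0
    simpa using this
  exact ((hI t).const_add (X 0)).congr_of_eventuallyEq (Eventually.of_forall key)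

/-- Product rule for pairings of a strongly differentiable curve with a continuous one. -/
theorem hasDerivAt_inner_moving {H : Type*} [NormedAddCommGroup H] [InnerProductSpace ℝ H]
    {β V : ℝ → H} {β' : H} {m : ℝ} {t : ℝ} (hβ : HasDerivAt β β' t) (hV : ContinuousAt V t)
    (hm : HasDerivAt (fun s => inner ℝ (β t) (V s)) m t) :
    HasDerivAt (fun s => inner ℝ (β s) (V s)) (inner ℝ β' (V t) + m) t := by
  rw [hasDerivAt_iff_tendsto_slope] at hβ hm ⊢
  -- The slope of the pairing is `⟨slope β, V s⟩` plus the slope of `⟨β t, V⟩`, so only continuity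
  -- of `V` is needed in the first term.
  have h1 : Tendsto (fun s => inner ℝ (slope β t s) (V s)) (𝓝[≠] t) (𝓝 (inner ℝ β' (V t))) :=
    hβ.inner (hV.tendsto.mono_left nhdsWithin_le_nhds)
  refine (h1.add hm).congr fun s => ?_
  simp only [slope_def_field, slope_def_module, inner_smul_left, inner_sub_left,
    RCLike.conj_to_real]
  ring

/-- The space `L²(ℝ)`. -/
abbrev L2 : Type := Lp ℝ 2 (volume : Measure ℝ)

theorem inner_eq_integral (f g : L2) : inner ℝ f g = ∫ x, f x * g x := by
  rw [L2.inner_def]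
  exact integral_congr_ae (Eventually.of_forall fun x => by simp [mul_comm])

/-- The elements of `L²(ℝ)` represented by test functions. -/
def testL2 : Set L2 :=
  {x | ∃ b : ℝ → ℝ, ContDiff ℝ ∞ b ∧ HasCompactSupport b ∧ ⇑x =ᵐ[volume] b}

/-- The fundamental lemma of the calculus of variations. It makes `testL2` a legitimate set of
functionals in `hasDerivAt_of_inner`. -/
theorem eq_zero_of_testL2 (x : L2) (h : ∀ b ∈ testL2, inner ℝ b x = 0) : x = 0 := by
  have hx : LocallyIntegrable (x : ℝ → ℝ) := (Lp.memLp x).locallyIntegrable (by norm_num)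
  have := ae_eq_zero_of_integral_contDiff_smul_eq_zero hx (fun g hg hc => by
    have hm : MemLp g 2 (volume : Measure ℝ) := hg.continuous.memLp_of_hasCompactSupport hc
    rw [← h (hm.toLp g) ⟨g, hg, hc, hm.coeFn_toLp⟩, inner_eq_integral]
    refine integral_congr_ae ?_
    filter_upwards [hm.coeFn_toLp] with r hr
    simp [hr])
  exact (Lp.eq_zero_iff_ae_eq_zero).2 this

/-- Translation `g ↦ g(· + a)` on `L²(ℝ)`. -/
noncomputable def shift (a : ℝ) : L2 →ₗᵢ[ℝ] L2 :=
  Lp.compMeasurePreservingₗᵢ ℝ (fun x => x + a) (measurePreserving_add_right volume a)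

theorem shift_coe (a : ℝ) (g : L2) : shift a g =ᵐ[volume] fun x => g (x + a) :=
  Lp.coeFn_compMeasurePreserving g (measurePreserving_add_right volume a)

/-- Translations are isometries and strongly continuous on `L²`, so moving frame and moving element
may vary together. -/
theorem continuous_shift {Z : ℝ → L2} (hZ : Continuous Z) (c : ℝ) :
    Continuous fun t => shift (c * t) (Z t) := by
  let g : ℝ → C(ℝ, ℝ) := fun t => ⟨fun x => x + c * t, by fun_prop⟩
  have hg : Continuous g := ContinuousMap.continuous_of_continuous_uncurry _ (by
    change Continuous fun q : ℝ × ℝ => q.2 + c * q.1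
    fun_prop)
  exact Continuous.compMeasurePreservingLp hZ hg
    (fun t => measurePreserving_add_right volume (c * t)) (by norm_num)

theorem integral_shift (a : ℝ) (F : ℝ → ℝ) : ∫ x, F (x + a) = ∫ x, F x :=
  integral_add_right_eq_self F a

theorem inner_shift {b : ℝ → ℝ} {x : L2} (hx : ⇑x =ᵐ[volume] b) (a : ℝ) (y : L2) :
    inner ℝ x (shift a y) = ∫ r, b (r - a) * y r := by
  rw [inner_eq_integral, ← integral_shift a (fun r => b (r - a) * y r)]
  refine integral_congr_ae ?_
  filter_upwards [hx, shift_coe a y] with r h1 h2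
  simp [h1, h2]

theorem exists_forall_abs_le {b : ℝ → ℝ} (hb : Continuous b) (hc : HasCompactSupport b) :
    ∃ C, ∀ x, |b x| ≤ C := by
  simpa using hb.bounded_above_of_compact_support hc

/-- Translates of test functions are differentiable as curves in `L²(ℝ)`. -/
theorem hasDerivAt_shift_test {b : ℝ → ℝ} {x y : L2} (hb : ContDiff ℝ ∞ b)
    (hc : HasCompactSupport b) (hx : ⇑x =ᵐ[volume] b) (hy : ⇑y =ᵐ[volume] deriv b) (c t : ℝ) :
    HasDerivAt (fun s => shift (c * s) x) (c • shift (c * t) y) t := by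
  refine hasDerivAt_of_inner eq_zero_of_testL2 (X := fun s => shift (c * s) x)
    (G := fun s => c • shift (c * s) y) ((continuous_shift continuous_const c).const_smul c) ?_ t
  rintro z ⟨d, hd, hdc, hz⟩ t
  have e1 : ∀ s, inner ℝ z (shift (c * s) x) = ∫ r, d r * b (r + c * s) := fun s => by
    rw [inner_eq_integral]
    refine integral_congr_ae ?_
    have := (measurePreserving_add_right volume (c * s)).quasiMeasurePreserving.ae_eq_comp hx
    filter_upwards [hz, shift_coe (c * s) x, this] with r h1 h2 h3
    simp only [Function.comp_apply] at h3
    rw [h1, h2, h3]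
  have e2 : inner ℝ z (c • shift (c * t) y) = ∫ r, d r * (deriv b (r + c * t) * c) := by
    rw [inner_smul_right, inner_eq_integral, ← integral_const_mul]
    refine integral_congr_ae ?_
    have := (measurePreserving_add_right volume (c * t)).quasiMeasurePreserving.ae_eq_comp hy
    filter_upwards [hz, shift_coe (c * t) y, this] with r h1 h2 h3
    simp only [Function.comp_apply] at h3
    rw [h1, h2, h3]; ring
  simp only [e1, e2]
  have hb' : Continuous (deriv b) := hb.continuous_deriv (by simp)
  obtain ⟨C, hC⟩ := exists_forall_abs_le hb' hc.deriv
  have hdi : Integrable d := hd.continuous.integrable_of_hasCompactSupport hdc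
  have hdcont := hd.continuous
  have hbcont := hb.continuous
  refine (hasDerivAt_integral_of_dominated_loc_of_deriv_le (s := univ)
    (F := fun s r => d r * b (r + c * s)) (F' := fun s r => d r * (deriv b (r + c * s) * c))
    (bound := fun r => |d r| * (C * |c|)) univ_mem
    (Eventually.of_forall fun s => ?_) ?_ ?_ (Eventually.of_forall fun r s _ => ?_)
    (hdi.abs.mul_const _) (Eventually.of_forall fun r s _ => ?_)).2
  · exact Continuous.aestronglyMeasurable (by fun_prop)
  · exact Continuous.integrable_of_hasCompactSupport (by fun_prop) hdc.mul_right
  · exact Continuous.aestronglyMeasurable (by fun_prop)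
  · rw [Real.norm_eq_abs, abs_mul, abs_mul]
    gcongr
    exact hC _
  · have h1 : HasDerivAt b (deriv b (r + c * s)) (r + c * s) :=
      ((hb.differentiable (by simp)) _).hasDerivAt
    have h2 : HasDerivAt (fun s => r + c * s) c s := by
      simpa using ((hasDerivAt_id s).const_mul c).const_add r
    exact (h1.comp s h2).const_mul (d r)

/-- `(∂ₜ + c ∂ᵣ) Y = Z` in the sense of distributions, with `Y, Z ∈ C(ℝ; L²(ℝ))`. -/
structure Transport (c : ℝ) (Y Z : ℝ → L2) : Prop where
  continuous : Continuous Y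
  continuous_source : Continuous Z
  hasDerivAt : ∀ b : ℝ → ℝ, ContDiff ℝ ∞ b → HasCompactSupport b → ∀ t,
    HasDerivAt (fun s => ∫ r, b r * Y s r) ((∫ r, b r * Z t r) + c * ∫ r, deriv b r * Y t r) t

/-- In the frame `σ ↦ σ + c t` the transport equation is an ordinary differential equation in `L²`.
The shift is moved onto the test function. The derivative of the moving test function then
contributes `-c ∫ b' Y`, which cancels the transport term. -/
theorem Transport.hasDerivAt_shift {c : ℝ} {Y Z : ℝ → L2} (h : Transport c Y Z) (t : ℝ) :
    HasDerivAt (fun s => shift (c * s) (Y s)) (shift (c * t) (Z t)) t := by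
  refine hasDerivAt_of_inner eq_zero_of_testL2 (continuous_shift h.continuous_source c) ?_ t
  rintro x ⟨b, hb, hbc, hx⟩ t
  have hb' : ContDiff ℝ ∞ (deriv b) := hb.deriv' 
  have hmb' : MemLp (deriv b) 2 (volume : Measure ℝ) :=
    hb'.continuous.memLp_of_hasCompactSupport hbc.deriv
  have hpair : ∀ s (y : L2), inner ℝ x (shift (c * s) y) = inner ℝ (shift (-c * s) x) y := by
    intro s y
    rw [inner_shift hx, inner_eq_integral]
    refine integral_congr_ae ?_
    have := (measurePreserving_add_right volume (-c * s)).quasiMeasurePreserving.ae_eq_comp hx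
    filter_upwards [shift_coe (-c * s) x, this] with r h2 h3
    simp only [Function.comp_apply] at h3
    rw [h2, h3]; congr 2; ring
  simp only [hpair]
  have hβ := hasDerivAt_shift_test hb hbc hx hmb'.coeFn_toLp (-c) t
  have ht := (measurePreserving_add_right volume (-c * t)).quasiMeasurePreserving.ae_eq_comp hx
  have hS : ∀ y : L2, inner ℝ (shift (-c * t) x) y = ∫ r, b (r + -c * t) * y r := fun y => by
    rw [inner_eq_integral]
    refine integral_congr_ae ?_
    filter_upwards [shift_coe (-c * t) x, ht] with r h2 h3
    simp only [Function.comp_apply] at h3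
    rw [h2, h3]
  have hm := h.hasDerivAt (fun r => b (r + -c * t)) (by fun_prop)
    (hbc.comp_homeomorph (Homeomorph.addRight (-c * t))) t
  have hm' : HasDerivAt (fun s => inner ℝ (shift (-c * t) x) (Y s))
      ((∫ r, b (r + -c * t) * Z t r) + c * ∫ r, deriv b (r + -c * t) * Y t r) t := by
    simp only [hS]
    convert hm using 6
    rw [deriv_comp_add_const]
  refine (hasDerivAt_inner_moving hβ h.continuous.continuousAt hm').congr_deriv ?_
  rw [hS, inner_smul_left, inner_eq_integral]
  have : ∫ r, (shift (-c * t) (hmb'.toLp (deriv b))) r * Y t r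
      = ∫ r, deriv b (r + -c * t) * Y t r := by
    refine integral_congr_ae ?_
    have := (measurePreserving_add_right volume (-c * t)).quasiMeasurePreserving.ae_eq_comp
      hmb'.coeFn_toLp
    filter_upwards [shift_coe (-c * t) (hmb'.toLp (deriv b)), this] with r h2 h3
    simp only [Function.comp_apply] at h3
    rw [h2, h3]
  rw [this]
  simp

end RadialWave

/-! ### Differentiating nonlinear integrals along a transport equation -/

namespace RadialWave

theorem integral_sq_eq_norm (y : L2) : ∫ x, y x ^ 2 = ‖y‖ ^ 2 := by
  rw [← real_inner_self_eq_norm_sq, inner_eq_integral]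
  simp [sq]

theorem integrable_sq_L2 (y : L2) : Integrable fun x => y x ^ 2 :=
  (Lp.memLp y).integrable_sq

theorem integrable_mul_L2 (y z : L2) : Integrable fun x => y x * z x :=
  (Lp.memLp y).integrable_mul (Lp.memLp z)

theorem integrable_abs_mul_abs (y z : L2) : Integrable fun x => |y x| * |z x| := by
  simpa [abs_mul] using (integrable_mul_L2 y z).abs

theorem integral_abs_mul_abs_le (y z : L2) : ∫ x, |y x| * |z x| ≤ ‖y‖ * ‖z‖ := by
  have h := real_inner_le_norm |y| |z|
  rw [norm_abs_eq_norm, norm_abs_eq_norm, inner_eq_integral] at h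
  refine le_trans (le_of_eq (integral_congr_ae ?_)) h
  filter_upwards [Lp.coeFn_abs y, Lp.coeFn_abs z] with x h1 h2
  rw [h1, h2]

/-- A differentiable curve satisfies `‖y t - y t₀‖ = O(t - t₀)`, so a quadratic error is `o(t -
t₀)`. -/
theorem hasDerivAt_zero_of_abs_le_sq {E : ℝ → ℝ} {H : Type*} [NormedAddCommGroup H]
    [NormedSpace ℝ H] {y : ℝ → H} {z : H} {t₀ C : ℝ} (hy : HasDerivAt y z t₀) (h0 : E t₀ = 0)
    (h : ∀ᶠ t in 𝓝 t₀, |E t| ≤ C * ‖y t - y t₀‖ ^ 2) : HasDerivAt E 0 t₀ := by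
  rw [hasDerivAt_iff_isLittleO]
  have h1 : (fun t => E t - E t₀ - (t - t₀) • (0 : ℝ)) =O[𝓝 t₀] fun t => (t - t₀) ^ 2 := by
    have h2 : (fun t => E t - E t₀ - (t - t₀) • (0 : ℝ)) =O[𝓝 t₀] fun t => ‖y t - y t₀‖ ^ 2 := by
      refine Asymptotics.IsBigO.of_bound C ?_
      filter_upwards [h] with t ht
      simpa [h0] using ht
    exact h2.trans (hy.isBigO_sub.norm_left.pow 2)
  refine h1.trans_isLittleO ?_
  refine Asymptotics.IsLittleO.of_bound fun c hc => ?_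
  filter_upwards [Metric.ball_mem_nhds t₀ hc] with t ht
  rw [Metric.mem_ball, Real.dist_eq] at ht
  rw [Real.norm_eq_abs, Real.norm_eq_abs, abs_pow, sq]
  gcongr

/-- A `C¹` weight whose support is bounded locally uniformly in time is, near any time, bounded
and Lipschitz in time. -/
theorem exists_bound_of_contDiff {κ : ℝ → ℝ → ℝ} (hκ : ContDiff ℝ 1 (fun q : ℝ × ℝ => κ q.1 q.2))
    {t₀ A : ℝ} (hA : ∀ t, |t - t₀| < 1 → ∀ r, A < |r| → κ t r = 0) :
    ∃ C, 0 ≤ C ∧ (∀ t, |t - t₀| < 1 → ∀ r, |κ t r| ≤ C) ∧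
      ∀ t, |t - t₀| < 1 → ∀ r, |deriv (fun s => κ s r) t| ≤ C := by
  have hcont : Continuous fun q : ℝ × ℝ => κ q.1 q.2 := hκ.continuous
  have hd : ∀ q : ℝ × ℝ, deriv (fun s => κ s q.2) q.1
      = fderiv ℝ (fun q : ℝ × ℝ => κ q.1 q.2) q (1, 0) := by
    intro q
    have h1 := (hκ.differentiable (by simp) q).hasFDerivAt
    have h2 : HasDerivAt (fun s : ℝ => (s, q.2)) ((1 : ℝ), (0 : ℝ)) q.1 :=
      (hasDerivAt_id q.1).prodMk (hasDerivAt_const _ _)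
    exact (HasFDerivAt.comp_hasDerivAt q.1 (f := fun s : ℝ => (s, q.2)) h1 h2).deriv
  have hcont' : Continuous fun q : ℝ × ℝ => deriv (fun s => κ s q.2) q.1 := by
    simp only [hd]
    exact (hκ.continuous_fderiv (by simp)).clm_apply continuous_const
  have hK : IsCompact (Icc (t₀ - 1) (t₀ + 1) ×ˢ Icc (-A) A) := isCompact_Icc.prod isCompact_Icc
  obtain ⟨C₁, h1⟩ := hK.exists_bound_of_continuousOn hcont.continuousOn
  obtain ⟨C₂, h2⟩ := hK.exists_bound_of_continuousOn hcont'.continuousOn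
  have hmem : ∀ t, |t - t₀| < 1 → ∀ r, |r| ≤ A →
      ((t, r) : ℝ × ℝ) ∈ Icc (t₀ - 1) (t₀ + 1) ×ˢ Icc (-A) A := fun t ht r hr => by
    rw [abs_lt] at ht
    rw [abs_le] at hr
    exact ⟨⟨by linarith [ht.1], by linarith [ht.2]⟩, hr⟩
  refine ⟨max (max C₁ C₂) 0, le_max_right _ _, fun t ht r => ?_, fun t ht r => ?_⟩
  · rcases le_or_gt |r| A with hr | hr
    · exact (h1 _ (hmem t ht r hr)).trans (by simp)
    · simp [hA t ht r hr]
  · rcases le_or_gt |r| A with hr | hr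
    · exact (h2 _ (hmem t ht r hr)).trans (by simp)
    · have : (fun s => κ s r) =ᶠ[𝓝 t] fun _ => 0 := by
        have ho : IsOpen {s | |s - t₀| < 1} := isOpen_lt (by fun_prop) continuous_const
        filter_upwards [ho.mem_nhds ht] with s hs using hA s hs r hr
      simp [this.deriv_eq]

/-- Differentiation in time of a weighted integral of a nonlinear function of a differentiable
curve in `L²(ℝ)`. -/
theorem hasDerivAt_integral_nonlinear {y : ℝ → L2} {z : L2} {t₀ : ℝ} (hy : HasDerivAt y z t₀)
    {Φ f : ℝ → ℝ} (hΦ : Continuous Φ) (hf : Continuous f) {K : ℝ} (hK : 0 ≤ K)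
    (h1 : ∀ᶠ t in 𝓝 t₀, ∀ᵐ σ, |Φ (y t σ) - Φ (y t₀ σ) - f (y t₀ σ) * (y t σ - y t₀ σ)|
      ≤ K * (y t σ - y t₀ σ) ^ 2)
    (h2 : ∀ᵐ σ, |f (y t₀ σ)| ≤ K * |y t₀ σ|)
    (h3 : ∀ᶠ t in 𝓝 t₀, ∀ᵐ σ, |Φ (y t σ)| ≤ K * (y t σ) ^ 2)
    {κ : ℝ → ℝ → ℝ} (hκ : ContDiff ℝ 1 (fun q : ℝ × ℝ => κ q.1 q.2)) {A : ℝ}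
    (hA : ∀ t, |t - t₀| < 1 → ∀ r, A < |r| → κ t r = 0) :
    HasDerivAt (fun t => ∫ σ, Φ (y t σ) * κ t σ)
      ((∫ σ, f (y t₀ σ) * z σ * κ t₀ σ) + ∫ σ, Φ (y t₀ σ) * deriv (fun s => κ s σ) t₀) t₀ := by
  obtain ⟨C, hC0, hC, hC'⟩ := exists_bound_of_contDiff hκ hA
  have hmemt : ∀ᶠ t in 𝓝 t₀, |t - t₀| < 1 := by
    filter_upwards [Metric.ball_mem_nhds t₀ one_pos] with t ht
    rwa [Metric.mem_ball, Real.dist_eq] at ht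
  have ht₀ : |t₀ - t₀| < 1 := by simp
  have hκc : ∀ t, Continuous (κ t) := fun t =>
    hκ.continuous.comp (Continuous.prodMk continuous_const continuous_id)
  have hdiff : ∀ t r, HasDerivAt (fun s => κ s r) (deriv (fun s => κ s r) t) t := fun t r =>
    (((hκ.differentiable (by simp)).comp
      (differentiable_id.prodMk (differentiable_const r))) t).hasDerivAt
  have hLip : ∀ t, |t - t₀| < 1 → ∀ r, |κ t r - κ t₀ r| ≤ C * |t - t₀| := by
    intro t ht r
    have := (convex_ball t₀ 1).norm_image_sub_le_of_norm_hasDerivWithin_le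
      (f := fun s => κ s r) (f' := fun s => deriv (fun s => κ s r) s) (C := C)
      (fun s _ => (hdiff s r).hasDerivWithinAt)
      (fun s hs => hC' s (by simpa [Real.dist_eq] using hs) r)
      (Metric.mem_ball_self one_pos) (by simpa [Real.dist_eq] using ht : t ∈ Metric.ball t₀ 1)
    simpa using this
  have hmy : ∀ t, AEStronglyMeasurable (y t) volume := fun t => (Lp.memLp (y t)).1
  have hmΦ : ∀ t, AEStronglyMeasurable (fun σ => Φ (y t σ)) volume := fun t =>
    hΦ.comp_aestronglyMeasurable (hmy t)
  have hmf : AEStronglyMeasurable (fun σ => f (y t₀ σ)) volume :=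
    hf.comp_aestronglyMeasurable (hmy t₀)
  have hiΦ : ∀ᶠ t in 𝓝 t₀, Integrable fun σ => Φ (y t σ) := by
    filter_upwards [h3] with t ht
    refine ((integrable_sq_L2 (y t)).const_mul K).mono' (hmΦ t) ht
  have hi0 : Integrable fun σ => Φ (y t₀ σ) := hiΦ.self_of_nhds
  -- The linear part of the Taylor expansion is the pairing with this fixed element of `L²`, hence
  -- differentiable together with the curve.
  have hg : MemLp (fun σ => f (y t₀ σ) * κ t₀ σ) 2 volume := by
    refine MemLp.of_le_mul (g := y t₀) (c := K * C) (Lp.memLp (y t₀))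
      (hmf.mul (hκc t₀).aestronglyMeasurable) ?_
    filter_upwards [h2] with σ hσ
    rw [Real.norm_eq_abs, abs_mul, Real.norm_eq_abs]
    calc _ ≤ K * |y t₀ σ| * C := by gcongr; exact hC t₀ ht₀ σ
      _ = _ := by ring
  set g : L2 := hg.toLp _ with hgdef
  have hpair : ∀ x : L2, inner ℝ g x = ∫ σ, f (y t₀ σ) * x σ * κ t₀ σ := fun x => by
    rw [inner_eq_integral]
    refine integral_congr_ae ?_
    filter_upwards [hg.coeFn_toLp] with σ hσ
    rw [hgdef, hσ]; ring
  have hgi : ∀ x : L2, Integrable fun σ => f (y t₀ σ) * κ t₀ σ * x σ := fun x =>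
    hg.integrable_mul (Lp.memLp x)
  have hsub : ∀ t, ⇑(y t - y t₀) =ᵐ[volume] fun σ => y t σ - y t₀ σ := fun t => Lp.coeFn_sub _ _
  have hisq : ∀ t, Integrable fun σ => (y t σ - y t₀ σ) ^ 2 := fun t =>
    (integrable_sq_L2 (y t - y t₀)).congr ((hsub t).mono fun σ hσ => by simp only [hσ])
  have hsq : ∀ t, ∫ σ, (y t σ - y t₀ σ) ^ 2 = ‖y t - y t₀‖ ^ 2 := fun t => by
    rw [← integral_sq_eq_norm]
    exact integral_congr_ae ((hsub t).mono fun σ hσ => by simp only [hσ])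
  have hiab : ∀ t, Integrable fun σ => |y t₀ σ| * |y t σ - y t₀ σ| := fun t =>
    (integrable_abs_mul_abs (y t₀) (y t - y t₀)).congr
      ((hsub t).mono fun σ hσ => by simp only [hσ])
  have hab : ∀ t, ∫ σ, |y t₀ σ| * |y t σ - y t₀ σ| ≤ ‖y t₀‖ * ‖y t - y t₀‖ := fun t => by
    refine le_trans (le_of_eq ?_) (integral_abs_mul_abs_le (y t₀) (y t - y t₀))
    exact integral_congr_ae ((hsub t).mono fun σ hσ => by simp only [hσ])
  have hiΦκ : ∀ t, Integrable (fun σ => Φ (y t σ)) → ∀ s, |s - t₀| < 1 →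
      Integrable fun σ => Φ (y t σ) * κ s σ := fun t ht s hs =>
    ht.mul_bdd (c := C) (hκc s).aestronglyMeasurable (Eventually.of_forall (hC s hs))
  -- the nonlinear term with frozen weight
  have hA1 : HasDerivAt (fun t => ∫ σ, Φ (y t σ) * κ t₀ σ)
      (∫ σ, f (y t₀ σ) * z σ * κ t₀ σ) t₀ := by
    have hlin : HasDerivAt (fun t => inner ℝ g (y t)) (inner ℝ g z) t₀ := by
      simpa using (hasDerivAt_const t₀ g).inner ℝ hy
    have herr : HasDerivAt (fun t => (∫ σ, Φ (y t σ) * κ t₀ σ) - (∫ σ, Φ (y t₀ σ) * κ t₀ σ)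
        - inner ℝ g (y t - y t₀)) 0 t₀ := by
      refine hasDerivAt_zero_of_abs_le_sq (C := K * C) hy (by simp) ?_
      filter_upwards [h1, hiΦ] with t ht hit
      have e : (∫ σ, Φ (y t σ) * κ t₀ σ) - (∫ σ, Φ (y t₀ σ) * κ t₀ σ)
          - inner ℝ g (y t - y t₀) =
          ∫ σ, (Φ (y t σ) - Φ (y t₀ σ) - f (y t₀ σ) * (y t σ - y t₀ σ)) * κ t₀ σ := by
        rw [hpair, ← integral_sub (hiΦκ t hit t₀ ht₀) (hiΦκ t₀ hi0 t₀ ht₀), ← integral_sub]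
        · refine integral_congr_ae ((hsub t).mono fun σ hσ => ?_)
          simp only [hσ]; ring
        · exact (hiΦκ t hit t₀ ht₀).sub (hiΦκ t₀ hi0 t₀ ht₀)
        · exact (hgi (y t - y t₀)).congr (Eventually.of_forall fun σ => by ring)
      rw [e]
      refine (abs_integral_le_integral_abs).trans ?_
      rw [← hsq, ← integral_const_mul]
      refine integral_mono_of_nonneg (Eventually.of_forall fun σ => abs_nonneg _)
        ((hisq t).const_mul _) ?_
      filter_upwards [ht] with σ hσ
      rw [abs_mul]
      calc _ ≤ K * (y t σ - y t₀ σ) ^ 2 * C := by gcongr; exact hC t₀ ht₀ σ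
        _ = _ := by ring
    have := (hlin.add herr).add_const ((∫ σ, Φ (y t₀ σ) * κ t₀ σ) - inner ℝ g (y t₀))
    rw [add_zero, hpair z] at this
    refine this.congr_of_eventuallyEq (Eventually.of_forall fun t => ?_)
    simp only [Pi.add_apply, inner_sub_right]
    ring
  -- the moving weight with frozen nonlinear term
  have hA2 : HasDerivAt (fun t => ∫ σ, Φ (y t₀ σ) * κ t σ)
      (∫ σ, Φ (y t₀ σ) * deriv (fun s => κ s σ) t₀) t₀ := by
    have hκ'c : Continuous fun σ => deriv (fun s => κ s σ) t₀ := by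
      have : (fun σ => deriv (fun s => κ s σ) t₀) = fun σ =>
          fderiv ℝ (fun q : ℝ × ℝ => κ q.1 q.2) (t₀, σ) (1, 0) := by
        funext σ
        have h2 : HasDerivAt (fun s : ℝ => (s, σ)) ((1 : ℝ), (0 : ℝ)) t₀ :=
          (hasDerivAt_id t₀).prodMk (hasDerivAt_const _ _)
        exact (HasFDerivAt.comp_hasDerivAt t₀ (f := fun s : ℝ => (s, σ))
          (hκ.differentiable (by simp) (t₀, σ)).hasFDerivAt h2).deriv
      rw [this]
      exact ((hκ.continuous_fderiv (by simp)).comp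
        (Continuous.prodMk continuous_const continuous_id)).clm_apply continuous_const
    refine (hasDerivAt_integral_of_dominated_loc_of_deriv_le
      (F := fun t σ => Φ (y t₀ σ) * κ t σ)
      (F' := fun t σ => Φ (y t₀ σ) * deriv (fun s => κ s σ) t)
      (bound := fun σ => |Φ (y t₀ σ)| * C) hmemt
      (Eventually.of_forall fun t => (hmΦ t₀).mul (hκc t).aestronglyMeasurable)
      (hiΦκ t₀ hi0 t₀ ht₀) ((hmΦ t₀).mul hκ'c.aestronglyMeasurable)
      (Eventually.of_forall fun σ t ht => ?_) (hi0.abs.mul_const _)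
      (Eventually.of_forall fun σ t _ => (hdiff t σ).const_mul _)).2
    rw [Real.norm_eq_abs, abs_mul]
    gcongr
    exact hC' t ht σ
  -- the mixed error
  have hA3 : HasDerivAt (fun t => ∫ σ, (Φ (y t σ) - Φ (y t₀ σ)) * (κ t σ - κ t₀ σ)) 0 t₀ := by
    rw [hasDerivAt_iff_isLittleO]
    have hbd : ∀ᶠ t in 𝓝 t₀, |∫ σ, (Φ (y t σ) - Φ (y t₀ σ)) * (κ t σ - κ t₀ σ)| ≤
        (K * ‖y t - y t₀‖ ^ 2 + K * (‖y t₀‖ * ‖y t - y t₀‖)) * (C * |t - t₀|) := by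
      filter_upwards [h1, hmemt] with t ht htt
      refine (abs_integral_le_integral_abs).trans ?_
      have hint : Integrable fun σ =>
          (K * (y t σ - y t₀ σ) ^ 2 + K * (|y t₀ σ| * |y t σ - y t₀ σ|)) * (C * |t - t₀|) :=
        (((hisq t).const_mul K).add ((hiab t).const_mul K)).mul_const _
      calc _ ≤ ∫ σ, (K * (y t σ - y t₀ σ) ^ 2 + K * (|y t₀ σ| * |y t σ - y t₀ σ|))
            * (C * |t - t₀|) := by
            refine integral_mono_of_nonneg (Eventually.of_forall fun σ => abs_nonneg _) hint ?_
            filter_upwards [ht, h2] with σ hσ hσ2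
            rw [abs_mul]
            have e1 : |Φ (y t σ) - Φ (y t₀ σ)| ≤
                K * (y t σ - y t₀ σ) ^ 2 + K * (|y t₀ σ| * |y t σ - y t₀ σ|) := by
              have : |f (y t₀ σ) * (y t σ - y t₀ σ)| ≤ K * (|y t₀ σ| * |y t σ - y t₀ σ|) := by
                rw [abs_mul, ← mul_assoc]
                gcongr
              have e2 := abs_add_le (Φ (y t σ) - Φ (y t₀ σ) - f (y t₀ σ) * (y t σ - y t₀ σ))
                (f (y t₀ σ) * (y t σ - y t₀ σ))
              rw [sub_add_cancel] at e2
              linarith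
            gcongr
            exact hLip t htt σ
        _ = (K * ‖y t - y t₀‖ ^ 2 + K * ∫ σ, |y t₀ σ| * |y t σ - y t₀ σ|) * (C * |t - t₀|) := by
            rw [integral_mul_const, integral_add ((hisq t).const_mul K) ((hiab t).const_mul K),
              integral_const_mul, integral_const_mul, hsq]
        _ ≤ _ := by gcongr; exact hab t
    have hlim : Tendsto (fun t => (K * ‖y t - y t₀‖ ^ 2 + K * (‖y t₀‖ * ‖y t - y t₀‖)) * C)
        (𝓝 t₀) (𝓝 0) := by
      have hc : Tendsto (fun t => ‖y t - y t₀‖) (𝓝 t₀) (𝓝 0) :=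
        tendsto_iff_norm_sub_tendsto_zero.1 hy.continuousAt
      have := (((hc.pow 2).const_mul K).add ((hc.const_mul ‖y t₀‖).const_mul K)).mul_const C
      simpa using this
    refine Asymptotics.IsLittleO.of_bound fun c hc => ?_
    filter_upwards [hbd, hlim.eventually_lt_const hc] with t ht1 ht2
    simp only [sub_self, integral_zero, sub_zero, smul_zero, mul_zero,
      Real.norm_eq_abs]
    refine ht1.trans ?_
    rw [← mul_assoc]
    gcongr
  have hfin := (hA1.add hA2).add hA3
  rw [add_zero] at hfin
  have hfin2 := hfin.sub_const (∫ σ, Φ (y t₀ σ) * κ t₀ σ)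
  refine hfin2.congr_of_eventuallyEq ?_
  filter_upwards [hiΦ, hmemt] with t hit htt
  simp only [Pi.add_apply]
  rw [eq_sub_iff_add_eq]
  have i1 := hiΦκ t hit t₀ ht₀
  have i2 := hiΦκ t₀ hi0 t htt
  have i3 := hiΦκ t hit t htt
  have i4 := hiΦκ t₀ hi0 t₀ ht₀
  -- Expanding the mixed difference shows that `Φ(y) κ` is the sum of the two partially frozen terms
  -- and the mixed error, minus the fully frozen term.
  have e : (fun σ => (Φ (y t σ) - Φ (y t₀ σ)) * (κ t σ - κ t₀ σ)) = fun σ =>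
      (Φ (y t σ) * κ t σ + Φ (y t₀ σ) * κ t₀ σ) - (Φ (y t σ) * κ t₀ σ + Φ (y t₀ σ) * κ t σ) := by
    funext σ; ring
  have e' := (integral_sub (i3.add i4) (i1.add i2)).trans
    (congrArg₂ _ (integral_add i3 i4) (integral_add i1 i2))
  simp only [Pi.add_apply] at e'
  rw [e, e']
  ring

/-- Time derivative of a weighted nonlinear integral along a transport equation. -/
theorem Transport.hasDerivAt_integral {c : ℝ} {Y Z : ℝ → L2} (h : Transport c Y Z) {t₀ : ℝ}
    {Φ f : ℝ → ℝ} (hΦ : Continuous Φ) (hf : Continuous f) {K : ℝ} (hK : 0 ≤ K) {s : Set ℝ}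
    (hs : ∀ᶠ t in 𝓝 t₀, ∀ᵐ r, Y t r ∈ s)
    (h1 : ∀ a ∈ s, ∀ b ∈ s, |Φ b - Φ a - f a * (b - a)| ≤ K * (b - a) ^ 2)
    (h2 : ∀ a ∈ s, |f a| ≤ K * |a|) (h3 : ∀ a ∈ s, |Φ a| ≤ K * a ^ 2)
    {κ : ℝ → ℝ → ℝ} (hκ : ContDiff ℝ 1 (fun q : ℝ × ℝ => κ q.1 q.2)) {A : ℝ}
    (hA : ∀ t, |t - t₀| < 1 → ∀ r, A < |r| → κ t r = 0) {κ' : ℝ → ℝ}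
    (hκ' : ∀ r, HasDerivAt (fun t => κ t (r + c * (t - t₀))) (κ' r) t₀) :
    HasDerivAt (fun t => ∫ r, Φ (Y t r) * κ t r)
      ((∫ r, f (Y t₀ r) * Z t₀ r * κ t₀ r) + ∫ r, Φ (Y t₀ r) * κ' r) t₀ := by
  have hsh : ∀ t (x : L2), ∀ᵐ σ, shift (c * t) x σ = x (σ + c * t) := fun t x => shift_coe _ x
  have hs' : ∀ᶠ t in 𝓝 t₀, ∀ᵐ σ, shift (c * t) (Y t) σ ∈ s := by
    filter_upwards [hs] with t ht
    have := (measurePreserving_add_right volume (c * t)).quasiMeasurePreserving.ae ht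
    filter_upwards [hsh t (Y t), this] with σ e1 e2
    rwa [e1]
  have hs0 := hs'.self_of_nhds
  -- In the moving frame the weight is `κ t (σ + c t)`, whose time derivative is the derivative of
  -- `κ` along characteristics. For `|t - t₀| < 1` the displacement `c t` is at most `|c| (|t₀| +
  -- 1)`, which is how much the support bound grows.
  have hmain := hasDerivAt_integral_nonlinear (κ := fun t σ => κ t (σ + c * t))
    (A := A + |c| * (|t₀| + 1)) (h.hasDerivAt_shift t₀) hΦ hf hK
    (by filter_upwards [hs'] with t ht
        filter_upwards [ht, hs0] with σ e1 e2 using h1 _ e2 _ e1)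
    (by filter_upwards [hs0] with σ e using h2 _ e)
    (by filter_upwards [hs'] with t ht
        filter_upwards [ht] with σ e using h3 _ e)
    (by
      have : ContDiff ℝ 1 fun q : ℝ × ℝ => (q.1, q.2 + c * q.1) := by fun_prop
      exact hκ.comp this)
    (fun t ht r hr => hA t ht _ (by
      have e1 : |c * t| ≤ |c| * (|t₀| + 1) := by
        rw [abs_mul]
        gcongr
        have := abs_sub_abs_le_abs_sub t t₀
        linarith
      have e2 := abs_sub_abs_le_abs_sub r (-(c * t))
      rw [abs_neg, sub_neg_eq_add] at e2
      linarith))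
  have key : ∀ F : ℝ → ℝ, ∫ σ, F (σ + c * t₀) = ∫ r, F r := fun F => integral_shift _ F
  have e0 : ∀ t, ∫ σ, Φ (shift (c * t) (Y t) σ) * κ t (σ + c * t) = ∫ r, Φ (Y t r) * κ t r := by
    intro t
    refine Eq.trans (integral_congr_ae ?_) (integral_shift (c * t) fun r => Φ (Y t r) * κ t r)
    filter_upwards [hsh t (Y t)] with σ e
    simp only [e]
  simp only [e0] at hmain
  refine hmain.congr_deriv ?_
  congr 1
  · refine Eq.trans (integral_congr_ae ?_) (key fun r => f (Y t₀ r) * Z t₀ r * κ t₀ r)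
    filter_upwards [hsh t₀ (Y t₀), hsh t₀ (Z t₀)] with σ e e'
    simp only [e, e']
  · refine Eq.trans (integral_congr_ae ?_) (key fun r => Φ (Y t₀ r) * κ' r)
    filter_upwards [hsh t₀ (Y t₀)] with σ e
    simp only [e]
    congr 1
    rw [← (hκ' (σ + c * t₀)).deriv]
    congr 1
    funext t
    congr 1
    ring

end RadialWave

/-! ### The half-line system and its localization away from the origin -/

namespace RadialWave

/-- The profile equations of a radial wave on the half line, written as transport equations:
`(∂ₜ + ∂ᵣ) w = V` and `(∂ₜ - ∂ᵣ) V = -|w|^{p-1} w r^{1-p}` for `r > 0`. -/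
structure InwardWave (p : ℝ) (w : ℝ → ℝ → ℝ) (V : ℝ → L2) : Prop where
  continuousOn : ContinuousOn (fun q : ℝ × ℝ => w q.1 q.2) (univ ×ˢ Ioi 0)
  growth : ∃ N : ℝ → ℝ, Continuous N ∧ ∀ t r, 0 < r → |w t r| ≤ √r * N t
  continuous_V : Continuous V
  deriv_w : ∀ β : ℝ → ℝ, ContDiff ℝ ∞ β → HasCompactSupport β → tsupport β ⊆ Ioi 0 → ∀ t,
    HasDerivAt (fun s => ∫ r, w s r * β r) ((∫ r, V t r * β r) + ∫ r, w t r * deriv β r) t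
  deriv_V : ∀ β : ℝ → ℝ, ContDiff ℝ ∞ β → HasCompactSupport β → tsupport β ⊆ Ioi 0 → ∀ t,
    HasDerivAt (fun s => ∫ r, V s r * β r)
      (-(∫ r, V t r * deriv β r) - ∫ r, |w t r| ^ (p - 1) * w t r * r ^ (1 - p) * β r) t

theorem exists_continuous_mul {χ : ℝ → ℝ} (hχ : Continuous χ) (hc : HasCompactSupport χ)
    {V : ℝ → L2} (hV : Continuous V) :
    ∃ G : ℝ → L2, Continuous G ∧ ∀ t, G t =ᵐ[volume] fun r => χ r * V t r := by
  obtain ⟨C, hC⟩ := exists_forall_abs_le hχ hc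
  have hm : ∀ f : L2, MemLp (fun r => χ r * f r) 2 volume := fun f =>
    (Lp.memLp f).of_le_mul (c := C) (hχ.aestronglyMeasurable.mul (Lp.memLp f).1)
      (Eventually.of_forall fun r => by
        rw [Real.norm_eq_abs, abs_mul, Real.norm_eq_abs]
        exact mul_le_mul_of_nonneg_right (hC r) (abs_nonneg _))
  refine ⟨fun t => (hm (V t)).toLp _, continuous_iff_continuousAt.2 fun t₀ => ?_,
    fun t => (hm (V t)).coeFn_toLp⟩
  refine tendsto_iff_norm_sub_tendsto_zero.2 ?_
  have h0 : Tendsto (fun t => C * ‖V t - V t₀‖) (𝓝 t₀) (𝓝 0) := by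
    simpa using (tendsto_iff_norm_sub_tendsto_zero.1 hV.continuousAt).const_mul C
  refine squeeze_zero (fun _ => norm_nonneg _) (fun t => ?_) h0
  refine Lp.norm_le_mul_norm_of_ae_le_mul ?_
  filter_upwards [Lp.coeFn_sub ((hm (V t)).toLp _) ((hm (V t₀)).toLp _), (hm (V t)).coeFn_toLp,
    (hm (V t₀)).coeFn_toLp, Lp.coeFn_sub (V t) (V t₀)] with r e1 e2 e3 e4
  rw [e1, e4, Pi.sub_apply, Pi.sub_apply, e2, e3, ← mul_sub, Real.norm_eq_abs, abs_mul,
    Real.norm_eq_abs]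
  exact mul_le_mul_of_nonneg_right (hC r) (abs_nonneg _)

/-- A function continuous on an open set becomes continuous when multiplied by a cutoff. -/
theorem continuous_mul_cutoff {χ : ℝ → ℝ} (hχ : Continuous χ)
    (hs : tsupport χ ⊆ Ioi 0) {g : ℝ → ℝ → ℝ}
    (hg : ContinuousOn (fun q : ℝ × ℝ => g q.1 q.2) (univ ×ˢ Ioi 0)) :
    Continuous fun q : ℝ × ℝ => χ q.2 * g q.1 q.2 := by
  rw [continuous_iff_continuousAt]
  rintro ⟨t, r⟩
  by_cases hr : r ∈ tsupport χ
  · have : (univ ×ˢ Ioi (0 : ℝ)) ∈ 𝓝 ((t, r) : ℝ × ℝ) :=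
      (isOpen_univ.prod isOpen_Ioi).mem_nhds ⟨mem_univ _, hs hr⟩
    exact (hχ.comp continuous_snd).continuousAt.mul (hg.continuousAt this)
  · have h0 : (fun q : ℝ × ℝ => χ q.2 * g q.1 q.2) =ᶠ[𝓝 (t, r)] fun _ => 0 := by
      have : (tsupport χ)ᶜ ∈ 𝓝 r := (isClosed_tsupport χ).isOpen_compl.mem_nhds hr
      filter_upwards [continuousAt_snd.preimage_mem_nhds this] with q hq
      simp [image_eq_zero_of_notMem_tsupport hq]
    exact continuousAt_const.congr h0.symm

/-- The squared `L²` distance between two times is a parametric integral of a jointly continuous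
function over the fixed compact support, so it is continuous in time and vanishes at equal times. -/
theorem exists_continuous_cutoff {χ : ℝ → ℝ} (hχ : Continuous χ) (hc : HasCompactSupport χ)
    (hs : tsupport χ ⊆ Ioi 0) {g : ℝ → ℝ → ℝ}
    (hg : ContinuousOn (fun q : ℝ × ℝ => g q.1 q.2) (univ ×ˢ Ioi 0)) :
    ∃ G : ℝ → L2, Continuous G ∧ ∀ t, G t =ᵐ[volume] fun r => χ r * g t r := by
  have hcont := continuous_mul_cutoff hχ hs hg
  have hct : ∀ t, Continuous fun r => χ r * g t r := fun t =>
    hcont.comp (Continuous.prodMk continuous_const continuous_id)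
  have hm : ∀ t, MemLp (fun r => χ r * g t r) 2 volume := fun t =>
    (hct t).memLp_of_hasCompactSupport hc.mul_right
  refine ⟨fun t => (hm t).toLp _, continuous_iff_continuousAt.2 fun t₀ => ?_,
    fun t => (hm t).coeFn_toLp⟩
  refine tendsto_iff_norm_sub_tendsto_zero.2 ?_
  have hsq : ∀ t, ‖(hm t).toLp _ - (hm t₀).toLp _‖ ^ 2
      = ∫ r in tsupport χ, (χ r * g t r - χ r * g t₀ r) ^ 2 := by
    intro t
    rw [← integral_sq_eq_norm, setIntegral_eq_integral_of_forall_compl_eq_zero]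
    · refine integral_congr_ae ?_
      filter_upwards [Lp.coeFn_sub ((hm t).toLp _) ((hm t₀).toLp _), (hm t).coeFn_toLp,
        (hm t₀).coeFn_toLp] with r e1 e2 e3
      rw [e1, Pi.sub_apply, e2, e3]
    · intro r hr
      simp [image_eq_zero_of_notMem_tsupport hr]
  have hlim : Continuous fun t => ∫ r in tsupport χ, (χ r * g t r - χ r * g t₀ r) ^ 2 := by
    refine continuous_parametric_integral_of_continuous ?_ hc
    have h0 : Continuous fun q : ℝ × ℝ => χ q.2 * g t₀ q.2 := (hct t₀).comp continuous_snd
    exact (hcont.sub h0).pow 2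
  have h1 := hlim.tendsto t₀
  simp only [← hsq] at h1
  have h2 := h1.sqrt
  simpa using h2

theorem continuousOn_source {p : ℝ} (hp : 1 < p) {w : ℝ → ℝ → ℝ}
    (hw : ContinuousOn (fun q : ℝ × ℝ => w q.1 q.2) (univ ×ˢ Ioi 0)) :
    ContinuousOn (fun q : ℝ × ℝ => -(|w q.1 q.2| ^ (p - 1) * w q.1 q.2 * q.2 ^ (1 - p)))
      (univ ×ˢ Ioi 0) := by
  refine ((ContinuousOn.mul (ContinuousOn.rpow_const hw.abs fun q _ => ?_) hw).mul
    (continuousOn_snd.rpow_const fun q hq => Or.inl (ne_of_gt hq.2))).neg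
  exact Or.inr (by linarith)

theorem integrable_test_mul {b : ℝ → ℝ} (hb : Continuous b) (hc : HasCompactSupport b) (y : L2) :
    Integrable fun r => b r * y r :=
  (hb.memLp_of_hasCompactSupport hc (p := 2)).integrable_mul (Lp.memLp y)

/-- The localized inward wave is transported towards the origin. -/
theorem InwardWave.exists_transport_V {p : ℝ} (hp : 1 < p) {w : ℝ → ℝ → ℝ} {V : ℝ → L2}
    (h : InwardWave p w V) {χ : ℝ → ℝ} (hχ : ContDiff ℝ ∞ χ) (hc : HasCompactSupport χ)
    (hs : tsupport χ ⊆ Ioi 0) :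
    ∃ Y Z : ℝ → L2, Transport (-1) Y Z ∧ (∀ t, Y t =ᵐ[volume] fun r => χ r * V t r) ∧
      ∀ t, Z t =ᵐ[volume] fun r =>
        χ r * (-(|w t r| ^ (p - 1) * w t r * r ^ (1 - p))) - deriv χ r * V t r := by
  have hχ' : Continuous (deriv χ) := hχ.continuous_deriv (by simp)
  obtain ⟨Y, hY, eY⟩ := exists_continuous_mul hχ.continuous hc h.continuous_V
  obtain ⟨G, hG, eG⟩ := exists_continuous_mul hχ' hc.deriv h.continuous_V
  obtain ⟨S, hS, eS⟩ := exists_continuous_cutoff hχ.continuous hc hs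
    (g := fun t r => -(|w t r| ^ (p - 1) * w t r * r ^ (1 - p))) (continuousOn_source hp h.continuousOn)
  refine ⟨Y, fun t => S t - G t, ⟨hY, hS.sub hG, fun b hb hbc t => ?_⟩, eY, fun t => ?_⟩
  · have hcb : HasCompactSupport fun r => χ r * b r := hc.mul_right
    have hd := h.deriv_V (fun r => χ r * b r) (hχ.mul hb) hcb
      ((tsupport_mul_subset_left).trans hs) t
    have e1 : ∀ s, ∫ r, V s r * (χ r * b r) = ∫ r, b r * Y s r := fun s =>
      integral_congr_ae ((eY s).mono fun r hr => by simp only [hr]; ring)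
    simp only [e1] at hd
    refine hd.congr_deriv ?_
    have hb' : Continuous (deriv b) := hb.continuous_deriv (by simp)
    have e2 : ∫ r, V t r * deriv (fun r => χ r * b r) r
        = (∫ r, b r * G t r) + ∫ r, deriv b r * Y t r := by
      rw [← integral_add (integrable_test_mul hb.continuous hbc _)
        (integrable_test_mul hb' hbc.deriv _)]
      refine integral_congr_ae ?_
      filter_upwards [eY t, eG t] with r hr1 hr2
      rw [deriv_fun_mul (hχ.differentiable (by simp) r) (hb.differentiable (by simp) r), hr1, hr2]
      ring
    have e3 : ∫ r, |w t r| ^ (p - 1) * w t r * r ^ (1 - p) * (χ r * b r)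
        = -∫ r, b r * S t r := by
      rw [← integral_neg]
      exact integral_congr_ae ((eS t).mono fun r hr => by simp only [hr]; ring)
    have e4 : ∫ r, b r * (S t - G t : L2) r = (∫ r, b r * S t r) - ∫ r, b r * G t r := by
      rw [← integral_sub (integrable_test_mul hb.continuous hbc _)
        (integrable_test_mul hb.continuous hbc _)]
      exact integral_congr_ae ((Lp.coeFn_sub (S t) (G t)).mono fun r hr => by
        simp only [hr, Pi.sub_apply]; ring)
    rw [e2, e3, e4]
    ring
  · filter_upwards [Lp.coeFn_sub (S t) (G t), eS t, eG t] with r h1 h2 h3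
    rw [h1, Pi.sub_apply, h2, h3]

/-- The localized profile is transported away from the origin. -/
theorem InwardWave.exists_transport_w {p : ℝ} {w : ℝ → ℝ → ℝ} {V : ℝ → L2}
    (h : InwardWave p w V) {χ : ℝ → ℝ} (hχ : ContDiff ℝ ∞ χ) (hc : HasCompactSupport χ)
    (hs : tsupport χ ⊆ Ioi 0) :
    ∃ Y Z : ℝ → L2, Transport 1 Y Z ∧ (∀ t, Y t =ᵐ[volume] fun r => χ r * w t r) ∧
      ∀ t, Z t =ᵐ[volume] fun r => χ r * V t r + deriv χ r * w t r := by
  have hχ' : Continuous (deriv χ) := hχ.continuous_deriv (by simp)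
  have hs' : tsupport (deriv χ) ⊆ Ioi 0 := (tsupport_deriv_subset).trans hs
  obtain ⟨Y, hY, eY⟩ := exists_continuous_cutoff hχ.continuous hc hs h.continuousOn
  obtain ⟨G, hG, eG⟩ := exists_continuous_cutoff hχ' hc.deriv hs' h.continuousOn
  obtain ⟨S, hS, eS⟩ := exists_continuous_mul hχ.continuous hc h.continuous_V
  refine ⟨Y, fun t => S t + G t, ⟨hY, hS.add hG, fun b hb hbc t => ?_⟩, eY, fun t => ?_⟩
  · have hcb : HasCompactSupport fun r => χ r * b r := hc.mul_right
    have hd := h.deriv_w (fun r => χ r * b r) (hχ.mul hb) hcb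
      ((tsupport_mul_subset_left).trans hs) t
    have e1 : ∀ s, ∫ r, w s r * (χ r * b r) = ∫ r, b r * Y s r := fun s =>
      integral_congr_ae ((eY s).mono fun r hr => by simp only [hr]; ring)
    simp only [e1] at hd
    refine hd.congr_deriv ?_
    have hb' : Continuous (deriv b) := hb.continuous_deriv (by simp)
    have e2 : ∫ r, w t r * deriv (fun r => χ r * b r) r
        = (∫ r, b r * G t r) + ∫ r, deriv b r * Y t r := by
      rw [← integral_add (integrable_test_mul hb.continuous hbc _)
        (integrable_test_mul hb' hbc.deriv _)]
      refine integral_congr_ae ?_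
      filter_upwards [eY t, eG t] with r hr1 hr2
      rw [deriv_fun_mul (hχ.differentiable (by simp) r) (hb.differentiable (by simp) r), hr1, hr2]
      ring
    have e3 : ∫ r, V t r * (χ r * b r) = ∫ r, b r * S t r :=
      integral_congr_ae ((eS t).mono fun r hr => by simp only [hr]; ring)
    have e4 : ∫ r, b r * (S t + G t : L2) r = (∫ r, b r * S t r) + ∫ r, b r * G t r := by
      rw [← integral_add (integrable_test_mul hb.continuous hbc _)
        (integrable_test_mul hb.continuous hbc _)]
      exact integral_congr_ae ((Lp.coeFn_add (S t) (G t)).mono fun r hr => by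
        simp only [hr, Pi.add_apply]; ring)
    rw [e2, e3, e4]
    ring
  · filter_upwards [Lp.coeFn_add (S t) (G t), eS t, eG t] with r h1 h2 h3
    rw [h1, Pi.add_apply, h2, h3]

/-- Quadratic bounds for the power nonlinearity on bounded intervals. -/
theorem exists_power_taylor {q : ℝ} (hq : 4 ≤ q) (B : ℝ) :
    ∃ K, 0 ≤ K ∧
      (∀ a ∈ Icc (-B) B, ∀ b ∈ Icc (-B) B,
        |(|b| ^ q) - |a| ^ q - q * |a| ^ (q - 2) * a * (b - a)| ≤ K * (b - a) ^ 2) ∧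
      (∀ a ∈ Icc (-B) B, |q * |a| ^ (q - 2) * a| ≤ K * |a|) ∧
      ∀ a ∈ Icc (-B) B, |(|a| ^ q)| ≤ K * a ^ 2 := by
  have hf : ContDiff ℝ 1 fun a : ℝ => q * |a| ^ (q - 2) * a :=
    (contDiff_const.mul (contDiff_norm_rpow (E := ℝ) (by linarith : 1 < q - 2))).mul contDiff_id
  -- The function `q |a|^{q-2} a` is `C¹` because `q - 2 > 1`, hence Lipschitz on the interval. The
  -- mean value inequality applied to the Taylor remainder turns this into the quadratic bound.
  obtain ⟨L, hL⟩ := hf.contDiffOn.exists_lipschitzOnWith (by simp) (convex_Icc (-B) B)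
    isCompact_Icc
  have hpow : ∀ a ∈ Icc (-B) B, |a| ^ (q - 2) ≤ |B| ^ (q - 2) := fun a ha =>
    Real.rpow_le_rpow (abs_nonneg _) ((abs_le.2 ha).trans (le_abs_self B)) (by linarith)
  have hB : 0 ≤ |B| ^ (q - 2) := Real.rpow_nonneg (abs_nonneg _) _
  refine ⟨L + q * |B| ^ (q - 2), by positivity, fun a ha b hb => ?_, fun a ha => ?_,
    fun a ha => ?_⟩
  · have hd : ∀ x, HasDerivAt (fun x : ℝ => |x| ^ q - |a| ^ q - q * |a| ^ (q - 2) * a * (x - a))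
        (q * |x| ^ (q - 2) * x - q * |a| ^ (q - 2) * a) x := fun x => by
      have h1 := ((hasDerivAt_abs_rpow x (by linarith : 1 < q)).sub_const (|a| ^ q)).sub
        (((hasDerivAt_id x).sub_const a).const_mul (q * |a| ^ (q - 2) * a))
      rw [mul_one] at h1
      exact h1
    have hsub : uIcc a b ⊆ Icc (-B) B := by
      rw [uIcc]
      exact Icc_subset_Icc (le_min ha.1 hb.1) (max_le ha.2 hb.2)
    have := (convex_uIcc a b).norm_image_sub_le_of_norm_hasDerivWithin_le (C := L * |b - a|)
      (fun x _ => (hd x).hasDerivWithinAt) (fun x hx => ?_) left_mem_uIcc right_mem_uIcc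
    · simp only [sub_self, mul_zero, sub_zero, Real.norm_eq_abs] at this
      refine this.trans ?_
      rw [mul_assoc, ← abs_mul, ← sq, abs_of_nonneg (sq_nonneg _)]
      have h0 : 0 ≤ q * |B| ^ (q - 2) := by positivity
      nlinarith [sq_nonneg (b - a)]
    · have := hL.dist_le_mul x (hsub hx) a ha
      rw [Real.dist_eq, Real.dist_eq] at this
      rw [Real.norm_eq_abs]
      refine this.trans ?_
      exact mul_le_mul_of_nonneg_left (abs_sub_left_of_mem_uIcc hx) L.2
  · rw [abs_mul, abs_mul, abs_of_nonneg (by linarith : 0 ≤ q),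
      abs_of_nonneg (Real.rpow_nonneg (abs_nonneg a) _)]
    have := hpow a ha
    have hq0 : 0 ≤ q := by linarith
    gcongr
    calc q * |a| ^ (q - 2) ≤ q * |B| ^ (q - 2) := by gcongr
      _ ≤ _ := by linarith [L.2]
  · rw [abs_of_nonneg (Real.rpow_nonneg (abs_nonneg a) _)]
    have e : |a| ^ q = |a| ^ (q - 2) * a ^ 2 := by
      rw [← sq_abs a, ← Real.rpow_natCast, ← Real.rpow_add_of_nonneg (abs_nonneg a) (by linarith)
        (by positivity)]
      norm_num
    rw [e]
    have h1 := hpow a ha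
    have h2 : (L : ℝ) ≥ 0 := L.2
    gcongr
    nlinarith

/-- Where an energy weight lives, the cutoff is `1` with zero derivative, so there the localized
quantities and their sources agree with the original ones. -/
theorem exists_cutoff {δ R : ℝ} (hδ : 0 < δ) :
    ∃ χ : ℝ → ℝ, ContDiff ℝ ∞ χ ∧ HasCompactSupport χ ∧ tsupport χ ⊆ Ioi 0 ∧
      ∀ r, δ ≤ r → r ≤ R → χ r = 1 ∧ deriv χ r = 0 := by
  have hc : δ ≤ |R| + δ := by linarith [abs_nonneg R]
  -- The inner ball reaches down to `δ / 2` and beyond `R` on the right, so the bump is `1` near all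
  -- of `[δ, R]`. The outer ball stops at `δ / 4 > 0`.
  let f : ContDiffBump (|R| + δ) := ⟨|R| + δ - δ / 2, |R| + δ - δ / 4, by linarith, by linarith⟩
  have h1 : ∀ r, δ / 2 < r → r < 2 * |R| + 2 * δ - δ / 2 → f r = 1 := fun r h1 h2 => by
    refine f.one_of_mem_closedBall ?_
    rw [Metric.mem_closedBall, Real.dist_eq, abs_le]
    constructor <;> simp only [f] <;> linarith
  refine ⟨f, f.contDiff, f.hasCompactSupport, ?_, fun r hr1 hr2 => ?_⟩
  · rw [f.tsupport_eq]
    intro r hr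
    rw [Metric.mem_closedBall, Real.dist_eq, abs_le] at hr
    simp only [f] at hr
    rw [mem_Ioi]
    linarith [hr.1]
  · have hR := le_abs_self R
    have h0 := abs_nonneg R
    refine ⟨h1 r (by linarith) (by linarith), ?_⟩
    have : (f : ℝ → ℝ) =ᶠ[𝓝 r] fun _ => 1 := by
      filter_upwards [Ioo_mem_nhds (show δ / 2 < r by linarith)
        (show r < 2 * |R| + 2 * δ - δ / 2 by linarith)] with x hx using h1 x hx.1 hx.2
    rw [this.deriv_eq, deriv_const]

end RadialWave

/-! ### The weighted energy identity -/

namespace RadialWave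

theorem contDiff_mul_of_eq_zero {n : WithTop ℕ∞} {ψ g : ℝ → ℝ} (hψ : ContDiff ℝ n ψ) {δ : ℝ}
    (hδ : 0 < δ) (h0 : ∀ r ≤ δ, ψ r = 0) (hg : ContDiffOn ℝ n g (Ioi 0)) :
    ContDiff ℝ n fun r => ψ r * g r := by
  rw [contDiff_iff_contDiffAt]
  intro r
  rcases lt_or_ge r δ with hr | hr
  · have : (fun r => ψ r * g r) =ᶠ[𝓝 r] fun _ => 0 := by
      filter_upwards [Iio_mem_nhds hr] with x hx
      rw [h0 x (le_of_lt hx), zero_mul]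
    exact contDiffAt_const.congr_of_eventuallyEq this
  · exact hψ.contDiffAt.mul (hg.contDiffAt (Ioi_mem_nhds (hδ.trans_le hr)))

/-- The energy identity with a weight `ψ(r) Θ(r + t)` supported away from the origin. -/
theorem InwardWave.hasDerivAt_energy {p : ℝ} (hp : 3 ≤ p) {w : ℝ → ℝ → ℝ} {V : ℝ → L2}
    (h : InwardWave p w V) {ψ Θ : ℝ → ℝ} (hψ : ContDiff ℝ 1 ψ) (hΘ : ContDiff ℝ 1 Θ) {δ S : ℝ}
    (hδ : 0 < δ) (hψ0 : ∀ r ≤ δ, ψ r = 0) (hΘ0 : ∀ ρ, S ≤ ρ → Θ ρ = 0) (t₀ : ℝ) :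
    HasDerivAt (fun t => (∫ r, V t r ^ 2 * (ψ r * Θ (r + t))) +
        ∫ r, |w t r| ^ (p + 1) * (2 / (p + 1) * (ψ r * r ^ (1 - p) * Θ (r + t))))
      ((∫ r, V t₀ r ^ 2 * (-(deriv ψ r * Θ (r + t₀)))) +
        ∫ r, |w t₀ r| ^ (p + 1) * (2 / (p + 1) * (deriv (fun r => ψ r * r ^ (1 - p)) r * Θ (r + t₀)
          + ψ r * r ^ (1 - p) * (deriv Θ (r + t₀) * 2)))) t₀ := by
  -- For `|t - t₀| < 1` the weight is nonzero only where `r > δ` and `r + t < S`, hence where `r < S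
  -- - t₀ + 1`.
  obtain ⟨χ, hχ, hχc, hχs, hχ1⟩ := exists_cutoff (R := S - t₀ + 1) hδ
  obtain ⟨Y₁, Z₁, T₁, eY₁, eZ₁⟩ := h.exists_transport_V (by linarith) hχ hχc hχs
  obtain ⟨Y₂, Z₂, T₂, eY₂, eZ₂⟩ := h.exists_transport_w hχ hχc hχs
  have hP : ContDiff ℝ 1 fun r => ψ r * r ^ (1 - p) :=
    contDiff_mul_of_eq_zero hψ hδ hψ0 fun r hr =>
      (Real.contDiffAt_rpow_const_of_ne (ne_of_gt hr)).contDiffWithinAt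
  set P : ℝ → ℝ := fun r => ψ r * r ^ (1 - p) with hPdef
  have hψd := hψ.differentiable (by simp)
  have hΘd := hΘ.differentiable (by simp)
  have hPd := hP.differentiable (by simp)
  have hA : ∀ t, |t - t₀| < 1 → ∀ r, |S| + |t₀| + 1 + δ < |r| → ψ r * Θ (r + t) = 0 := by
    intro t ht r hr
    rw [abs_lt] at ht
    rcases le_or_gt r δ with h1 | h1
    · rw [hψ0 r h1, zero_mul]
    · rw [hΘ0, mul_zero]
      rw [abs_of_pos (hδ.trans h1)] at hr
      linarith [le_abs_self S, neg_abs_le t₀]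
  have hsupp : ∀ t, |t - t₀| < 1 → ∀ r, (χ r = 1 ∧ deriv χ r = 0) ∨ ψ r = 0 ∨ Θ (r + t) = 0 := by
    intro t ht r
    rw [abs_lt] at ht
    rcases le_or_gt r δ with h1 | h1
    · exact Or.inr (Or.inl (hψ0 r h1))
    · rcases le_or_gt S (r + t) with h2 | h2
      · exact Or.inr (Or.inr (hΘ0 _ h2))
      · exact Or.inl (hχ1 r h1.le (by linarith))
  have ht₀ : |t₀ - t₀| < 1 := by simp
  have hmemt : ∀ᶠ t in 𝓝 t₀, |t - t₀| < 1 := by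
    filter_upwards [Metric.ball_mem_nhds t₀ one_pos] with t ht
    rwa [Metric.mem_ball, Real.dist_eq] at ht
  -- the quadratic part
  have D₁ := T₁.hasDerivAt_integral (t₀ := t₀) (Φ := fun a => a ^ 2) (f := fun a => 2 * a)
    (by fun_prop) (by fun_prop) (K := 2) (by norm_num) (s := univ)
    (Eventually.of_forall fun t => Eventually.of_forall fun r => mem_univ _)
    (fun a _ b _ => by
      rw [show b ^ 2 - a ^ 2 - 2 * a * (b - a) = (b - a) ^ 2 by ring, abs_of_nonneg (sq_nonneg _)]
      linarith [sq_nonneg (b - a)])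
    (fun a _ => by rw [abs_mul]; simp)
    (fun a _ => by rw [abs_of_nonneg (sq_nonneg _)]; linarith [sq_nonneg a])
    (κ := fun t r => ψ r * Θ (r + t)) (by fun_prop) hA
    (κ' := fun r => -(deriv ψ r * Θ (r + t₀))) (fun r => by
      have h1 : HasDerivAt (fun t => ψ (r + -1 * (t - t₀))) (deriv ψ r * (-1)) t₀ := by
        have e : HasDerivAt ψ (deriv ψ r) (r + -1 * (t₀ - t₀)) := by
          simpa using (hψd r).hasDerivAt
        exact e.comp t₀ ((((hasDerivAt_id t₀).sub_const t₀).const_mul (-1)).const_add r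
          |>.congr_deriv (by simp))
      -- `r + t` is constant along inward characteristics, so `Θ` is not differentiated in the `V²`
      -- part.
      have h2 : (fun t => ψ (r + -1 * (t - t₀)) * Θ (r + -1 * (t - t₀) + t)) =
          fun t => ψ (r + -1 * (t - t₀)) * Θ (r + t₀) := by
        funext t; congr 2; ring
      rw [h2]
      exact (h1.mul_const _).congr_deriv (by ring))
  -- the potential part
  obtain ⟨B, hB⟩ : ∃ B, ∀ t ∈ Icc (t₀ - 1) (t₀ + 1), ∀ r ∈ tsupport χ, |χ r * w t r| ≤ B := by
    have hK : IsCompact (Icc (t₀ - 1) (t₀ + 1) ×ˢ tsupport χ) := isCompact_Icc.prod hχc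
    obtain ⟨B, hB⟩ := hK.exists_bound_of_continuousOn
      (continuous_mul_cutoff hχ.continuous hχs h.continuousOn).continuousOn
    exact ⟨B, fun t ht r hr => hB (t, r) ⟨ht, hr⟩⟩
  -- The power is not globally quadratic in its Taylor remainder. The local bound on `χ w` confines
  -- its argument to a fixed interval.
  obtain ⟨K, hK, hK1, hK2, hK3⟩ := exists_power_taylor (q := p + 1) (by linarith) (max B 0)
  have hYB : ∀ᶠ t in 𝓝 t₀, ∀ᵐ r, Y₂ t r ∈ Icc (-max B 0) (max B 0) := by
    filter_upwards [hmemt] with t ht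
    rw [abs_lt] at ht
    filter_upwards [eY₂ t] with r hr
    rw [hr, mem_Icc, ← abs_le]
    by_cases hrs : r ∈ tsupport χ
    · exact (hB t ⟨by linarith, by linarith⟩ r hrs).trans (le_max_left _ _)
    · simp [image_eq_zero_of_notMem_tsupport hrs]
  have D₂ := T₂.hasDerivAt_integral (t₀ := t₀) (Φ := fun a => |a| ^ (p + 1))
    (f := fun a => (p + 1) * |a| ^ (p + 1 - 2) * a)
    (continuous_abs.rpow_const fun _ => Or.inr (by linarith))
    ((continuous_const.mul (continuous_abs.rpow_const fun _ => Or.inr (by linarith))).mul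
      continuous_id) hK hYB hK1 hK2 hK3
    (κ := fun t r => 2 / (p + 1) * (P r * Θ (r + t))) (by fun_prop) (A := |S| + |t₀| + 1 + δ)
    (fun t ht r hr => by
      have := hA t ht r hr
      rw [hPdef]
      linear_combination 2 / (p + 1) * r ^ (1 - p) * this)
    (κ' := fun r => 2 / (p + 1) * (deriv P r * Θ (r + t₀) + P r * (deriv Θ (r + t₀) * 2)))
    (fun r => by
      have h1 : HasDerivAt (fun t => P (r + 1 * (t - t₀))) (deriv P r) t₀ := by
        have e : HasDerivAt P (deriv P r) (r + 1 * (t₀ - t₀)) := by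
          simpa using (hPd r).hasDerivAt
        have e0 : HasDerivAt (fun t => r + 1 * (t - t₀)) 1 t₀ :=
          ((((hasDerivAt_id t₀).sub_const t₀).const_mul 1).const_add r).congr_deriv (by simp)
        exact (e.comp t₀ e0).congr_deriv (mul_one _)
      -- Along outward characteristics `r + t` advances at speed `2`, which produces the factor in
      -- front of `Θ'`.
      have h2 : HasDerivAt (fun t => Θ (r + 1 * (t - t₀) + t)) (deriv Θ (r + t₀) * 2) t₀ := by
        have e : HasDerivAt Θ (deriv Θ (r + t₀)) (r + 1 * (t₀ - t₀) + t₀) := by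
          simpa using (hΘd (r + t₀)).hasDerivAt
        have e0 : HasDerivAt (fun t => r + 1 * (t - t₀) + t) 2 t₀ :=
          (((((hasDerivAt_id t₀).sub_const t₀).const_mul 1).const_add r).add
            (hasDerivAt_id t₀)).congr_deriv (by norm_num)
        exact HasDerivAt.comp (h := fun t => r + 1 * (t - t₀) + t) t₀ e e0
      refine ((h1.mul h2).const_mul (2 / (p + 1))).congr_deriv ?_
      simp)
  -- the interaction terms cancel
  have hcancel : (∫ r, (2 * Y₁ t₀ r) * Z₁ t₀ r * (ψ r * Θ (r + t₀))) +
      ∫ r, (p + 1) * |Y₂ t₀ r| ^ (p + 1 - 2) * Y₂ t₀ r * Z₂ t₀ r *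
        (2 / (p + 1) * (P r * Θ (r + t₀))) = 0 := by
    rw [add_eq_zero_iff_eq_neg, ← integral_neg]
    refine integral_congr_ae ?_
    filter_upwards [eY₁ t₀, eZ₁ t₀, eY₂ t₀, eZ₂ t₀] with r h1 h2 h3 h4
    rw [h1, h2, h3, h4]
    rcases hsupp t₀ ht₀ r with ⟨e1, e2⟩ | e | e
    · rw [e1, e2, show p + 1 - 2 = p - 1 by ring]
      have : p + 1 ≠ 0 := by linarith
      simp only [hPdef, one_mul, zero_mul]
      field_simp
      ring
    · simp [hPdef, e]
    · simp [e]
  have hsum := D₁.add D₂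
  have hfun : (fun t => (∫ r, V t r ^ 2 * (ψ r * Θ (r + t))) +
      ∫ r, |w t r| ^ (p + 1) * (2 / (p + 1) * (P r * Θ (r + t)))) =ᶠ[𝓝 t₀]
      ((fun t => ∫ r, Y₁ t r ^ 2 * (ψ r * Θ (r + t))) +
        fun t => ∫ r, |Y₂ t r| ^ (p + 1) * (2 / (p + 1) * (P r * Θ (r + t)))) := by
    filter_upwards [hmemt] with t ht
    simp only [Pi.add_apply]
    congr 1
    · refine integral_congr_ae ?_
      filter_upwards [eY₁ t] with r h1
      rw [h1]
      rcases hsupp t ht r with ⟨e1, -⟩ | e | e <;> simp [*]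
    · refine integral_congr_ae ?_
      filter_upwards [eY₂ t] with r h1
      rw [h1]
      rcases hsupp t ht r with ⟨e1, -⟩ | e | e <;> simp [*]
  refine (hsum.congr_of_eventuallyEq hfun).congr_deriv ?_
  rw [add_add_add_comm, hcancel, zero_add]
  have hd0 : ∀ r, r < δ → deriv ψ r = 0 ∧ deriv P r = 0 := by
    intro r hr
    have e1 : ψ =ᶠ[𝓝 r] fun _ => 0 := by
      filter_upwards [Iio_mem_nhds hr] with x hx using hψ0 x (le_of_lt hx)
    have e2 : P =ᶠ[𝓝 r] fun _ => 0 := by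
      filter_upwards [Iio_mem_nhds hr] with x hx
      simp [hPdef, hψ0 x (le_of_lt hx)]
    exact ⟨by simp [e1.deriv_eq], by simp [e2.deriv_eq]⟩
  have hΘ0' : ∀ ρ, S < ρ → deriv Θ ρ = 0 := fun ρ hρ => by
    have e : Θ =ᶠ[𝓝 ρ] fun _ => 0 := by
      filter_upwards [Ioi_mem_nhds hρ] with x hx using hΘ0 x (le_of_lt hx)
    simp [e.deriv_eq]
  -- Wherever `χ` may differ from `1`, the differentiated weights vanish as well, so `χ V` and `χ w`
  -- can be replaced by `V` and `w`.
  have hχ' : ∀ r, χ r = 1 ∨ r < δ ∨ (Θ (r + t₀) = 0 ∧ deriv Θ (r + t₀) = 0) := by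
    intro r
    rcases lt_or_ge r δ with h1 | h1
    · exact Or.inr (Or.inl h1)
    · rcases lt_or_ge S (r + t₀) with h2 | h2
      · exact Or.inr (Or.inr ⟨hΘ0 _ h2.le, hΘ0' _ h2⟩)
      · exact Or.inl (hχ1 r h1 (by linarith)).1
  congr 1
  · refine integral_congr_ae ?_
    filter_upwards [eY₁ t₀] with r h1
    rw [h1]
    rcases hχ' r with e | e | e
    · simp [e]
    · simp [hd0 r e]
    · simp [e]
  · refine integral_congr_ae ?_
    filter_upwards [eY₂ t₀] with r h1
    rw [h1]
    rcases hχ' r with e | e | e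
    · simp [e, hPdef]
    · have e3 : P r = 0 := by simp [hPdef, hψ0 r e.le]
      rw [(hd0 r e).2, hψ0 r e.le, e3]
      simp
    · simp [e]

end RadialWave

/-! ### Local integrability of the energy density, and the sign of the weights -/

namespace RadialWave

/-- The potential part of the energy density. -/
noncomputable def potential (p : ℝ) (w : ℝ → ℝ → ℝ) (t r : ℝ) : ℝ :=
  |w t r| ^ (p + 1) / r ^ (p - 1)

/-- The energy density `V² + 2/(p+1) |w|^{p+1} / r^{p-1}`. -/
noncomputable def waveDensity (p : ℝ) (w : ℝ → ℝ → ℝ) (V : ℝ → L2) (t r : ℝ) : ℝ :=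
  V t r ^ 2 + 2 / (p + 1) * potential p w t r

theorem potential_nonneg {p : ℝ} {w : ℝ → ℝ → ℝ} {t r : ℝ} (hr : 0 < r) :
    0 ≤ potential p w t r :=
  div_nonneg (Real.rpow_nonneg (abs_nonneg _) _) (Real.rpow_nonneg hr.le _)

theorem potential_eq {p : ℝ} {w : ℝ → ℝ → ℝ} {t r : ℝ} (hr : 0 < r) :
    potential p w t r = |w t r| ^ (p + 1) * r ^ (1 - p) := by
  rw [potential, div_eq_mul_inv, ← Real.rpow_neg hr.le, neg_sub]

theorem waveDensity_nonneg {p : ℝ} (hp : 3 ≤ p) {w : ℝ → ℝ → ℝ} {V : ℝ → L2} {t r : ℝ}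
    (hr : 0 < r) : 0 ≤ waveDensity p w V t r :=
  add_nonneg (sq_nonneg _) (mul_nonneg (div_nonneg zero_le_two (by linarith)) (potential_nonneg hr))

/-- The powers of `r` add up to `(p + 1)/2 + 1 - p = (3 - p)/2`. -/
theorem potential_le {p : ℝ} (hp : 3 ≤ p) {w : ℝ → ℝ → ℝ} {t r N : ℝ} (hr : 0 < r)
    (h : |w t r| ≤ √r * N) : potential p w t r ≤ N ^ (p + 1) * r ^ ((3 - p) / 2) := by
  have hN : 0 ≤ N := by
    have := (abs_nonneg _).trans h
    exact nonneg_of_mul_nonneg_right this (Real.sqrt_pos.2 hr)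
  rw [potential_eq hr]
  calc |w t r| ^ (p + 1) * r ^ (1 - p) ≤ (√r * N) ^ (p + 1) * r ^ (1 - p) := by
        have : 0 ≤ r ^ (1 - p) := Real.rpow_nonneg hr.le _
        gcongr
    _ = N ^ (p + 1) * (r ^ ((p + 1) / 2) * r ^ (1 - p)) := by
        rw [Real.mul_rpow (Real.sqrt_nonneg _) hN, Real.sqrt_eq_rpow, ← Real.rpow_mul hr.le]
        ring_nf
    _ = _ := by
        rw [← Real.rpow_add hr]
        ring_nf

theorem InwardWave.continuousOn_potential {p : ℝ} (hp : 3 ≤ p) {w : ℝ → ℝ → ℝ} {V : ℝ → L2}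
    (h : InwardWave p w V) (t : ℝ) : ContinuousOn (potential p w t) (Ioi 0) := by
  have hw : ContinuousOn (w t) (Ioi 0) :=
    h.continuousOn.comp (f := fun r : ℝ => (t, r)) (by fun_prop) fun r hr => ⟨mem_univ _, hr⟩
  refine (hw.abs.rpow_const fun r _ => Or.inr (by linarith)).div
    (continuousOn_id.rpow_const fun r hr => Or.inl (ne_of_gt hr)) fun r hr => ?_
  exact (Real.rpow_pos_of_pos hr _).ne'

/-- The majorant `r^{(3-p)/2}` is integrable at the origin exactly because `p < 5`. No finiteness of
the total energy enters. -/
theorem InwardWave.integrableOn_potential {p : ℝ} (hp3 : 3 ≤ p) (hp5 : p < 5) {w : ℝ → ℝ → ℝ}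
    {V : ℝ → L2} (h : InwardWave p w V) (t R : ℝ) :
    IntegrableOn (potential p w t) (Ioo 0 R) := by
  obtain ⟨N, -, hN⟩ := h.growth
  have h1 : IntegrableOn (fun r : ℝ => N t ^ (p + 1) * r ^ ((3 - p) / 2)) (Ioo 0 R) := by
    rcases le_or_gt R 0 with hR | hR
    · simp [Ioo_eq_empty (not_lt.2 hR)]
    · have := (intervalIntegral.intervalIntegrable_rpow' (a := 0) (b := R) (r := (3 - p) / 2)
        (by linarith)).1
      exact (this.mono_set Ioo_subset_Ioc_self).const_mul _
  refine h1.mono' ((h.continuousOn_potential hp3 t).mono Ioo_subset_Ioi_self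
    |>.aestronglyMeasurable measurableSet_Ioo) ?_
  filter_upwards [ae_restrict_mem measurableSet_Ioo] with r hr
  rw [Real.norm_of_nonneg (potential_nonneg hr.1)]
  exact potential_le hp3 hr.1 (hN t r hr.1)

theorem InwardWave.aestronglyMeasurable_density {p : ℝ} (hp3 : 3 ≤ p) {w : ℝ → ℝ → ℝ}
    {V : ℝ → L2} (h : InwardWave p w V) (t : ℝ) :
    AEStronglyMeasurable (waveDensity p w V t) (volume.restrict (Ioi 0)) :=
  ((Lp.memLp (V t)).1.restrict.pow 2).add
    (((h.continuousOn_potential hp3 t).aestronglyMeasurable measurableSet_Ioi).const_mul _)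

/-- The energy density is integrable on bounded intervals. -/
theorem InwardWave.integrableOn_density {p : ℝ} (hp3 : 3 ≤ p) (hp5 : p < 5) {w : ℝ → ℝ → ℝ}
    {V : ℝ → L2} (h : InwardWave p w V) (t R : ℝ) :
    IntegrableOn (waveDensity p w V t) (Ioo 0 R) :=
  (integrable_sq_L2 (V t)).integrableOn.add ((h.integrableOn_potential hp3 hp5 t R).const_mul _)

theorem integrableOn_mul_of_bounded_support {f η : ℝ → ℝ} {R : ℝ} (hf : IntegrableOn f (Ioo 0 R))
    (hη : Continuous η) (h1 : ∀ r, 0 < r → |η r| ≤ 1) (h0 : ∀ r, R ≤ r → η r = 0) :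
    IntegrableOn (fun r => f r * η r) (Ioi 0) := by
  have hi : IntegrableOn (fun r => f r * η r) (Ioo 0 R) := by
    refine hf.mul_bdd (c := 1) hη.aestronglyMeasurable ?_
    filter_upwards [ae_restrict_mem measurableSet_Ioo] with r hr using h1 r hr.1
  refine hi.of_forall_sdiff_eq_zero measurableSet_Ioi fun r hr => ?_
  have : R ≤ r := by
    by_contra hlt
    exact hr.2 ⟨hr.1, not_le.1 hlt⟩
  simp [h0 r this]

theorem exists_deriv_smoothTransition_le :
    ∃ C, 0 ≤ C ∧ ∀ x, deriv Real.smoothTransition x ≤ C ∧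
      (1 < x → deriv Real.smoothTransition x = 0) := by
  have hc : Continuous (deriv Real.smoothTransition) :=
    (Real.smoothTransition.contDiff (n := 1)).continuous_deriv (by simp)
  obtain ⟨C, hC⟩ := (isCompact_Icc (a := (0 : ℝ)) (b := 1)).exists_bound_of_continuousOn
    hc.continuousOn
  have h1 : ∀ x, 1 < x → deriv Real.smoothTransition x = 0 := fun x hx => by
    have : Real.smoothTransition =ᶠ[𝓝 x] fun _ => 1 := by
      filter_upwards [Ioi_mem_nhds hx] with y hy
        using Real.smoothTransition.one_of_one_le (le_of_lt hy)
    simp [this.deriv_eq]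
  refine ⟨max C 0, le_max_right _ _, fun x => ⟨?_, h1 x⟩⟩
  rcases lt_or_ge x 0 with hx | hx
  · have : Real.smoothTransition =ᶠ[𝓝 x] fun _ => 0 := by
      filter_upwards [Iio_mem_nhds hx] with y hy
        using Real.smoothTransition.zero_of_nonpos (le_of_lt hy)
    simp [this.deriv_eq]
  · rcases le_or_gt x 1 with hx1 | hx1
    · exact (le_abs_self _).trans ((hC x ⟨hx, hx1⟩).trans (le_max_left _ _))
    · simp [h1 x hx1]

/-- The radial weight vanishing for `r ≤ δ`, close to `min(lr, 1)` beyond. -/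
noncomputable def radialWeight (δ l r : ℝ) : ℝ :=
  Real.smoothTransition (r / δ - 1) * (1 - Real.exp (-(l * r)))

theorem radialWeight_contDiff (δ l : ℝ) : ContDiff ℝ 1 (radialWeight δ l) := by
  unfold radialWeight
  exact (Real.smoothTransition.contDiff.comp (by fun_prop)).mul (by fun_prop)

theorem radialWeight_eq_zero {δ : ℝ} (hδ : 0 < δ) (l : ℝ) {r : ℝ} (hr : r ≤ δ) :
    radialWeight δ l r = 0 := by
  rw [radialWeight, Real.smoothTransition.zero_of_nonpos, zero_mul]
  rw [sub_nonpos, div_le_one hδ]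
  exact hr

/-- With `σ = 1 - exp(-l r)`, the bound `σ ≤ l r` compensates the `1/δ` of the cutoff. The bound `r
σ' ≤ σ` limits the loss in the potential term to one unit of `p - 1`. The latter follows from `1 + l
r ≤ exp(l r)` multiplied by `exp(-l r)`. -/
theorem one_sub_exp_mem {l r : ℝ} (hl : 0 < l) (hr : 0 < r) :
    0 ≤ 1 - Real.exp (-(l * r)) ∧ 1 - Real.exp (-(l * r)) ≤ 1 ∧
      1 - Real.exp (-(l * r)) ≤ l * r ∧
      r * (l * Real.exp (-(l * r))) ≤ 1 - Real.exp (-(l * r)) := by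
  have h0 : 0 < l * r := mul_pos hl hr
  have h1 : Real.exp (-(l * r)) ≤ 1 := Real.exp_le_one_iff.2 (by linarith)
  have h2 := Real.add_one_le_exp (-(l * r))
  have h3 := Real.add_one_le_exp (l * r)
  have h4 := Real.exp_pos (-(l * r))
  have h5 : Real.exp (-(l * r)) * Real.exp (l * r) = 1 := by
    rw [← Real.exp_add]; simp
  refine ⟨by linarith, by linarith, by linarith, ?_⟩
  nlinarith

theorem radialWeight_mem {δ l r : ℝ} (hl : 0 < l) (hr : 0 < r) :
    0 ≤ radialWeight δ l r ∧ radialWeight δ l r ≤ 1 := by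
  obtain ⟨h1, h2, -, -⟩ := one_sub_exp_mem hl hr
  have h3 := Real.smoothTransition.nonneg (r / δ - 1)
  have h4 := Real.smoothTransition.le_one (r / δ - 1)
  exact ⟨mul_nonneg h3 h1, mul_le_one₀ h4 h1 h2⟩

theorem hasDerivAt_radialWeight (δ l r : ℝ) :
    HasDerivAt (radialWeight δ l)
      (deriv Real.smoothTransition (r / δ - 1) * (1 / δ) * (1 - Real.exp (-(l * r))) +
        Real.smoothTransition (r / δ - 1) * (l * Real.exp (-(l * r)))) r := by
  have h1 : HasDerivAt Real.smoothTransition (deriv Real.smoothTransition (r / δ - 1))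
      (r / δ - 1) :=
    ((Real.smoothTransition.contDiff (n := 1)).differentiable (by simp) _).hasDerivAt
  have h2 : HasDerivAt (fun r => r / δ - 1) (1 / δ) r :=
    ((hasDerivAt_id r).div_const δ).sub_const 1
  have h3 : HasDerivAt (fun r => 1 - Real.exp (-(l * r))) (l * Real.exp (-(l * r))) r := by
    have : HasDerivAt (fun r => -(l * r)) (-l) r :=
      (((hasDerivAt_id r).const_mul l).neg).congr_deriv (by simp)
    exact (this.exp.const_sub 1).congr_deriv (by ring)
  exact (HasDerivAt.comp (h := fun r => r / δ - 1) r h1 h2).mul h3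

/-- The algebra behind the monotonicity formula: away from the zone `δ ≤ r ≤ 2δ` the weight
`ψ(r) Θ(r + t)` gives a nonpositive contribution. -/
theorem weight_inequality {p : ℝ} (hp : 3 ≤ p) {C : ℝ}
    (hC : ∀ x, deriv Real.smoothTransition x ≤ C ∧ (1 < x → deriv Real.smoothTransition x = 0))
    {δ l r Θ Θ' : ℝ} (hδ : 0 < δ) (hl : 0 < l) (hΘ0 : 0 ≤ Θ) (hΘ1 : Θ ≤ 1)
    (hΘ' : r ≠ 0 → 2 * (r * Θ') ≤ Θ) :
    deriv (fun r => radialWeight δ l r * r ^ (1 - p)) r * Θ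
      + radialWeight δ l r * r ^ (1 - p) * (Θ' * 2) ≤
      (Icc δ (2 * δ)).indicator (fun r => 2 * C * l * r ^ (1 - p)) r := by
  have hC0 : 0 ≤ C := (Monotone.deriv_nonneg Real.smoothTransition.monotone).trans (hC 0).1
  rcases lt_or_ge r δ with hr | hr
  · have e1 : (fun r => radialWeight δ l r * r ^ (1 - p)) =ᶠ[𝓝 r] fun _ => 0 := by
      filter_upwards [Iio_mem_nhds hr] with x hx
      simp [radialWeight_eq_zero hδ l (le_of_lt hx)]
    rw [e1.deriv_eq, radialWeight_eq_zero hδ l hr.le]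
    simp [hr]
  · have hr0 : 0 < r := hδ.trans_le hr
    obtain ⟨s0, s1, s2, s3⟩ := one_sub_exp_mem hl hr0
    have hd : HasDerivAt (fun r => radialWeight δ l r * r ^ (1 - p)) _ r :=
      (hasDerivAt_radialWeight δ l r).mul (Real.hasDerivAt_rpow_const (Or.inl hr0.ne'))
    rw [hd.deriv, radialWeight]
    set χ := Real.smoothTransition (r / δ - 1)
    set χ' := deriv Real.smoothTransition (r / δ - 1) with hχ'
    set σ := 1 - Real.exp (-(l * r))
    set σ' := l * Real.exp (-(l * r))
    have hχ0 : 0 ≤ χ := Real.smoothTransition.nonneg _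
    have hχ'0 : 0 ≤ χ' := Monotone.deriv_nonneg Real.smoothTransition.monotone
    have hpow : r ^ (1 - p) = r * r ^ (1 - p - 1) := by
      rw [Real.rpow_sub_one hr0.ne', mul_div_cancel₀ _ hr0.ne']
    set g := r ^ (1 - p - 1) with hg
    have hg0 : 0 ≤ g := Real.rpow_nonneg hr0.le _
    -- After factoring out `g = r^{-p}`, the terms without `χ'` are at most `χ g σ Θ (1 + 1 + (1 -
    -- p))`: one unit comes from `r σ' ≤ σ`, one from `2 r Θ' ≤ Θ`. This is nonpositive since `p ≥
    -- 3`, and only the cutoff term survives.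
    have key : (χ' * (1 / δ) * σ + χ * σ') * r ^ (1 - p) * Θ + χ * σ * ((1 - p) * g) * Θ
        + χ * σ * r ^ (1 - p) * (Θ' * 2) ≤ χ' * (1 / δ) * σ * r ^ (1 - p) * Θ := by
      rw [hpow]
      have a1 : χ * g * Θ * (r * σ') ≤ χ * g * Θ * σ :=
        mul_le_mul_of_nonneg_left s3 (by positivity)
      have a2 : χ * g * σ * (2 * (r * Θ')) ≤ χ * g * σ * Θ :=
        mul_le_mul_of_nonneg_left (hΘ' hr0.ne') (by positivity)
      have a3 : 0 ≤ (p - 3) * (χ * g * σ * Θ) := mul_nonneg (by linarith) (by positivity)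
      nlinarith
    refine le_trans (le_of_eq ?_) (key.trans ?_)
    · ring
    · rcases le_or_gt r (2 * δ) with h2 | h2
      · rw [indicator_of_mem (show r ∈ Icc δ (2 * δ) from ⟨hr, h2⟩)]
        have b0 : 0 ≤ r ^ (1 - p) := Real.rpow_nonneg hr0.le _
        -- From `σ ≤ l r` and `r ≤ 2 δ`.
        have b1 : 1 / δ * σ ≤ 2 * l := by
          rw [one_div, inv_mul_le_iff₀ hδ]
          nlinarith
        have b2 : 0 ≤ 1 / δ * σ := by positivity
        calc χ' * (1 / δ) * σ * r ^ (1 - p) * Θ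
            = χ' * (1 / δ * σ) * r ^ (1 - p) * Θ := by ring
          _ ≤ C * (2 * l) * r ^ (1 - p) * 1 := by
              have := (hC (r / δ - 1)).1
              gcongr
          _ = _ := by ring
      · have : χ' = 0 := (hC (r / δ - 1)).2 (by
          rw [lt_sub_iff_add_lt, lt_div_iff₀ hδ]; linarith)
        rw [this]
        simp [h2]

end RadialWave

/-! ### Monotonicity of weighted energies: removing the weight at the origin -/

namespace RadialWave

/-- Weights `Θ(r + t)` for which the weighted energy is nonincreasing after time `t₀`. -/
structure IsAdmissible (t₀ : ℝ) (Θ : ℝ → ℝ) : Prop where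
  contDiff : ContDiff ℝ 1 Θ
  nonneg : ∀ ρ, 0 ≤ Θ ρ
  le_one : ∀ ρ, Θ ρ ≤ 1
  deriv_le : ∀ ρ, t₀ < ρ → 2 * ((ρ - t₀) * deriv Θ ρ) ≤ Θ ρ

/-- The energy identity is stated with integrals over the whole line. The radial weight vanishes for
`r ≤ 0`, and its product with `Θ` is bounded with bounded support on the half line, so the two parts
combine into one integral of the density. -/
theorem InwardWave.energy_eq {p : ℝ} (hp3 : 3 ≤ p) (hp5 : p < 5) {w : ℝ → ℝ → ℝ} {V : ℝ → L2}
    (h : InwardWave p w V) {t₀ S δ l : ℝ} {Θ : ℝ → ℝ} (hΘ : IsAdmissible t₀ Θ)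
    (hS : ∀ ρ, S ≤ ρ → Θ ρ = 0) (hδ : 0 < δ) (hl : 0 < l) (t : ℝ) :
    (∫ r, V t r ^ 2 * (radialWeight δ l r * Θ (r + t))) +
      ∫ r, |w t r| ^ (p + 1) * (2 / (p + 1) * (radialWeight δ l r * r ^ (1 - p) * Θ (r + t))) =
    ∫ r in Ioi 0, waveDensity p w V t r * (radialWeight δ l r * Θ (r + t)) := by
  have hΘc := hΘ.contDiff.continuous
  have hψc := (radialWeight_contDiff δ l).continuous
  have hη : Continuous fun r => radialWeight δ l r * Θ (r + t) := by fun_prop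
  have hη1 : ∀ r, 0 < r → |radialWeight δ l r * Θ (r + t)| ≤ 1 := fun r hr => by
    obtain ⟨a, b⟩ := radialWeight_mem (δ := δ) hl hr
    rw [abs_of_nonneg (mul_nonneg a (hΘ.nonneg _))]
    exact mul_le_one₀ b (hΘ.nonneg _) (hΘ.le_one _)
  have hη0 : ∀ r, S - t ≤ r → radialWeight δ l r * Θ (r + t) = 0 := fun r hr => by
    rw [hS _ (by linarith), mul_zero]
  have hneg : ∀ r ∉ Ioi (0 : ℝ), radialWeight δ l r = 0 := fun r hr =>
    radialWeight_eq_zero hδ l ((not_lt.1 hr).trans hδ.le)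
  rw [← setIntegral_eq_integral_of_forall_compl_eq_zero (s := Ioi 0)
      (f := fun r => V t r ^ 2 * (radialWeight δ l r * Θ (r + t)))
      (fun r hr => by rw [hneg r hr]; simp),
    ← setIntegral_eq_integral_of_forall_compl_eq_zero (s := Ioi 0)
      (f := fun r => |w t r| ^ (p + 1) *
        (2 / (p + 1) * (radialWeight δ l r * r ^ (1 - p) * Θ (r + t))))
      (fun r hr => by rw [hneg r hr]; simp), ← integral_add]
  · refine setIntegral_congr_fun measurableSet_Ioi fun r hr => ?_
    rw [waveDensity, potential_eq hr]
    ring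
  · exact integrableOn_mul_of_bounded_support (integrable_sq_L2 (V t)).integrableOn hη hη1 hη0
  · have := (integrableOn_mul_of_bounded_support (h.integrableOn_potential hp3 hp5 t (S - t))
      hη hη1 hη0).const_mul (2 / (p + 1))
    refine IntegrableOn.congr_fun this (fun r hr => ?_) measurableSet_Ioi
    simp only [potential_eq hr]
    ring

/-- The only contribution of the wrong sign comes from the potential on `[δ, 2δ]`. There the
integrand is at most a constant times `δ^{(3-p)/2}`, and the length `δ` of the zone adds one to the
exponent. The constant may depend on `l`, but not on `δ`. -/
theorem InwardWave.truncated_energy_le {p : ℝ} (hp3 : 3 ≤ p) (hp5 : p < 5) {w : ℝ → ℝ → ℝ}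
    {V : ℝ → L2} (h : InwardWave p w V) {t₀ t₁ S l : ℝ} (ht : t₀ ≤ t₁) {Θ : ℝ → ℝ}
    (hΘ : IsAdmissible t₀ Θ) (hS : ∀ ρ, S ≤ ρ → Θ ρ = 0) (hl : 0 < l) :
    ∃ C, ∀ δ, 0 < δ →
      ∫ r in Ioi 0, waveDensity p w V t₁ r * (radialWeight δ l r * Θ (r + t₁)) ≤
      (∫ r in Ioi 0, waveDensity p w V t₀ r * (radialWeight δ l r * Θ (r + t₀))) +
        C * δ ^ ((5 - p) / 2) := by
  obtain ⟨C, hC0, hC⟩ := exists_deriv_smoothTransition_le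
  obtain ⟨N, hNc, hN⟩ := h.growth
  obtain ⟨B, hB⟩ := (isCompact_Icc (a := t₀) (b := t₁)).exists_bound_of_continuousOn
    hNc.continuousOn
  have hB' : ∀ t ∈ Icc t₀ t₁, N t ≤ max B 0 := fun t ht =>
    (le_abs_self _).trans ((hB t ht).trans (le_max_left _ _))
  set D := 2 / (p + 1) * (2 * C * l) * (max B 0) ^ (p + 1) with hD
  have hD0 : 0 ≤ D := by
    have : 0 < p + 1 := by linarith
    positivity
  refine ⟨D * (t₁ - t₀), fun δ hδ => ?_⟩
  have hder := fun t => h.hasDerivAt_energy hp3 (radialWeight_contDiff δ l) hΘ.contDiff hδ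
    (fun r hr => radialWeight_eq_zero hδ l hr) hS t
  have hle : ∀ t ∈ Ioo t₀ t₁, deriv (fun t => (∫ r, V t r ^ 2 * (radialWeight δ l r * Θ (r + t))) +
      ∫ r, |w t r| ^ (p + 1) * (2 / (p + 1) * (radialWeight δ l r * r ^ (1 - p) * Θ (r + t)))) t ≤
      D * δ ^ ((5 - p) / 2) := by
    intro t htt
    rw [(hder t).deriv]
    have hfirst : ∫ r, V t r ^ 2 * (-(deriv (radialWeight δ l) r * Θ (r + t))) ≤ 0 := by
      refine integral_nonpos fun r => ?_
      have h1 : 0 ≤ deriv (radialWeight δ l) r := by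
        rcases lt_or_ge r δ with hr | hr
        · have e1 : radialWeight δ l =ᶠ[𝓝 r] fun _ => 0 := by
            filter_upwards [Iio_mem_nhds hr] with x hx
            exact radialWeight_eq_zero hδ l (le_of_lt hx)
          simp [e1.deriv_eq]
        · rw [(hasDerivAt_radialWeight δ l r).deriv]
          have h1 := (one_sub_exp_mem hl (hδ.trans_le hr)).1
          have h2 : 0 ≤ deriv Real.smoothTransition (r / δ - 1) :=
            Monotone.deriv_nonneg Real.smoothTransition.monotone
          have h3 := Real.smoothTransition.nonneg (r / δ - 1)
          positivity
      have h2 := mul_nonneg (sq_nonneg (V t r)) (mul_nonneg h1 (hΘ.nonneg (r + t)))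
      simp only [Pi.zero_apply]
      linarith
    have hsecond : ∫ r, |w t r| ^ (p + 1) * (2 / (p + 1) *
        (deriv (fun r => radialWeight δ l r * r ^ (1 - p)) r * Θ (r + t)
          + radialWeight δ l r * r ^ (1 - p) * (deriv Θ (r + t) * 2))) ≤ D * δ ^ ((5 - p) / 2) := by
      have hpt : ∀ r, |w t r| ^ (p + 1) * (2 / (p + 1) *
          (deriv (fun r => radialWeight δ l r * r ^ (1 - p)) r * Θ (r + t)
            + radialWeight δ l r * r ^ (1 - p) * (deriv Θ (r + t) * 2))) ≤
          (Icc δ (2 * δ)).indicator (fun _ => D * δ ^ ((3 - p) / 2)) r := by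
        intro r
        have hw0 : 0 ≤ |w t r| ^ (p + 1) := Real.rpow_nonneg (abs_nonneg _) _
        have hp0 : 0 ≤ 2 / (p + 1) := div_nonneg zero_le_two (by linarith)
        rcases lt_or_ge r δ with hr | hr
        · have e1 : (fun r => radialWeight δ l r * r ^ (1 - p)) =ᶠ[𝓝 r] fun _ => 0 := by
            filter_upwards [Iio_mem_nhds hr] with x hx
            simp [radialWeight_eq_zero hδ l (le_of_lt hx)]
          rw [e1.deriv_eq, radialWeight_eq_zero hδ l hr.le]
          simp [hr]
        have hr0 : 0 < r := hδ.trans_le hr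
        -- At times after `t₀` one has `r ≤ r + t - t₀`, so admissibility of `Θ` implies `2 r Θ' ≤
        -- Θ` where `Θ' ≥ 0`. Where `Θ' < 0` this inequality is trivial.
        have hW := weight_inequality hp3 hC (r := r) (Θ := Θ (r + t)) (Θ' := deriv Θ (r + t)) hδ hl
          (hΘ.nonneg _) (hΘ.le_one _) (fun _ => by
            have h1 := hΘ.deriv_le (r + t) (by linarith [htt.1])
            rcases le_or_gt 0 (deriv Θ (r + t)) with h2 | h2
            · have : r * deriv Θ (r + t) ≤ (r + t - t₀) * deriv Θ (r + t) := by
                gcongr; linarith [htt.1]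
              linarith
            · have := mul_neg_of_pos_of_neg hr0 h2
              linarith [hΘ.nonneg (r + t)])
        refine (mul_le_mul_of_nonneg_left (mul_le_mul_of_nonneg_left hW hp0) hw0).trans ?_
        by_cases hmem : r ∈ Icc δ (2 * δ)
        · rw [indicator_of_mem hmem, indicator_of_mem hmem]
          have h1 := potential_le hp3 hr0 ((hN t r hr0).trans (mul_le_mul_of_nonneg_left
            (hB' t ⟨htt.1.le, htt.2.le⟩) (Real.sqrt_nonneg r)))
          rw [potential_eq hr0] at h1
          have h2 : r ^ ((3 - p) / 2) ≤ δ ^ ((3 - p) / 2) :=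
            Real.rpow_le_rpow_of_nonpos hδ hr (by linarith)
          calc |w t r| ^ (p + 1) * (2 / (p + 1) * (2 * C * l * r ^ (1 - p)))
              = 2 / (p + 1) * (2 * C * l) * (|w t r| ^ (p + 1) * r ^ (1 - p)) := by ring
            _ ≤ 2 / (p + 1) * (2 * C * l) * (max B 0 ^ (p + 1) * r ^ ((3 - p) / 2)) := by
                gcongr
            _ ≤ 2 / (p + 1) * (2 * C * l) * (max B 0 ^ (p + 1) * δ ^ ((3 - p) / 2)) := by
                gcongr
            _ = _ := by rw [hD]; ring
        · rw [indicator_of_notMem hmem, indicator_of_notMem hmem]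
          simp
      have hint : Integrable ((Icc δ (2 * δ)).indicator fun _ => D * δ ^ ((3 - p) / 2)) :=
        (integrable_indicator_iff measurableSet_Icc).2 (integrableOn_const (by simp))
      have hval : ∫ r, (Icc δ (2 * δ)).indicator (fun _ => D * δ ^ ((3 - p) / 2)) r
          = D * δ ^ ((5 - p) / 2) := by
        rw [integral_indicator measurableSet_Icc, setIntegral_const, measureReal_def,
          Real.volume_Icc, ENNReal.toReal_ofReal (by linarith), smul_eq_mul,
          show (5 - p) / 2 = (3 - p) / 2 + 1 by ring, Real.rpow_add_one hδ.ne']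
        ring
      -- Integrability need not be proved: otherwise the integral is `0` by convention and the bound
      -- is nonnegative.
      by_cases hi : Integrable fun r => |w t r| ^ (p + 1) * (2 / (p + 1) *
          (deriv (fun r => radialWeight δ l r * r ^ (1 - p)) r * Θ (r + t)
            + radialWeight δ l r * r ^ (1 - p) * (deriv Θ (r + t) * 2)))
      · rw [← hval]
        exact integral_mono hi hint hpt
      · rw [integral_undef hi]
        positivity
    linarith
  have hmv := (convex_Icc t₀ t₁).image_sub_le_mul_sub_of_deriv_le
    (fun t _ => (hder t).continuousAt.continuousWithinAt)
    (fun t _ => (hder t).differentiableAt.differentiableWithinAt)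
    (C := D * δ ^ ((5 - p) / 2)) (by rw [interior_Icc]; exact hle)
    t₀ (left_mem_Icc.2 ht) t₁ (right_mem_Icc.2 ht) ht
  have e := h.energy_eq hp3 hp5 hΘ hS hδ hl
  rw [← e t₁, ← e t₀]
  linarith

theorem tendsto_weighted {f Θ : ℝ → ℝ} {R : ℝ} (hf : IntegrableOn f (Ioo 0 R))
    (hfm : AEStronglyMeasurable f (volume.restrict (Ioi 0))) (hΘ : Continuous Θ)
    (hΘ1 : ∀ r, |Θ r| ≤ 1) (hΘ0 : ∀ r, R ≤ r → Θ r = 0) {ψ : ℕ → ℝ → ℝ} {ψ₀ : ℝ → ℝ}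
    (hψ : ∀ n, Continuous (ψ n)) (hψ1 : ∀ n r, 0 < r → |ψ n r| ≤ 1)
    (hlim : ∀ r, 0 < r → Tendsto (fun n => ψ n r) atTop (𝓝 (ψ₀ r))) :
    Tendsto (fun n => ∫ r in Ioi 0, f r * (ψ n r * Θ r)) atTop
      (𝓝 (∫ r in Ioi 0, f r * (ψ₀ r * Θ r))) := by
  refine tendsto_integral_of_dominated_convergence (fun r => |f r * Θ r|)
    (fun n => hfm.mul ((hψ n).mul hΘ).aestronglyMeasurable)
    (integrableOn_mul_of_bounded_support hf hΘ (fun r _ => hΘ1 r) hΘ0).abs (fun n => ?_) ?_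
  · filter_upwards [ae_restrict_mem measurableSet_Ioi] with r hr
    rw [Real.norm_eq_abs, abs_mul, abs_mul, abs_mul]
    have := hψ1 n r hr
    gcongr
    exact mul_le_of_le_one_left (abs_nonneg _) this
  · filter_upwards [ae_restrict_mem measurableSet_Ioi] with r hr
    exact ((hlim r hr).mul_const _).const_mul _

/-- Weighted energies with admissible weights of bounded support are nonincreasing. -/
theorem InwardWave.weighted_energy_le {p : ℝ} (hp3 : 3 ≤ p) (hp5 : p < 5) {w : ℝ → ℝ → ℝ}
    {V : ℝ → L2} (h : InwardWave p w V) {t₀ t₁ S : ℝ} (ht : t₀ ≤ t₁) {Θ : ℝ → ℝ}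
    (hΘ : IsAdmissible t₀ Θ) (hS : ∀ ρ, S ≤ ρ → Θ ρ = 0) :
    ∫ r in Ioi 0, waveDensity p w V t₁ r * Θ (r + t₁) ≤
      ∫ r in Ioi 0, waveDensity p w V t₀ r * Θ (r + t₀) := by
  have hΘc := hΘ.contDiff.continuous
  have hconv : ∀ t {ψ : ℕ → ℝ → ℝ} {ψ₀ : ℝ → ℝ}, (∀ n, Continuous (ψ n)) →
      (∀ n r, 0 < r → |ψ n r| ≤ 1) →
      (∀ r, 0 < r → Tendsto (fun n => ψ n r) atTop (𝓝 (ψ₀ r))) →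
      Tendsto (fun n => ∫ r in Ioi 0, waveDensity p w V t r * (ψ n r * Θ (r + t))) atTop
        (𝓝 (∫ r in Ioi 0, waveDensity p w V t r * (ψ₀ r * Θ (r + t)))) := fun t ψ ψ₀ a b c =>
    tendsto_weighted (h.integrableOn_density hp3 hp5 t (S - t)) (h.aestronglyMeasurable_density hp3 t)
      (by fun_prop) (fun r => by rw [abs_of_nonneg (hΘ.nonneg _)]; exact hΘ.le_one _)
      (fun r hr => hS _ (by linarith)) a b c
  -- The limit `δ → 0` comes first with `l` fixed, since the error constant depends on `l`. For each
  -- `r` the cutoff is identically `1` once `2 δ ≤ r`.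
  have step : ∀ l, 0 < l →
      ∫ r in Ioi 0, waveDensity p w V t₁ r * ((1 - Real.exp (-(l * r))) * Θ (r + t₁)) ≤
      ∫ r in Ioi 0, waveDensity p w V t₀ r * ((1 - Real.exp (-(l * r))) * Θ (r + t₀)) := by
    intro l hl
    obtain ⟨C, hC⟩ := h.truncated_energy_le hp3 hp5 ht hΘ hS hl
    have hδ : ∀ n : ℕ, 0 < 1 / ((n : ℝ) + 1) := fun n => by positivity
    have hδlim : Tendsto (fun n : ℕ => 1 / ((n : ℝ) + 1)) atTop (𝓝 0) :=
      tendsto_one_div_add_atTop_nhds_zero_nat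
    have hψ : ∀ t, Tendsto (fun n : ℕ => ∫ r in Ioi 0, waveDensity p w V t r *
        (radialWeight (1 / ((n : ℝ) + 1)) l r * Θ (r + t))) atTop
        (𝓝 (∫ r in Ioi 0, waveDensity p w V t r * ((1 - Real.exp (-(l * r))) * Θ (r + t)))) := by
      intro t
      refine hconv t (fun n => (radialWeight_contDiff _ l).continuous)
        (fun n r hr => ?_) (fun r hr => ?_)
      · obtain ⟨a, b⟩ := radialWeight_mem (δ := 1 / ((n : ℝ) + 1)) hl hr
        rwa [abs_of_nonneg a]
      · refine tendsto_const_nhds.congr' ?_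
        filter_upwards [hδlim.eventually_lt_const (show 0 < r / 2 by linarith)] with n hn
        rw [radialWeight, Real.smoothTransition.one_of_one_le, one_mul]
        rw [le_sub_iff_add_le, le_div_iff₀ (hδ n)]
        linarith
    have hrhs : Tendsto (fun n : ℕ => C * (1 / ((n : ℝ) + 1)) ^ ((5 - p) / 2)) atTop (𝓝 0) := by
      have h0 : (0 : ℝ) ^ ((5 - p) / 2) = 0 := Real.zero_rpow (by linarith)
      have := (hδlim.rpow_const (p := (5 - p) / 2) (Or.inr (by linarith))).const_mul C
      rwa [h0, mul_zero] at this
    have := le_of_tendsto_of_tendsto' (hψ t₁) ((hψ t₀).add hrhs) fun n => hC _ (hδ n)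
    simpa using this
  -- The error has disappeared, so `l = n + 1` may now tend to infinity, where `1 - exp(-l r)`
  -- increases to `1`.
  have hψ : ∀ t, Tendsto (fun n : ℕ => ∫ r in Ioi 0, waveDensity p w V t r *
      ((1 - Real.exp (-(((n : ℝ) + 1) * r))) * Θ (r + t))) atTop
      (𝓝 (∫ r in Ioi 0, waveDensity p w V t r * (1 * Θ (r + t)))) := by
    intro t
    refine hconv t (ψ₀ := fun _ => 1) (fun n => by fun_prop) (fun n r hr => ?_) (fun r hr => ?_)
    · obtain ⟨a, b, -, -⟩ := one_sub_exp_mem (l := (n : ℝ) + 1) (by positivity) hr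
      rwa [abs_of_nonneg a]
    · have h1 : Tendsto (fun n : ℕ => ((n : ℝ) + 1) * r) atTop atTop :=
        (tendsto_atTop_add_const_right _ _ tendsto_natCast_atTop_atTop).atTop_mul_const hr
      have h2 := (Real.tendsto_exp_neg_atTop_nhds_zero.comp h1).const_sub 1
      simpa using h2
  have := le_of_tendsto_of_tendsto' (hψ t₁) (hψ t₀) fun n => step _ (by positivity)
  simpa using this

end RadialWave

/-! ### Unbounded weights and decay of the inward energy -/

namespace RadialWave

/-- A nonincreasing cutoff in `ρ` only lowers the derivative of the weight for `ρ > t₀`, so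
truncation at infinity preserves admissibility. Shifting the argument by `t₀` makes the weight equal
to `H(r)` at the initial time when the cutoff is `1`. -/
theorem IsAdmissible.truncate {H : ℝ → ℝ} (hH : IsAdmissible 0 H) (t₀ a : ℝ) :
    IsAdmissible t₀ fun ρ => H (ρ - t₀) * Real.smoothTransition (a - (ρ - t₀)) := by
  have hs : ContDiff ℝ 1 Real.smoothTransition := Real.smoothTransition.contDiff
  refine ⟨?_, fun ρ => ?_, fun ρ => ?_, fun ρ hρ => ?_⟩
  · have := hH.contDiff
    fun_prop
  · exact mul_nonneg (hH.nonneg _) (Real.smoothTransition.nonneg _)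
  · exact mul_le_one₀ (hH.le_one _) (Real.smoothTransition.nonneg _)
      (Real.smoothTransition.le_one _)
  · have h0 : HasDerivAt (fun ρ => ρ - t₀) 1 ρ := (hasDerivAt_id ρ).sub_const t₀
    have h1 : HasDerivAt (fun ρ => H (ρ - t₀)) (deriv H (ρ - t₀)) ρ :=
      (HasDerivAt.comp (h := fun ρ => ρ - t₀) ρ
        (hH.contDiff.differentiable (by simp) _).hasDerivAt h0).congr_deriv (mul_one _)
    have h2 : HasDerivAt (fun ρ => Real.smoothTransition (a - (ρ - t₀)))
        (deriv Real.smoothTransition (a - (ρ - t₀)) * (-1)) ρ :=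
      HasDerivAt.comp (h := fun ρ => a - (ρ - t₀)) ρ
        (hs.differentiable (by simp) _).hasDerivAt (h0.const_sub a)
    have hd : HasDerivAt (fun ρ => H (ρ - t₀) * Real.smoothTransition (a - (ρ - t₀))) _ ρ :=
      h1.mul h2
    rw [hd.deriv]
    have e1 := hH.deriv_le (ρ - t₀) (by linarith)
    rw [sub_zero] at e1
    have e2 := Real.smoothTransition.nonneg (a - (ρ - t₀))
    have e3 : 0 ≤ deriv Real.smoothTransition (a - (ρ - t₀)) :=
      Monotone.deriv_nonneg Real.smoothTransition.monotone
    have e4 := mul_le_mul_of_nonneg_right e1 e2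
    have e5 : 0 ≤ (ρ - t₀) * (H (ρ - t₀) * deriv Real.smoothTransition (a - (ρ - t₀))) :=
      mul_nonneg (by linarith) (mul_nonneg (hH.nonneg _) e3)
    nlinarith

/-- Weighted energies (possibly infinite) with admissible weights are nonincreasing. -/
theorem InwardWave.lintegral_weighted_le {p : ℝ} (hp3 : 3 ≤ p) (hp5 : p < 5) {w : ℝ → ℝ → ℝ}
    {V : ℝ → L2} (h : InwardWave p w V) {t₀ t₁ : ℝ} (ht : t₀ ≤ t₁) {H : ℝ → ℝ}
    (hH : IsAdmissible 0 H) :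
    ∫⁻ r in Ioi 0, ENNReal.ofReal (waveDensity p w V t₁ r * H (r + t₁ - t₀)) ≤
      ∫⁻ r in Ioi 0, ENNReal.ofReal (waveDensity p w V t₀ r * H r) := by
  have hHc := hH.contDiff.continuous
  have hsc := Real.smoothTransition.continuous
  set Θ : ℕ → ℝ → ℝ := fun n ρ => H (ρ - t₀) * Real.smoothTransition (n - (ρ - t₀)) with hΘ
  have hadm : ∀ n, IsAdmissible t₀ (Θ n) := fun n => hH.truncate t₀ n
  have hzero : ∀ (n : ℕ) ρ, n + t₀ ≤ ρ → Θ n ρ = 0 := fun n ρ hρ => by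
    simp only [hΘ]
    rw [Real.smoothTransition.zero_of_nonpos (by linarith), mul_zero]
  have hint : ∀ n t, IntegrableOn (fun r => waveDensity p w V t r * Θ n (r + t)) (Ioi 0) :=
    fun n t => by
      have := (hadm n).contDiff.continuous
      exact integrableOn_mul_of_bounded_support (R := n + t₀ - t) (h.integrableOn_density hp3 hp5 t _)
        (by fun_prop) (fun r _ => by
          rw [abs_of_nonneg ((hadm n).nonneg _)]; exact (hadm n).le_one _)
        (fun r hr => hzero n _ (by linarith))
  have hnn : ∀ n t, ∀ᵐ r ∂volume.restrict (Ioi 0), 0 ≤ waveDensity p w V t r * Θ n (r + t) :=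
    fun n t => by
      filter_upwards [ae_restrict_mem measurableSet_Ioi] with r hr
      exact mul_nonneg (waveDensity_nonneg hp3 hr) ((hadm n).nonneg _)
  have hn : ∀ n, ∫⁻ r in Ioi 0, ENNReal.ofReal (waveDensity p w V t₁ r * Θ n (r + t₁)) ≤
      ∫⁻ r in Ioi 0, ENNReal.ofReal (waveDensity p w V t₀ r * H r) := by
    intro n
    rw [← ofReal_integral_eq_lintegral_ofReal (hint n t₁) (hnn n t₁)]
    refine (ENNReal.ofReal_le_ofReal
      (h.weighted_energy_le hp3 hp5 ht (hadm n) (hzero n))).trans ?_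
    rw [ofReal_integral_eq_lintegral_ofReal (hint n t₀) (hnn n t₀)]
    refine setLIntegral_mono_ae' measurableSet_Ioi (Eventually.of_forall fun r hr => ?_)
    refine ENNReal.ofReal_le_ofReal (mul_le_mul_of_nonneg_left ?_ (waveDensity_nonneg hp3 hr))
    simp only [hΘ, add_sub_cancel_right]
    exact mul_le_of_le_one_right (hH.nonneg _) (Real.smoothTransition.le_one _)
  -- Fatou's lemma at the later time: each truncated integral is finite and already bounded by the
  -- initial weighted energy, so no finiteness of the limit is presupposed.
  calc ∫⁻ r in Ioi 0, ENNReal.ofReal (waveDensity p w V t₁ r * H (r + t₁ - t₀))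
      = ∫⁻ r in Ioi 0, liminf (fun n : ℕ =>
          ENNReal.ofReal (waveDensity p w V t₁ r * Θ n (r + t₁))) atTop := by
        refine lintegral_congr fun r => ?_
        refine (Tendsto.liminf_eq ?_).symm
        refine tendsto_const_nhds.congr' ?_
        filter_upwards [eventually_ge_atTop ⌈r + t₁ - t₀ + 1⌉₊] with n hn
        have : r + t₁ - t₀ + 1 ≤ n := (Nat.le_ceil _).trans (by exact_mod_cast hn)
        simp only [hΘ]
        rw [Real.smoothTransition.one_of_one_le (by linarith), mul_one]
    _ ≤ liminf (fun n : ℕ => ∫⁻ r in Ioi 0,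
          ENNReal.ofReal (waveDensity p w V t₁ r * Θ n (r + t₁))) atTop :=
        lintegral_liminf_le' fun n => (hint n t₁).1.aemeasurable.ennreal_ofReal
    _ ≤ _ := liminf_le_of_frequently_le' (Frequently.of_forall hn)

theorem isAdmissible_one : IsAdmissible 0 fun _ => 1 :=
  ⟨contDiff_const, fun _ => zero_le_one, fun _ => le_rfl, fun ρ _ => by simp⟩

/-- The weight `1` is admissible. Because the inequality holds in `[0, ∞]`, it propagates finiteness
forward in time as well as giving monotonicity. -/
theorem InwardWave.lintegral_density_le {p : ℝ} (hp3 : 3 ≤ p) (hp5 : p < 5) {w : ℝ → ℝ → ℝ}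
    {V : ℝ → L2} (h : InwardWave p w V) {t₀ t₁ : ℝ} (ht : t₀ ≤ t₁) :
    ∫⁻ r in Ioi 0, ENNReal.ofReal (waveDensity p w V t₁ r) ≤
      ∫⁻ r in Ioi 0, ENNReal.ofReal (waveDensity p w V t₀ r) := by
  simpa using h.lintegral_weighted_le hp3 hp5 ht isAdmissible_one

/-- A slowly growing weight, small for `x ≪ R` and at least `1/2` for `x ≥ R`. -/
noncomputable def growthWeight (R x : ℝ) : ℝ :=
  ((1 + x ^ 2) / (R ^ 2 + (1 + x ^ 2))) ^ (1 / 4 : ℝ)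

theorem growthWeight_base {R x : ℝ} :
    0 < (1 + x ^ 2) / (R ^ 2 + (1 + x ^ 2)) ∧ (1 + x ^ 2) / (R ^ 2 + (1 + x ^ 2)) ≤ 1 := by
  constructor
  · positivity
  · rw [div_le_one (by positivity)]
    linarith [sq_nonneg R]

/-- The numerator grows at infinity like `(x²)^{1/4} = x^{1/2}`, the borderline growth for `2 x H' ≤
H`. Exactly, `2 x H' / H = x² R² / ((R² + 1 + x²)(1 + x²)) ≤ 1`. -/
theorem growthWeight_isAdmissible (R : ℝ) : IsAdmissible 0 (growthWeight R) := by
  refine ⟨?_, fun x => ?_, fun x => ?_, fun x hx => ?_⟩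
  · unfold growthWeight
    refine ContDiff.rpow_const_of_ne (ContDiff.div (by fun_prop) (by fun_prop) fun x => ?_)
      fun x => growthWeight_base.1.ne'
    positivity
  · exact Real.rpow_nonneg growthWeight_base.1.le _
  · exact Real.rpow_le_one growthWeight_base.1.le growthWeight_base.2 (by norm_num)
  · obtain ⟨q0, q1⟩ := growthWeight_base (R := R) (x := x)
    have hA : 0 < R ^ 2 + (1 + x ^ 2) := by positivity
    have n1 : HasDerivAt (fun x : ℝ => 1 + x ^ 2) (2 * x) x := by
      simpa using (hasDerivAt_pow 2 x).const_add 1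
    have hq := n1.div (n1.const_add (R ^ 2)) hA.ne'
    have hd : HasDerivAt (growthWeight R) _ x :=
      hq.rpow_const (p := (1 / 4 : ℝ)) (Or.inl q0.ne')
    rw [hd.deriv, sub_zero]
    simp only [Pi.div_apply]
    rw [Real.rpow_sub_one q0.ne', growthWeight]
    set Q := ((1 + x ^ 2) / (R ^ 2 + (1 + x ^ 2))) ^ (1 / 4 : ℝ) with hQ
    have hQ0 : 0 ≤ Q := Real.rpow_nonneg q0.le _
    have e : 2 * (x * ((2 * x * (R ^ 2 + (1 + x ^ 2)) - (1 + x ^ 2) * (2 * x)) /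
        (R ^ 2 + (1 + x ^ 2)) ^ 2 * (1 / 4) * (Q / ((1 + x ^ 2) / (R ^ 2 + (1 + x ^ 2)))))) =
        Q * ((x ^ 2 * R ^ 2) / ((R ^ 2 + (1 + x ^ 2)) * (1 + x ^ 2))) := by
      field_simp
      ring
    rw [e]
    refine mul_le_of_le_one_right hQ0 ?_
    rw [div_le_one (by positivity)]
    nlinarith [sq_nonneg R, sq_nonneg x, sq_nonneg (x ^ 2), mul_nonneg (sq_nonneg R) (sq_nonneg x)]

theorem half_le_growthWeight {R x : ℝ} (hR : 0 ≤ R) (hx : R ≤ x) : 1 / 2 ≤ growthWeight R x := by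
  obtain ⟨q0, q1⟩ := growthWeight_base (R := R) (x := x)
  have h1 : 1 / 2 ≤ (1 + x ^ 2) / (R ^ 2 + (1 + x ^ 2)) := by
    rw [div_le_div_iff₀ (by norm_num) (by positivity)]
    nlinarith
  refine h1.trans ?_
  calc _ = ((1 + x ^ 2) / (R ^ 2 + (1 + x ^ 2))) ^ (1 : ℝ) := (Real.rpow_one _).symm
    _ ≤ _ := Real.rpow_le_rpow_of_exponent_ge q0 q1 (by norm_num)

theorem tendsto_growthWeight (x : ℝ) :
    Tendsto (fun n : ℕ => growthWeight n x) atTop (𝓝 0) := by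
  have h1 : Tendsto (fun n : ℕ => (n : ℝ) ^ 2 + (1 + x ^ 2)) atTop atTop :=
    tendsto_atTop_add_const_right _ _
      ((tendsto_pow_atTop two_ne_zero).comp tendsto_natCast_atTop_atTop)
  have h2 : Tendsto (fun n : ℕ => (1 + x ^ 2) / ((n : ℝ) ^ 2 + (1 + x ^ 2))) atTop (𝓝 0) :=
    tendsto_const_nhds.div_atTop h1
  have h3 := h2.rpow_const (p := (1 / 4 : ℝ)) (Or.inr (by norm_num))
  rwa [Real.zero_rpow (by norm_num)] at h3

/-- The inward energy of a wave with finite energy at some time tends to zero. -/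
theorem InwardWave.tendsto_lintegral_density {p : ℝ} (hp3 : 3 ≤ p) (hp5 : p < 5)
    {w : ℝ → ℝ → ℝ} {V : ℝ → L2} (h : InwardWave p w V) {t₀ : ℝ}
    (hfin : ∫⁻ r in Ioi 0, ENNReal.ofReal (waveDensity p w V t₀ r) ≠ ⊤) :
    Tendsto (fun t => ∫⁻ r in Ioi 0, ENNReal.ofReal (waveDensity p w V t r)) atTop (𝓝 0) := by
  have hlim : Tendsto (fun n : ℕ => ∫⁻ r in Ioi 0,
      ENNReal.ofReal (waveDensity p w V t₀ r * growthWeight n r)) atTop (𝓝 0) := by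
    have hm := h.aestronglyMeasurable_density hp3 t₀
    have := tendsto_lintegral_of_dominated_convergence' (μ := volume.restrict (Ioi (0 : ℝ)))
      (F := fun (n : ℕ) r => ENNReal.ofReal (waveDensity p w V t₀ r * growthWeight n r))
      (f := fun _ => 0) (fun r => ENNReal.ofReal (waveDensity p w V t₀ r))
      (fun n => (hm.mul (growthWeight_isAdmissible
        n).contDiff.continuous.aestronglyMeasurable).aemeasurable.ennreal_ofReal)
      (fun n => by
        filter_upwards [ae_restrict_mem measurableSet_Ioi] with r hr
        exact ENNReal.ofReal_le_ofReal (mul_le_of_le_one_right (waveDensity_nonneg hp3 hr)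
          ((growthWeight_isAdmissible n).le_one r))) hfin
      (Eventually.of_forall fun r => by
        have := ENNReal.tendsto_ofReal ((tendsto_growthWeight r).const_mul (waveDensity p w V t₀ r))
        simpa using this)
    simpa using this
  refine ENNReal.tendsto_nhds_zero.2 fun ε hε => ?_
  have hε2 : 0 < ε / 2 := ENNReal.half_pos hε.ne'
  -- `n` plays the role of `R`, chosen so that the initial weighted energy is at most `ε / 2`. After
  -- time `t₀ + n` the argument `r + t - t₀` exceeds `n`, where the weight is at least `1/2`.
  obtain ⟨n, hn⟩ := (hlim.eventually (eventually_le_nhds hε2)).exists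
  filter_upwards [eventually_ge_atTop (t₀ + n)] with t ht
  have h1 := h.lintegral_weighted_le hp3 hp5 (t₀ := t₀) (t₁ := t)
    (by linarith [(Nat.cast_nonneg n : (0 : ℝ) ≤ n)]) (growthWeight_isAdmissible n)
  have h2 : ∫⁻ r in Ioi 0, ENNReal.ofReal (waveDensity p w V t r) ≤
      2 * ∫⁻ r in Ioi 0, ENNReal.ofReal (waveDensity p w V t r * growthWeight n (r + t - t₀)) := by
    rw [← lintegral_const_mul' _ _ (by norm_num)]
    refine setLIntegral_mono_ae' measurableSet_Ioi (Eventually.of_forall fun r hr => ?_)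
    rw [← ENNReal.ofReal_ofNat 2, ← ENNReal.ofReal_mul zero_le_two]
    refine ENNReal.ofReal_le_ofReal ?_
    have := half_le_growthWeight (R := n) (x := r + t - t₀) (Nat.cast_nonneg n)
      (by rw [mem_Ioi] at hr; linarith)
    nlinarith [waveDensity_nonneg (V := V) (w := w) (t := t) hp3 hr]
  calc _ ≤ _ := h2
    _ ≤ 2 * (ε / 2) := by gcongr; exact h1.trans hn
    _ = ε := ENNReal.mul_div_cancel (by norm_num) (by norm_num)

end RadialWave

/-! ### Weak derivatives in one variable -/

namespace RadialWave

theorem integrable_test_mul_locallyIntegrableOn {I : Set ℝ} {g φ : ℝ → ℝ}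
    (hg : LocallyIntegrableOn g I) (hφ : Continuous φ) (hc : HasCompactSupport φ)
    (hs : tsupport φ ⊆ I) : Integrable fun x => φ x * g x := by
  obtain ⟨C, hC⟩ := exists_forall_abs_le hφ hc
  have h1 : IntegrableOn (fun x => φ x * g x) (tsupport φ) :=
    (hg.integrableOn_compact_subset hs hc).bdd_mul (c := C) hφ.aestronglyMeasurable
      (Eventually.of_forall hC)
  refine (integrableOn_iff_integrable_of_support_subset fun x hx => ?_).1 h1
  exact subset_tsupport _ (left_ne_zero_of_mul hx)

/-- A test function of zero mean, supported in an interval, is the derivative of a test function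
supported in the same interval. -/
theorem exists_primitive_test {I : Set ℝ} (hI : I.OrdConnected) {θ : ℝ → ℝ}
    (hθ : ContDiff ℝ ∞ θ) (hc : HasCompactSupport θ) (hs : tsupport θ ⊆ I) (h0 : ∫ x, θ x = 0) :
    ∃ a : ℝ → ℝ, ContDiff ℝ ∞ a ∧ HasCompactSupport a ∧ tsupport a ⊆ I ∧ deriv a = θ := by
  rcases (tsupport θ).eq_empty_or_nonempty with he | hne
  · have : θ = 0 := tsupport_eq_empty_iff.1 he
    refine ⟨fun _ => 0, contDiff_const, HasCompactSupport.zero, by simp [tsupport], ?_⟩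
    funext x
    simp [this]
  obtain ⟨a₀, ha₀, hmin⟩ := hc.exists_isLeast hne
  obtain ⟨b₀, hb₀, hmax⟩ := hc.exists_isGreatest hne
  have hz : ∀ x, x ∉ Icc a₀ b₀ → θ x = 0 := fun x hx => by
    refine image_eq_zero_of_notMem_tsupport fun hxs => hx ⟨hmin hxs, hmax hxs⟩
  have hd : ∀ x, HasDerivAt (fun x => ∫ y in a₀..x, θ y) (θ x) x := fun x =>
    intervalIntegral.integral_hasDerivAt_right (hθ.continuous.intervalIntegrable _ _)
      hθ.continuous.stronglyMeasurable.stronglyMeasurableAtFilter hθ.continuous.continuousAt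
  have hderiv : deriv (fun x => ∫ y in a₀..x, θ y) = θ := funext fun x => (hd x).deriv
  have hzero : ∀ x, x ∉ Icc a₀ b₀ → ∫ y in a₀..x, θ y = 0 := by
    intro x hx
    rcases lt_or_ge x a₀ with h1 | h1
    · have e : ∫ y in a₀..x, θ y = ∫ y in a₀..x, (0 : ℝ) := by
        -- The half-open interval of integration contains its endpoint `a₀`, which is discarded as a
        -- null set.
        have hae : ∀ᵐ y : ℝ, y ≠ a₀ := by simp [ae_iff]
        refine intervalIntegral.integral_congr_ae (hae.mono fun y hy hy' => ?_)
        rw [uIoc_of_ge h1.le] at hy'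
        exact hz y fun h => absurd (lt_of_le_of_ne hy'.2 hy) (not_lt.2 h.1)
      rw [e]; simp
    · have h2 : b₀ < x := by
        by_contra h2
        exact hx ⟨h1, not_lt.1 h2⟩
      rw [intervalIntegral.integral_of_le h1, ← integral_Icc_eq_integral_Ioc,
        setIntegral_eq_integral_of_forall_compl_eq_zero, h0]
      intro y hy
      exact hz y fun h => hy ⟨h.1, h.2.trans h2.le⟩
  have hsub : tsupport (fun x => ∫ y in a₀..x, θ y) ⊆ Icc a₀ b₀ :=
    closure_minimal (fun x hx => by_contra fun h => hx (hzero x h)) isClosed_Icc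
  refine ⟨fun x => ∫ y in a₀..x, θ y, ?_, HasCompactSupport.intro isCompact_Icc hzero,
    hsub.trans (hI.out (hs ha₀) (hs hb₀)), hderiv⟩
  rw [contDiff_infty_iff_deriv]
  exact ⟨fun x => (hd x).differentiableAt, by rwa [hderiv]⟩

/-- The du Bois-Reymond lemma: a function with vanishing weak derivative on an open interval is
almost everywhere constant there. -/
theorem exists_ae_eq_const {I : Set ℝ} (hI : IsOpen I) (hI' : I.OrdConnected) (hne : I.Nonempty)
    {g : ℝ → ℝ} (hg : LocallyIntegrableOn g I)
    (h : ∀ a : ℝ → ℝ, ContDiff ℝ ∞ a → HasCompactSupport a → tsupport a ⊆ I →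
      ∫ x, deriv a x * g x = 0) :
    ∃ c, ∀ᵐ x, x ∈ I → g x = c := by
  obtain ⟨x₀, hx₀⟩ := hne
  obtain ⟨ε, hε, hball⟩ := Metric.isOpen_iff.1 hI x₀ hx₀
  let f : ContDiffBump x₀ := ⟨ε / 4, ε / 2, by linarith, by linarith⟩
  set ζ : ℝ → ℝ := f.normed volume with hζ
  have hζ1 : ContDiff ℝ ∞ ζ := f.contDiff_normed
  have hζ2 : HasCompactSupport ζ := f.hasCompactSupport_normed
  have hζ3 : tsupport ζ ⊆ I := by
    rw [hζ, f.tsupport_normed_eq]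
    exact (Metric.closedBall_subset_ball (by simp only [f]; linarith)).trans hball
  have hζ4 : ∫ x, ζ x = 1 := f.integral_normed
  have hint := fun φ (h1 : Continuous φ) (h2 : HasCompactSupport φ) (h3 : tsupport φ ⊆ I) =>
    integrable_test_mul_locallyIntegrableOn hg h1 h2 h3
  set c := ∫ x, ζ x * g x with hcdef
  refine ⟨c, ?_⟩
  have hgc : LocallyIntegrableOn (fun x => g x - c) I :=
    hg.sub (locallyIntegrableOn_const c)
  have := hI.ae_eq_zero_of_integral_contDiff_smul_eq_zero hgc fun φ hφ hφc hφs => ?_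
  · filter_upwards [this] with x hx hxI
    linarith [hx hxI]
  have hφi : Integrable φ := hφ.continuous.integrable_of_hasCompactSupport hφc
  have hζi : Integrable ζ := hζ1.continuous.integrable_of_hasCompactSupport hζ2
  -- Subtracting `(∫ φ) ζ`, with `∫ ζ = 1`, leaves mean zero, hence a derivative of a test function.
  -- This identifies the constant as `∫ ζ g`.
  obtain ⟨a, ha1, ha2, ha3, ha4⟩ := exists_primitive_test hI'
    (θ := fun x => φ x - (∫ y, φ y) * ζ x) (by fun_prop)
    (hφc.sub hζ2.mul_left)
    ((tsupport_sub _ _).trans (union_subset hφs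
      ((closure_mono (Function.support_mul_subset_right _ _)).trans hζ3)))
    (by
      rw [integral_sub hφi (hζi.const_mul _), integral_const_mul, hζ4]
      ring)
  have h1 := h a ha1 ha2 ha3
  rw [ha4] at h1
  have i1 := hint φ hφ.continuous hφc hφs
  have i2 := hint ζ hζ1.continuous hζ2 hζ3
  have e1 : ∫ x, (φ x - (∫ y, φ y) * ζ x) * g x = (∫ x, φ x * g x) - (∫ y, φ y) * c := by
    rw [hcdef, ← integral_const_mul, ← integral_sub i1 (i2.const_mul _)]
    exact integral_congr_ae (Eventually.of_forall fun x => by ring)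
  have e2 : ∫ x, φ x • (g x - c) = (∫ x, φ x * g x) - (∫ y, φ y) * c := by
    rw [← integral_mul_const, ← integral_sub i1 (hφi.mul_const _)]
    exact integral_congr_ae (Eventually.of_forall fun x => by simp only [smul_eq_mul]; ring)
  rw [e2, ← e1, h1]

/-- A continuous function with continuous weak derivative is differentiable. -/
theorem hasDerivAt_of_weak_deriv {m n : ℝ → ℝ} (hm : Continuous m) (hn : Continuous n)
    (h : ∀ a : ℝ → ℝ, ContDiff ℝ ∞ a → HasCompactSupport a →
      ∫ t, deriv a t * m t = -∫ t, a t * n t) (t : ℝ) : HasDerivAt m (n t) t := by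
  have hd : ∀ x, HasDerivAt (fun x => ∫ y in (0 : ℝ)..x, n y) (n x) x := fun x =>
    intervalIntegral.integral_hasDerivAt_right (hn.intervalIntegrable _ _)
      hn.stronglyMeasurable.stronglyMeasurableAtFilter hn.continuousAt
  have hNc : Continuous fun x => ∫ y in (0 : ℝ)..x, n y :=
    continuous_iff_continuousAt.2 fun x => (hd x).continuousAt
  obtain ⟨c, hc⟩ := exists_ae_eq_const isOpen_univ ordConnected_univ univ_nonempty
    (g := fun x => m x - ∫ y in (0 : ℝ)..x, n y)
    ((hm.sub hNc).locallyIntegrable.locallyIntegrableOn _) (fun a ha hac _ => by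
      have ha' : Continuous (deriv a) := ha.continuous_deriv (by simp)
      have hIBP : ∫ x, (∫ y in (0 : ℝ)..x, n y) * deriv a x = -∫ x, n x * a x :=
        integral_mul_deriv_eq_deriv_mul_of_integrable (fun x _ => hd x)
          (fun x _ => (ha.differentiable (by simp) x).hasDerivAt)
          ((hNc.mul ha').integrable_of_hasCompactSupport hac.deriv.mul_left)
          ((hn.mul ha.continuous).integrable_of_hasCompactSupport hac.mul_left)
          ((hNc.mul ha.continuous).integrable_of_hasCompactSupport hac.mul_left)
      have e : ∀ x, deriv a x * (m x - ∫ y in (0 : ℝ)..x, n y) =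
          deriv a x * m x - (∫ y in (0 : ℝ)..x, n y) * deriv a x := fun x => by ring
      simp only [e]
      rw [integral_sub, hIBP, h a ha hac]
      · simp only [mul_comm]; ring
      · exact (ha'.mul hm).integrable_of_hasCompactSupport hac.deriv.mul_right
      · exact (hNc.mul ha').integrable_of_hasCompactSupport hac.deriv.mul_left)
  -- Continuity of both sides upgrades the almost everywhere identity to every time.
  have heq : (fun x => m x - ∫ y in (0 : ℝ)..x, n y) = fun _ => c :=
    (Continuous.ae_eq_iff_eq volume (hm.sub hNc) continuous_const).1
      (hc.mono fun x hx => hx (mem_univ x))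
  refine ((hd t).const_add c).congr_of_eventuallyEq (Eventually.of_forall fun x => ?_)
  have := congrFun heq x
  beta_reduce at this
  linarith

end RadialWave

/-! ### Radial calculus on `ℝ³` -/

namespace RadialWave

/-- The constant in the formula for integrals of radial functions on `ℝ³`. -/
noncomputable def sphereConst : ℝ := 3 * (volume : Measure E3).real (Metric.ball 0 1)

/-- Only positivity of this constant is needed later, never its value. -/
theorem sphereConst_pos : 0 < sphereConst := by
  have : 0 < (volume : Measure E3).real (Metric.ball 0 1) :=
    ENNReal.toReal_pos (Metric.measure_ball_pos _ _ one_pos).ne' measure_ball_lt_top.ne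
  unfold sphereConst
  positivity

theorem integral_radial (k : ℝ → ℝ) :
    ∫ x : E3, k ‖x‖ = sphereConst * ∫ r in Ioi 0, r ^ 2 * k r := by
  rw [integral_fun_norm_addHaar]
  simp [sphereConst, mul_assoc]

theorem integrable_radial_iff {k : ℝ → ℝ} :
    Integrable (fun x : E3 => k ‖x‖) ↔ IntegrableOn (fun r => r ^ 2 * k r) (Ioi 0) := by
  rw [integrable_fun_norm_addHaar]
  simp

theorem IsRadial.eq_profile {f : E3 → ℝ} (hf : IsRadial f) (x : E3) : f x = profile f ‖x‖ :=
  hf _ _ (by simp)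

/-- Test functions on the half line. -/
structure IsTest (β : ℝ → ℝ) : Prop where
  contDiff : ContDiff ℝ ∞ β
  hasCompactSupport : HasCompactSupport β
  tsupport_subset : tsupport β ⊆ Ioi 0

theorem IsTest.exists_pos {β : ℝ → ℝ} (h : IsTest β) : ∃ δ, 0 < δ ∧ ∀ r ≤ δ, β r = 0 := by
  rcases (tsupport β).eq_empty_or_nonempty with he | hne
  · have : β = 0 := tsupport_eq_empty_iff.1 he
    exact ⟨1, one_pos, fun r _ => by simp [this]⟩
  · obtain ⟨a, ha, hmin⟩ := h.hasCompactSupport.exists_isLeast hne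
    have ha0 : 0 < a := h.tsupport_subset ha
    refine ⟨a / 2, by linarith, fun r hr => image_eq_zero_of_notMem_tsupport fun hrs => ?_⟩
    linarith [hmin hrs]

theorem IsTest.mul {β g : ℝ → ℝ} (h : IsTest β) (hg : ContDiffOn ℝ ∞ g (Ioi 0)) :
    IsTest fun r => β r * g r := by
  obtain ⟨δ, hδ, h0⟩ := h.exists_pos
  exact ⟨contDiff_mul_of_eq_zero h.contDiff hδ h0 hg, h.hasCompactSupport.mul_right,
    tsupport_mul_subset_left.trans h.tsupport_subset⟩

theorem IsTest.deriv_test {β : ℝ → ℝ} (h : IsTest β) : IsTest (deriv β) :=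
  ⟨h.contDiff.deriv', h.hasCompactSupport.deriv, tsupport_deriv_subset.trans h.tsupport_subset⟩

theorem IsTest.mul_inv {β : ℝ → ℝ} (h : IsTest β) : IsTest fun r => β r * r⁻¹ :=
  h.mul (contDiffOn_inv ℝ |>.mono fun _ hr => ne_of_gt hr)

theorem IsTest.contDiff_radial {γ : ℝ → ℝ} (h : IsTest γ) :
    ContDiff ℝ ∞ fun x : E3 => γ ‖x‖ := by
  obtain ⟨δ, hδ, h0⟩ := h.exists_pos
  rw [contDiff_iff_contDiffAt]
  intro x
  by_cases hx : x = 0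
  · have : (fun x : E3 => γ ‖x‖) =ᶠ[𝓝 x] fun _ => 0 := by
      subst hx
      filter_upwards [Metric.ball_mem_nhds (0 : E3) hδ] with y hy
      exact h0 _ (mem_ball_zero_iff.1 hy).le
    exact contDiffAt_const.congr_of_eventuallyEq this
  · exact h.contDiff.contDiffAt.comp x (contDiffAt_norm ℝ hx)

theorem IsTest.hasCompactSupport_radial {γ : ℝ → ℝ} (h : IsTest γ) :
    HasCompactSupport fun x : E3 => γ ‖x‖ := by
  obtain ⟨R, hR⟩ := h.hasCompactSupport.isBounded.subset_closedBall 0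
  refine HasCompactSupport.intro (isCompact_closedBall (0 : E3) R) fun x hx => ?_
  refine image_eq_zero_of_notMem_tsupport fun hxs => hx ?_
  have := hR hxs
  simpa using this

/-- The `i`-th coordinate direction. -/
noncomputable def basisVec (i : Fin 3) : E3 := EuclideanSpace.single i 1

theorem norm_line_sq (x : E3) (i : Fin 3) (s : ℝ) :
    ‖x + s • basisVec i‖ ^ 2 = ‖x‖ ^ 2 + 2 * s * x i + s ^ 2 := by
  rw [@norm_add_sq_real, inner_smul_right, basisVec, EuclideanSpace.inner_single_right, norm_smul]
  simp
  ring

theorem hasDerivAt_norm_line {x : E3} {s : ℝ} {i : Fin 3} (hx : x + s • basisVec i ≠ 0) :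
    HasDerivAt (fun s => ‖x + s • basisVec i‖) ((x i + s) / ‖x + s • basisVec i‖) s := by
  have hpos : 0 < ‖x + s • basisVec i‖ := norm_pos_iff.2 hx
  have e : (fun s => ‖x + s • basisVec i‖) = fun s => √(‖x‖ ^ 2 + 2 * s * x i + s ^ 2) := by
    funext s
    rw [← norm_line_sq, Real.sqrt_sq (norm_nonneg _)]
  have h1 : HasDerivAt (fun s : ℝ => ‖x‖ ^ 2 + 2 * s * x i + s ^ 2) (2 * x i + 2 * s) s := by
    have a := (((hasDerivAt_id s).const_mul 2).mul_const (x i)).const_add (‖x‖ ^ 2)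
    exact (a.add (hasDerivAt_pow 2 s)).congr_deriv (by simp)
  have h2 := h1.sqrt (by rw [← norm_line_sq]; positivity)
  rw [← e] at h2
  refine h2.congr_deriv ?_
  rw [← norm_line_sq, Real.sqrt_sq (norm_nonneg _)]
  field_simp

theorem sum_sq_eq (x : E3) : ∑ i, x i ^ 2 = ‖x‖ ^ 2 := by
  rw [EuclideanSpace.norm_sq_eq]
  simp

theorem hasDerivAt_line {f : E3 → ℝ} (hf : ContDiff ℝ ∞ f) (x v : E3) (s : ℝ) :
    HasDerivAt (fun s : ℝ => f (x + s • v)) (fderiv ℝ f (x + s • v) v) s := by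
  have h1 : HasDerivAt (fun s : ℝ => x + s • v) v s := by
    simpa using ((hasDerivAt_id s).smul_const v).const_add x
  exact (hf.differentiable (by simp) _).hasFDerivAt.comp_hasDerivAt s h1

/-- The divergence of a radial vector field `γ(|x|) x`. -/
theorem IsTest.sum_gradient {γ : ℝ → ℝ} (h : IsTest γ) (x : E3) :
    ∑ i, gradient (fun y : E3 => γ ‖y‖ * y i) x i = deriv γ ‖x‖ * ‖x‖ + 3 * γ ‖x‖ := by
  have hsm : ∀ i : Fin 3, ContDiff ℝ ∞ fun y : E3 => γ ‖y‖ * y i := fun i =>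
    h.contDiff_radial.mul (by fun_prop)
  have hg : ∀ i, gradient (fun y : E3 => γ ‖y‖ * y i) x i =
      deriv (fun s : ℝ => γ ‖x + s • basisVec i‖ * (x i + s)) 0 := by
    intro i
    have h1 := (hasDerivAt_line (hsm i) x (basisVec i) 0).deriv
    have e : (fun s : ℝ => γ ‖x + s • basisVec i‖ * (x + s • basisVec i) i) =
        fun s : ℝ => γ ‖x + s • basisVec i‖ * (x i + s) := by
      funext s; simp [basisVec]
    rw [e] at h1
    rw [h1, zero_smul, add_zero]
    have h2 := inner_gradient_left (𝕜 := ℝ) (f := fun y : E3 => γ ‖y‖ * y i) (x := x)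
      (y := basisVec i)
    rw [← h2, basisVec, EuclideanSpace.inner_single_right]
    simp
  by_cases hx : x = 0
  · obtain ⟨δ, hδ, h0⟩ := h.exists_pos
    have hz : ∀ i, deriv (fun s : ℝ => γ ‖x + s • basisVec i‖ * (x i + s)) 0 = 0 := by
      intro i
      have : (fun s : ℝ => γ ‖x + s • basisVec i‖ * (x i + s)) =ᶠ[𝓝 0] fun _ => 0 := by
        filter_upwards [Metric.ball_mem_nhds (0 : ℝ) hδ] with s hs
        have : ‖x + s • basisVec i‖ ≤ δ := by
          rw [hx, zero_add, norm_smul]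
          simpa [basisVec] using (mem_ball_zero_iff.1 hs).le
        rw [h0 _ this, zero_mul]
      simp [this.deriv_eq]
    simp only [hg, hz]
    simp [hx, h0 0 hδ.le]
  · have hpos : 0 < ‖x‖ := norm_pos_iff.2 hx
    have hv : ∀ i, deriv (fun s : ℝ => γ ‖x + s • basisVec i‖ * (x i + s)) 0 =
        deriv γ ‖x‖ / ‖x‖ * x i ^ 2 + γ ‖x‖ := by
      intro i
      have h1 := hasDerivAt_norm_line (x := x) (s := 0) (i := i) (by simpa using hx)
      have h2 : HasDerivAt γ (deriv γ ‖x + (0 : ℝ) • basisVec i‖)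
          ‖x + (0 : ℝ) • basisVec i‖ :=
        (h.contDiff.differentiable (by simp) _).hasDerivAt
      have h3 := (HasDerivAt.comp (h := fun s : ℝ => ‖x + s • basisVec i‖) 0 h2 h1).mul
        ((hasDerivAt_id (0 : ℝ)).const_add (x i))
      refine h3.deriv.trans ?_
      simp
      ring
    simp only [hg, hv]
    rw [Finset.sum_add_distrib, ← Finset.mul_sum, sum_sq_eq]
    simp
    field_simp

/-- The Laplacian of `β(|x|) / |x|` is `β''(|x|) / |x|`. -/
theorem IsTest.laplacian_radial {β : ℝ → ℝ} (h : IsTest β) (x : E3) :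
    Laplacian.laplacian (fun y : E3 => β ‖y‖ * ‖y‖⁻¹) x =
      deriv (deriv β) ‖x‖ * ‖x‖⁻¹ := by
  set γ : ℝ → ℝ := fun r => β r * r⁻¹ with hγdef
  have hγ : IsTest γ := h.mul_inv
  have hsm : ContDiff ℝ ∞ fun y : E3 => γ ‖y‖ := hγ.contDiff_radial
  change Laplacian.laplacian (fun y : E3 => γ ‖y‖) x = _
  rw [InnerProductSpace.laplacian_eq_iteratedFDeriv_orthonormalBasis _
    (EuclideanSpace.basisFun (Fin 3) ℝ)]
  have hterm : ∀ i, iteratedFDeriv ℝ 2 (fun y : E3 => γ ‖y‖) x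
      ![EuclideanSpace.basisFun (Fin 3) ℝ i, EuclideanSpace.basisFun (Fin 3) ℝ i] =
      deriv (deriv fun s : ℝ => γ ‖x + s • basisVec i‖) 0 := by
    intro i
    rw [iteratedFDeriv_two_apply]
    simp only [EuclideanSpace.basisFun_apply, Matrix.cons_val_zero, Matrix.cons_val_one]
    have e1 : (deriv fun s : ℝ => γ ‖x + s • basisVec i‖) =
        fun s => fderiv ℝ (fun y : E3 => γ ‖y‖) (x + s • basisVec i) (basisVec i) :=
      funext fun s => (hasDerivAt_line hsm x (basisVec i) s).deriv
    have h2 : ContDiff ℝ ∞ (fderiv ℝ fun y : E3 => γ ‖y‖) := hsm.fderiv_right (by simp)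
    have h3 : HasDerivAt (fun s : ℝ => x + s • basisVec i) (basisVec i) 0 := by
      simpa using ((hasDerivAt_id (0 : ℝ)).smul_const (basisVec i)).const_add x
    have h4 := (h2.differentiable (by simp) (x + (0 : ℝ) • basisVec i)).hasFDerivAt.comp_hasDerivAt
      (0 : ℝ) h3
    have h5 := h4.clm_apply (hasDerivAt_const (0 : ℝ) (basisVec i))
    rw [e1]
    refine Eq.trans ?_ h5.deriv.symm
    simp [basisVec]
  simp only [hterm]
  by_cases hx : x = 0
  · obtain ⟨δ, hδ, h0⟩ := hγ.exists_pos
    have hz : ∀ i, deriv (deriv fun s : ℝ => γ ‖x + s • basisVec i‖) 0 = 0 := by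
      intro i
      have : (fun s : ℝ => γ ‖x + s • basisVec i‖) =ᶠ[𝓝 0] fun _ => 0 := by
        filter_upwards [Metric.ball_mem_nhds (0 : ℝ) hδ] with s hs
        have : ‖x + s • basisVec i‖ ≤ δ := by
          rw [hx, zero_add, norm_smul]
          simpa [basisVec] using (mem_ball_zero_iff.1 hs).le
        exact h0 _ this
      rw [this.deriv.deriv_eq]
      simp
    simp only [hz]
    simp [hx]
  · have hpos : 0 < ‖x‖ := norm_pos_iff.2 hx
    have hv : ∀ i, deriv (deriv fun s : ℝ => γ ‖x + s • basisVec i‖) 0 =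
        (deriv (deriv γ) ‖x‖ / ‖x‖ ^ 2 - deriv γ ‖x‖ / ‖x‖ ^ 3) * x i ^ 2 +
          deriv γ ‖x‖ / ‖x‖ := by
      intro i
      have hne : ∀ᶠ s : ℝ in 𝓝 0, x + s • basisVec i ≠ 0 := by
        have hc : ContinuousAt (fun s : ℝ => x + s • basisVec i) 0 := by fun_prop
        exact hc.eventually_ne (by simpa using hx)
      have e1 : (deriv fun s : ℝ => γ ‖x + s • basisVec i‖) =ᶠ[𝓝 0]
          fun s => deriv γ ‖x + s • basisVec i‖ * ((x i + s) / ‖x + s • basisVec i‖) := by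
        filter_upwards [hne] with s hs
        exact (HasDerivAt.comp (h := fun s : ℝ => ‖x + s • basisVec i‖) s
          (hγ.contDiff.differentiable (by simp) _).hasDerivAt (hasDerivAt_norm_line hs)).deriv
      rw [e1.deriv_eq]
      have h1 := hasDerivAt_norm_line (x := x) (s := 0) (i := i) (by simpa using hx)
      have h2 : HasDerivAt (deriv γ) (deriv (deriv γ) ‖x + (0 : ℝ) • basisVec i‖)
          ‖x + (0 : ℝ) • basisVec i‖ :=
        (hγ.deriv_test.contDiff.differentiable (by simp) _).hasDerivAt
      have h3 := (HasDerivAt.comp (h := fun s : ℝ => ‖x + s • basisVec i‖) 0 h2 h1).mul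
        (((hasDerivAt_id (0 : ℝ)).const_add (x i)).div h1 (by simpa using hx))
      refine h3.deriv.trans ?_
      simp
      field_simp
      ring
    -- Summing with `∑ xᵢ² = |x|²` gives `γ'' + 2 γ'/r`, and for `γ = β/r` this is `β''/r`.
    simp only [hv]
    rw [Finset.sum_add_distrib, ← Finset.mul_sum, sum_sq_eq]
    have d1 : ∀ r, 0 < r → deriv γ r = deriv β r * r⁻¹ - β r * (r ^ 2)⁻¹ := by
      intro r hr
      have := ((h.contDiff.differentiable (by simp) r).hasDerivAt).mul (hasDerivAt_inv hr.ne')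
      refine this.deriv.trans (by ring)
    have d2 : deriv (deriv γ) ‖x‖ = deriv (deriv β) ‖x‖ * ‖x‖⁻¹ -
        2 * deriv β ‖x‖ * (‖x‖ ^ 2)⁻¹ + 2 * β ‖x‖ * (‖x‖ ^ 3)⁻¹ := by
      have e : deriv γ =ᶠ[𝓝 ‖x‖] fun r => deriv β r * r⁻¹ - β r * (r ^ 2)⁻¹ := by
        filter_upwards [Ioi_mem_nhds hpos] with r hr using d1 r hr
      rw [e.deriv_eq]
      have a1 := ((h.deriv_test.contDiff.differentiable (by simp) ‖x‖).hasDerivAt).mul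
        (hasDerivAt_inv hpos.ne')
      have a2 := ((h.contDiff.differentiable (by simp) ‖x‖).hasDerivAt).mul
        ((hasDerivAt_pow 2 ‖x‖).inv (by positivity))
      refine (a1.sub a2).deriv.trans ?_
      simp
      field_simp
      ring
    rw [d2, d1 _ hpos]
    simp
    field_simp
    ring

end RadialWave

/-! ### Square integrable functions and weak gradients in polar coordinates -/

namespace RadialWave

/-- Allows almost everywhere identities in `r` to be pulled back to `ℝ³`. It is the polar coordinate
formula applied to the indicator of a null set. -/
theorem quasiMeasurePreserving_norm :
    Measure.QuasiMeasurePreserving (fun x : E3 => ‖x‖) volume volume := by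
  refine ⟨measurable_norm, Measure.AbsolutelyContinuous.mk fun s hs h0 => ?_⟩
  rw [Measure.map_apply measurable_norm hs]
  have hz : (fun r : ℝ => r ^ 2 * s.indicator (fun _ => (1 : ℝ)) r)
      =ᵐ[volume.restrict (Ioi 0)] fun _ => 0 := by
    refine ae_restrict_of_ae ?_
    filter_upwards [measure_eq_zero_iff_ae_notMem.1 h0] with r hr
    simp [hr]
  have hi : Integrable fun x : E3 => s.indicator (fun _ => (1 : ℝ)) ‖x‖ :=
    integrable_radial_iff.2 ((integrable_zero _ _ _).congr hz.symm)
  have h1 : ∫ x : E3, s.indicator (fun _ => (1 : ℝ)) ‖x‖ = 0 := by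
    rw [integral_radial, integral_congr_ae hz]
    simp
  have h2 := (integral_eq_zero_iff_of_nonneg
    (fun x => indicator_nonneg (fun _ _ => zero_le_one) _) hi).1 h1
  refine measure_eq_zero_iff_ae_notMem.2 (h2.mono fun x hx hxs => ?_)
  have hxs' : ‖x‖ ∈ s := hxs
  simp [hxs'] at hx

/-- Square integrable functions on `ℝ³`. -/
abbrev L2E : Type := Lp ℝ 2 (volume : Measure E3)

theorem memLp_radial {k : ℝ → ℝ} (hk : AEStronglyMeasurable (fun x : E3 => k ‖x‖))
    (hi : IntegrableOn (fun r => r ^ 2 * k r ^ 2) (Ioi 0)) : MemLp (fun x : E3 => k ‖x‖) 2 :=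
  (memLp_two_iff_integrable_sq hk).2 ((integrable_radial_iff (k := fun r => k r ^ 2)).2 hi)

theorem sq_mul_div_sq_eqOn (φ : ℝ → ℝ) :
    EqOn (fun r => φ r ^ 2) (fun r => r ^ 2 * (φ r * r⁻¹) ^ 2) (Ioi 0) := by
  intro r hr
  have : r ≠ 0 := ne_of_gt hr
  beta_reduce
  field_simp

theorem memLp_lift (φ : L2) : MemLp (fun x : E3 => φ ‖x‖ * ‖x‖⁻¹) 2 := by
  refine memLp_radial (k := fun r => φ r * r⁻¹) ?_ ?_
  · exact (((Lp.stronglyMeasurable φ).measurable.comp measurable_norm).mul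
      measurable_norm.inv).aestronglyMeasurable
  · exact (integrable_sq_L2 φ).integrableOn.congr_fun (sq_mul_div_sq_eqOn _) measurableSet_Ioi

theorem norm_lift_le (φ : L2) : ‖(memLp_lift φ).toLp _‖ ≤ √sphereConst * ‖φ‖ := by
  refine le_of_sq_le_sq ?_ (by positivity)
  rw [mul_pow, Real.sq_sqrt sphereConst_pos.le, ← real_inner_self_eq_norm_sq, L2.inner_def]
  have e : ∫ x, inner ℝ ((memLp_lift φ).toLp _ x) ((memLp_lift φ).toLp _ x) =
      ∫ x : E3, (φ ‖x‖ * ‖x‖⁻¹) ^ 2 := by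
    refine integral_congr_ae ((memLp_lift φ).coeFn_toLp.mono fun x hx => ?_)
    beta_reduce
    rw [hx, real_inner_self_eq_norm_sq, Real.norm_eq_abs, sq_abs]
  rw [e, integral_radial (fun r => (φ r * r⁻¹) ^ 2),
    ← setIntegral_congr_fun measurableSet_Ioi (sq_mul_div_sq_eqOn φ), ← integral_sq_eq_norm]
  exact mul_le_mul_of_nonneg_left (setIntegral_le_integral (integrable_sq_L2 φ)
    (Eventually.of_forall fun _ => sq_nonneg _)) sphereConst_pos.le

/-- The bounded operator taking `φ` to the function `φ(|x|) / |x|`. -/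
noncomputable def lift : L2 →L[ℝ] L2E :=
  LinearMap.mkContinuous
    { toFun := fun φ => (memLp_lift φ).toLp _
      map_add' := fun φ ψ => by
        rw [← MemLp.toLp_add]
        refine MemLp.toLp_congr _ _ ?_
        filter_upwards [quasiMeasurePreserving_norm.ae_eq_comp (Lp.coeFn_add φ ψ)] with x hx
        simp only [Function.comp_apply, Pi.add_apply] at hx ⊢
        rw [hx]; ring
      map_smul' := fun c φ => by
        rw [RingHom.id_apply, ← MemLp.toLp_const_smul]
        refine MemLp.toLp_congr _ _ ?_
        filter_upwards [quasiMeasurePreserving_norm.ae_eq_comp (Lp.coeFn_smul c φ)] with x hx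
        simp only [Function.comp_apply, Pi.smul_apply, smul_eq_mul] at hx ⊢
        rw [hx]; ring }
    (√sphereConst) norm_lift_le

theorem coeFn_lift (φ : L2) : lift φ =ᵐ[volume] fun x : E3 => φ ‖x‖ * ‖x‖⁻¹ :=
  (memLp_lift φ).coeFn_toLp

/-- The radial component of a square integrable vector field. -/
theorem memLp_radialComponent {G : E3 → E3} (hG : MemLp G 2) :
    MemLp (fun x => inner ℝ x (G x) * ‖x‖⁻¹) 2 := by
  refine hG.of_le ?_ (Eventually.of_forall fun x => ?_)
  · exact (continuous_id.aestronglyMeasurable.inner hG.1).mul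
      measurable_norm.inv.aestronglyMeasurable
  · rw [norm_mul, norm_inv, norm_norm]
    rcases eq_or_ne x 0 with rfl | hx
    · simp
    · have := norm_inner_le_norm (𝕜 := ℝ) x (G x)
      have hx' : 0 < ‖x‖ := norm_pos_iff.2 hx
      rw [mul_inv_le_iff₀ hx']
      linarith

/-- The averaged radial derivative of a function on `ℝ³` with weak gradient `G`, times `r`. -/
noncomputable def radialDeriv {G : E3 → E3} (hG : MemLp G 2) : L2 :=
  sphereConst⁻¹ • (ContinuousLinearMap.adjoint lift) ((memLp_radialComponent hG).toLp _)

/-- The duality that characterizes `radialDeriv`. The weak gradient is not assumed to be a radial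
field, so its radial component has no profile of its own, and the adjoint of `lift` performs the
spherical averaging. -/
theorem sphereConst_mul_integral_radialDeriv {G : E3 → E3} (hG : MemLp G 2) {b : ℝ → ℝ}
    (hb : MemLp b 2) :
    sphereConst * ∫ r, b r * radialDeriv hG r =
      ∫ x : E3, b ‖x‖ * ‖x‖⁻¹ * (inner ℝ x (G x) * ‖x‖⁻¹) := by
  have h1 : ∫ r, b r * radialDeriv hG r = inner ℝ (radialDeriv hG) (hb.toLp b) := by
    rw [inner_eq_integral]
    refine integral_congr_ae (hb.coeFn_toLp.mono fun r hr => ?_)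
    simp only [hr, mul_comm]
  rw [h1, radialDeriv, inner_smul_left, ContinuousLinearMap.adjoint_inner_left, L2.inner_def]
  simp only [conj_trivial]
  rw [mul_inv_cancel_left₀ sphereConst_pos.ne']
  refine integral_congr_ae ?_
  filter_upwards [coeFn_lift (hb.toLp b), (memLp_radialComponent hG).coeFn_toLp,
    quasiMeasurePreserving_norm.ae_eq_comp hb.coeFn_toLp] with x h2 h3 h4
  simp only [Function.comp_apply] at h4
  simp [h2, h3, h4]

/-- `G ↦ x·G/|x|` is a contraction of `L²` by Cauchy–Schwarz, and the adjoint is bounded. -/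
theorem continuous_radialDeriv {G : ℝ → E3 → E3} (hG : ∀ t, MemLp (G t) 2)
    (hc : ∀ t₀, Tendsto (fun t => eLpNorm (G t - G t₀) 2) (𝓝 t₀) (𝓝 0)) :
    Continuous fun t => radialDeriv (hG t) := by
  refine ((ContinuousLinearMap.continuous (ContinuousLinearMap.adjoint lift)).comp ?_).const_smul
    sphereConst⁻¹
  rw [continuous_iff_continuousAt]
  intro t₀
  refine (Lp.tendsto_Lp_iff_tendsto_eLpNorm'' _ (fun t => memLp_radialComponent (hG t)) _
    (memLp_radialComponent (hG t₀))).2 ?_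
  refine tendsto_of_tendsto_of_tendsto_of_le_of_le tendsto_const_nhds (hc t₀)
    (fun _ => zero_le) fun t => ?_
  refine eLpNorm_mono_ae (Eventually.of_forall fun x => ?_)
  have e : ((fun x => inner ℝ x (G t x) * ‖x‖⁻¹) - fun x => inner ℝ x (G t₀ x) * ‖x‖⁻¹) x =
      inner ℝ x (G t x - G t₀ x) * ‖x‖⁻¹ := by
    rw [inner_sub_right, Pi.sub_apply]; ring
  rw [e, norm_mul, norm_inv, norm_norm, Pi.sub_apply]
  rcases eq_or_ne x 0 with rfl | hx
  · simp
  · have := norm_inner_le_norm (𝕜 := ℝ) x (G t x - G t₀ x)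
    have hx' : 0 < ‖x‖ := norm_pos_iff.2 hx
    rw [mul_inv_le_iff₀ hx']
    linarith

theorem IsTest.memLp {β : ℝ → ℝ} (h : IsTest β) : MemLp β 2 :=
  h.contDiff.continuous.memLp_of_hasCompactSupport h.hasCompactSupport

theorem IsTest.setIntegral {β : ℝ → ℝ} (h : IsTest β) (g : ℝ → ℝ) :
    ∫ r in Ioi 0, g r * β r = ∫ r, g r * β r :=
  setIntegral_eq_integral_of_forall_compl_eq_zero fun r hr => by
    rw [image_eq_zero_of_notMem_tsupport fun h' => hr (h.tsupport_subset h'), mul_zero]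

/-- The weak gradient of a radial function in polar coordinates. -/
theorem IsWeakGradient.integral_profile {f : E3 → ℝ} {G : E3 → E3} (h : IsWeakGradient f G)
    (hf : IsRadial f) (hG : MemLp G 2) {β : ℝ → ℝ} (hβ : IsTest β) :
    ∫ r in Ioi 0, profile f r * deriv β r = -∫ r, β r * r⁻¹ * radialDeriv hG r := by
  -- The test field is `γ(|x|) x` with `γ = β/r³`. Its divergence is `(r³ γ)'/r² = β'/r²`, so the
  -- volume factor `r²` of polar coordinates cancels.
  set γ : ℝ → ℝ := fun r => β r * r⁻¹ * r⁻¹ * r⁻¹ with hγdef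
  have hγ : IsTest γ := hβ.mul_inv.mul_inv.mul_inv
  have hsm : ∀ i : Fin 3, ContDiff ℝ ∞ fun y : E3 => γ ‖y‖ * y i := fun i =>
    hγ.contDiff_radial.mul (by fun_prop)
  have hcs : ∀ i : Fin 3, HasCompactSupport fun y : E3 => γ ‖y‖ * y i := fun i =>
    hγ.hasCompactSupport_radial.mul_right
  have hpos := sphereConst_pos
  have i1 : ∀ i, Integrable fun x => f x • gradient (fun y : E3 => γ ‖y‖ * y i) x := fun i => by
    refine h.locallyIntegrable.integrable_smul_right_of_hasCompactSupport ?_ ?_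
    · have : gradient (fun y : E3 => γ ‖y‖ * y i) = fun x =>
          (InnerProductSpace.toDual ℝ E3).symm (fderiv ℝ (fun y : E3 => γ ‖y‖ * y i) x) := rfl
      rw [this]
      exact (LinearIsometryEquiv.continuous _).comp ((hsm i).continuous_fderiv (by simp))
    · exact ((hcs i).fderiv ℝ).comp_left (g := (InnerProductSpace.toDual ℝ E3).symm) (map_zero _)
  have i2 : ∀ i, Integrable fun x => (γ ‖x‖ * x i) • G x := fun i =>
    h.locallyIntegrable_grad.integrable_smul_left_of_hasCompactSupport (hsm i).continuous (hcs i)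
  have hi : ∀ i, ∫ x, f x * gradient (fun y : E3 => γ ‖y‖ * y i) x i =
      -∫ x, γ ‖x‖ * x i * G x i := by
    intro i
    have := congrArg (EuclideanSpace.proj i : E3 →L[ℝ] ℝ) (h.integral_eq _ (hsm i) (hcs i))
    rw [map_neg, ← ContinuousLinearMap.integral_comp_comm _ (i1 i),
      ← ContinuousLinearMap.integral_comp_comm _ (i2 i)] at this
    simpa using this
  have hs : ∫ x, f x * (∑ i, gradient (fun y : E3 => γ ‖y‖ * y i) x i) =
      -∫ x, γ ‖x‖ * inner ℝ x (G x) := by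
    simp only [Finset.mul_sum]
    rw [integral_finsetSum, Finset.sum_congr rfl fun i _ => hi i, Finset.sum_neg_distrib,
      ← integral_finsetSum]
    · congr 1
      refine integral_congr_ae (Eventually.of_forall fun x => ?_)
      beta_reduce
      rw [PiLp.inner_apply, Finset.mul_sum]
      exact Finset.sum_congr rfl fun i _ => by simp; ring
    · exact fun i _ => ((EuclideanSpace.proj i : E3 →L[ℝ] ℝ).integrable_comp (i2 i)).congr
        (Eventually.of_forall fun x => by simp)
    · exact fun i _ => ((EuclideanSpace.proj i : E3 →L[ℝ] ℝ).integrable_comp (i1 i)).congr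
        (Eventually.of_forall fun x => by simp)
  simp only [hγ.sum_gradient] at hs
  have hl : ∫ x, f x * (deriv γ ‖x‖ * ‖x‖ + 3 * γ ‖x‖) =
      sphereConst * ∫ r in Ioi 0, profile f r * deriv β r := by
    simp only [hf.eq_profile]
    rw [integral_radial fun r => profile f r * (deriv γ r * r + 3 * γ r)]
    congr 1
    refine setIntegral_congr_fun measurableSet_Ioi fun r hr => ?_
    have hr0 : r ≠ 0 := ne_of_gt hr
    have hd : deriv β r = deriv γ r * r ^ 3 + γ r * (3 * r ^ 2) := by
      have e : β = fun r => γ r * r ^ 3 := by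
        funext s
        rcases eq_or_ne s 0 with rfl | hs0
        · obtain ⟨δ, hδ, h0⟩ := hβ.exists_pos
          simp [h0 0 hδ.le]
        · simp only [hγdef]; field_simp
      have hd : HasDerivAt (fun r => γ r * r ^ 3) _ r :=
        ((hγ.contDiff.differentiable (by simp) r).hasDerivAt).mul (hasDerivAt_pow 3 r)
      rw [e, hd.deriv]
      simp
    rw [hd]; ring
  have hr : ∫ x, γ ‖x‖ * inner ℝ x (G x) = sphereConst * ∫ r, β r * r⁻¹ * radialDeriv hG r := by
    rw [sphereConst_mul_integral_radialDeriv hG hβ.mul_inv.memLp]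
    exact integral_congr_ae (Eventually.of_forall fun x => by simp only [hγdef]; ring)
  rw [hl, hr, ← mul_neg] at hs
  exact mul_left_cancel₀ hpos.ne' hs

end RadialWave

/-! ### The tail integral and Hardy's inequality -/

namespace RadialWave

theorem sq_integral_mul_le {α : Type*} [MeasurableSpace α] {μ : Measure α} {f g : α → ℝ}
    (hf : MemLp f 2 μ) (hg : MemLp g 2 μ) :
    (∫ x, f x * g x ∂μ) ^ 2 ≤ (∫ x, f x ^ 2 ∂μ) * ∫ x, g x ^ 2 ∂μ := by
  have key : ∀ {a b : α → ℝ} (ha : MemLp a 2 μ) (hb : MemLp b 2 μ),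
      inner ℝ (ha.toLp a) (hb.toLp b) = ∫ x, a x * b x ∂μ := fun ha hb => by
    rw [L2.inner_def]
    refine integral_congr_ae ?_
    filter_upwards [ha.coeFn_toLp, hb.coeFn_toLp] with x h1 h2
    simp [h1, h2, mul_comm]
  have h := real_inner_mul_inner_self_le (hf.toLp f) (hg.toLp g)
  simp only [key] at h
  simpa only [sq] using h

theorem integral_Ioi_inv_sq {r : ℝ} (hr : 0 < r) :
    IntegrableOn (fun s : ℝ => (s⁻¹) ^ 2) (Ioi r) ∧ ∫ s in Ioi r, (s⁻¹) ^ 2 = r⁻¹ := by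
  have e : EqOn (fun s : ℝ => s ^ (-2 : ℝ)) (fun s : ℝ => (s⁻¹) ^ 2) (Ioi r) := fun s hs => by
    have : 0 < s := hr.trans hs
    beta_reduce
    rw [Real.rpow_neg this.le, inv_pow]
    norm_num
  refine ⟨(integrableOn_Ioi_rpow_of_lt (by norm_num) hr).congr_fun e measurableSet_Ioi, ?_⟩
  rw [← setIntegral_congr_fun measurableSet_Ioi e, integral_Ioi_rpow_of_lt (by norm_num) hr]
  norm_num
  rw [Real.rpow_neg_one]

/-- The function `s ↦ 1/s` cut off at `r`. -/
noncomputable def invTail (r s : ℝ) : ℝ := (Ioi r).indicator (fun s => s⁻¹) s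

theorem measurable_invTail (r : ℝ) : Measurable (invTail r) :=
  measurable_inv.indicator measurableSet_Ioi

theorem invTail_mul (r r' s : ℝ) :
    invTail r s * invTail r' s = (Ioi (max r r')).indicator (fun s => (s⁻¹) ^ 2) s := by
  unfold invTail
  by_cases h1 : r < s <;> by_cases h2 : r' < s <;> simp [indicator, h1, h2, sq]

theorem integral_invTail_mul {r : ℝ} (hr : 0 < r) (r' : ℝ) :
    ∫ s, invTail r s * invTail r' s = (max r r')⁻¹ := by
  simp only [invTail_mul]
  rw [integral_indicator measurableSet_Ioi, (integral_Ioi_inv_sq (hr.trans_le (le_max_left _ _))).2]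

theorem memLp_invTail {r : ℝ} (hr : 0 < r) : MemLp (invTail r) 2 := by
  refine (memLp_two_iff_integrable_sq (measurable_invTail r).aestronglyMeasurable).2 ?_
  simp only [sq (invTail r _), invTail_mul, max_self]
  exact (integral_Ioi_inv_sq hr).1.integrable_indicator measurableSet_Ioi

open Classical in
/-- The function `invTail r` as an element of `L²`, for `r > 0`. -/
noncomputable def invTailL2 (r : ℝ) : L2 :=
  if hr : 0 < r then (memLp_invTail hr).toLp (invTail r) else 0

theorem coeFn_invTailL2 {r : ℝ} (hr : 0 < r) : invTailL2 r =ᵐ[volume] invTail r := by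
  rw [invTailL2, dif_pos hr]
  exact MemLp.coeFn_toLp _

theorem inner_invTailL2 {r : ℝ} (hr : 0 < r) (h : L2) :
    inner ℝ (invTailL2 r) h = ∫ s, invTail r s * h s := by
  rw [inner_eq_integral]
  exact integral_congr_ae ((coeFn_invTailL2 hr).mono fun s hs => by simp only [hs])

theorem inner_invTailL2_invTailL2 {r r' : ℝ} (hr : 0 < r) (hr' : 0 < r') :
    inner ℝ (invTailL2 r) (invTailL2 r') = (max r r')⁻¹ := by
  rw [inner_invTailL2 hr, ← integral_invTail_mul hr]
  exact integral_congr_ae ((coeFn_invTailL2 hr').mono fun s hs => by simp only [hs])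

theorem norm_invTailL2 {r : ℝ} (hr : 0 < r) : ‖invTailL2 r‖ = (√r)⁻¹ := by
  rw [@norm_eq_sqrt_real_inner, inner_invTailL2_invTailL2 hr hr, max_self, Real.sqrt_inv]

/-- All inner products are explicit, `⟨1_{s>r}/s, 1_{s>r'}/s⟩ = 1/max(r, r')`, so the distance
between two of these vectors is an explicit continuous function. -/
theorem continuousOn_invTailL2 : ContinuousOn invTailL2 (Ioi 0) := by
  intro r (hr : 0 < r)
  refine tendsto_iff_norm_sub_tendsto_zero.2 ?_
  have h1 : ∀ r' ∈ Ioi (0 : ℝ), ‖invTailL2 r' - invTailL2 r‖ =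
      √(r'⁻¹ - 2 * (max r' r)⁻¹ + r⁻¹) := fun r' (hr' : 0 < r') => by
    rw [@norm_eq_sqrt_real_inner, inner_sub_left, inner_sub_right, inner_sub_right,
      inner_invTailL2_invTailL2 hr' hr', inner_invTailL2_invTailL2 hr' hr,
      inner_invTailL2_invTailL2 hr hr', inner_invTailL2_invTailL2 hr hr, max_self, max_self,
      max_comm r r']
    ring_nf
  have h2 : ContinuousWithinAt (fun r' : ℝ => √(r'⁻¹ - 2 * (max r' r)⁻¹ + r⁻¹)) (Ioi 0) r := by
    refine ContinuousAt.continuousWithinAt ?_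
    have : max r r ≠ 0 := by simpa using hr.ne'
    fun_prop (disch := first | exact hr.ne' | assumption)
  have h3 := h2.tendsto
  rw [max_self, show r⁻¹ - 2 * r⁻¹ + r⁻¹ = 0 by ring, Real.sqrt_zero] at h3
  exact h3.congr' (eventually_mem_nhdsWithin.mono fun r' hr' => (h1 r' hr').symm)

/-- `∫_r^∞ h(s)/s ds`. -/
noncomputable def tailIntegral (h : L2) (r : ℝ) : ℝ := inner ℝ (invTailL2 r) h

/-- Cauchy–Schwarz against a vector of norm `r^{-1/2}`. This is the origin of the bound `|w| ≤ √r
N(t)`. -/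
theorem abs_tailIntegral_le (h : L2) {r : ℝ} (hr : 0 < r) :
    |tailIntegral h r| ≤ (√r)⁻¹ * ‖h‖ := by
  rw [← norm_invTailL2 hr]
  exact abs_real_inner_le_norm _ _

theorem continuousOn_tailIntegral {h : ℝ → L2} (hh : Continuous h) :
    ContinuousOn (fun q : ℝ × ℝ => tailIntegral (h q.1) q.2) (univ ×ˢ Ioi 0) :=
  (continuousOn_invTailL2.comp continuousOn_snd fun _ hq => hq.2).inner
    (hh.comp continuous_fst).continuousOn

theorem continuousOn_tailIntegral_right (h : L2) : ContinuousOn (tailIntegral h) (Ioi 0) :=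
  continuousOn_invTailL2.inner continuousOn_const

/-- By Fubini: the inner integral of `β'` over `r < s` is `β(s)`. It expresses that the weak
derivative of the tail integral is `-h/r`. -/
theorem integral_tailIntegral_mul_deriv (h : L2) {β : ℝ → ℝ} (hβ : IsTest β) :
    ∫ r, tailIntegral h r * deriv β r = ∫ r, β r * r⁻¹ * h r := by
  obtain ⟨δ, hδ, h0⟩ := hβ.exists_pos
  have hd0 : ∀ r < δ, deriv β r = 0 := fun r hr => by
    have : β =ᶠ[𝓝 r] fun _ => 0 := by
      filter_upwards [Iio_mem_nhds hr] with s hs using h0 s (le_of_lt hs)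
    simp [this.deriv_eq]
  have hdi : Integrable (deriv β) :=
    (hβ.contDiff.continuous_deriv (by simp)).integrable_of_hasCompactSupport
      hβ.hasCompactSupport.deriv
  -- Since `β'` vanishes below `δ`, the varying tail is dominated by the fixed one starting at `δ /
  -- 2`, which makes the majorant a product.
  have hdom : Integrable fun q : ℝ × ℝ => deriv β q.1 * (invTail (δ / 2) q.2 * h q.2) :=
    hdi.mul_prod (((memLp_invTail (half_pos hδ)).integrable_mul (Lp.memLp h)))
  have hF : Integrable fun q : ℝ × ℝ => deriv β q.1 * (invTail q.1 q.2 * h q.2) := by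
    refine hdom.mono ?_ (Eventually.of_forall fun q => ?_)
    · have h1 : Measurable fun q : ℝ × ℝ => invTail q.1 q.2 :=
        (measurable_snd.inv).indicator (measurableSet_lt measurable_fst measurable_snd)
      exact (((measurable_deriv β).comp measurable_fst).mul
        (h1.mul ((Lp.stronglyMeasurable h).measurable.comp measurable_snd))).aestronglyMeasurable
    · rcases lt_or_ge q.1 δ with hq | hq
      · simp [hd0 _ hq]
      · simp only [norm_mul]
        gcongr
        unfold invTail indicator
        split_ifs with h1 h2
        · exact le_rfl
        · exact absurd (show δ / 2 < q.2 by have : q.1 < q.2 := h1; linarith) h2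
        · simp
        · simp
  have h1 : ∫ r, tailIntegral h r * deriv β r =
      ∫ r, ∫ s, deriv β r * (invTail r s * h s) := by
    refine integral_congr_ae (Eventually.of_forall fun r => ?_)
    rcases lt_or_ge r δ with hr | hr
    · simp [hd0 r hr]
    · beta_reduce
      rw [tailIntegral, inner_invTailL2 (hδ.trans_le hr), integral_const_mul, mul_comm]
  rw [h1, integral_integral_swap hF]
  refine integral_congr_ae (Eventually.of_forall fun s => ?_)
  have e : ∀ r, deriv β r * (invTail r s * h s) =
      (Iio s).indicator (deriv β) r * (s⁻¹ * h s) := fun r => by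
    unfold invTail indicator
    simp only [mem_Ioi, mem_Iio]
    split_ifs <;> simp
  simp only [e]
  rw [integral_mul_const, integral_indicator measurableSet_Iio, ← integral_Iic_eq_integral_Iio,
    HasCompactSupport.integral_Iic_deriv_eq (hβ.contDiff.of_le (by simp)) hβ.hasCompactSupport]
  ring

theorem integrableOn_sq_mul_rpow (h : L2) {r : ℝ} (hr : 0 < r) :
    IntegrableOn (fun s => h s ^ 2 * s ^ (-(1 / 2) : ℝ)) (Ioi r) := by
  refine (integrable_sq_L2 h).integrableOn.mul_bdd (c := r ^ (-(1 / 2) : ℝ))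
    (measurable_id.pow_const _).aestronglyMeasurable ?_
  refine (ae_restrict_mem measurableSet_Ioi).mono fun s hs => ?_
  have hs' : 0 < s := hr.trans hs
  rw [Real.norm_of_nonneg (Real.rpow_nonneg hs'.le _)]
  exact Real.rpow_le_rpow_of_nonpos hr (le_of_lt hs) (by norm_num)

/-- Cauchy–Schwarz with the split `1/s = s^{-1/4} s^{-3/4}` and `∫_r^∞ s^{-3/2} ds = 2 r^{-1/2}`.
Keeping a weight on `h²` makes the subsequent integration in `r` converge, as in Schur's test. -/
theorem sq_tailIntegral_le (h : L2) {r : ℝ} (hr : 0 < r) :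
    tailIntegral h r ^ 2 ≤
      2 * r ^ (-(1 / 2) : ℝ) * ∫ s in Ioi r, h s ^ 2 * s ^ (-(1 / 2) : ℝ) := by
  have p1 : ∀ s ∈ Ioi r, s ^ (-(1 / 4) : ℝ) * s ^ (-(3 / 4) : ℝ) = s⁻¹ := fun s hs => by
    rw [← Real.rpow_add (hr.trans hs), ← Real.rpow_neg_one]; norm_num
  have p2 : ∀ s ∈ Ioi r, (s ^ (-(1 / 4) : ℝ)) ^ 2 = s ^ (-(1 / 2) : ℝ) := fun s hs => by
    rw [sq, ← Real.rpow_add (hr.trans hs)]; norm_num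
  have p3 : ∀ s ∈ Ioi r, s ^ (-(3 / 2) : ℝ) = (s ^ (-(3 / 4) : ℝ)) ^ 2 := fun s hs => by
    rw [sq, ← Real.rpow_add (hr.trans hs)]; norm_num
  have e1 : tailIntegral h r =
      ∫ s in Ioi r, (h s * s ^ (-(1 / 4) : ℝ)) * s ^ (-(3 / 4) : ℝ) := by
    rw [tailIntegral, inner_invTailL2 hr, ← integral_indicator measurableSet_Ioi]
    refine integral_congr_ae (Eventually.of_forall fun s => ?_)
    by_cases hs : s ∈ Ioi r
    · simp only [invTail, indicator_of_mem hs]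
      rw [mul_assoc, p1 s hs, mul_comm]
    · simp [invTail, indicator_of_notMem hs]
  have m1 : EqOn (fun s => h s ^ 2 * s ^ (-(1 / 2) : ℝ))
      (fun s => (h s * s ^ (-(1 / 4) : ℝ)) ^ 2) (Ioi r) := fun s hs => by
    beta_reduce
    rw [mul_pow, p2 s hs]
  have h1 : MemLp (fun s => h s * s ^ (-(1 / 4) : ℝ)) 2 (volume.restrict (Ioi r)) :=
    (memLp_two_iff_integrable_sq ((Lp.stronglyMeasurable h).measurable.mul
      (measurable_id.pow_const _)).aestronglyMeasurable).2
      ((integrableOn_sq_mul_rpow h hr).congr_fun m1 measurableSet_Ioi)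
  have h2 : MemLp (fun s : ℝ => s ^ (-(3 / 4) : ℝ)) 2 (volume.restrict (Ioi r)) :=
    (memLp_two_iff_integrable_sq (measurable_id.pow_const _).aestronglyMeasurable).2
      ((integrableOn_Ioi_rpow_of_lt (by norm_num) hr).congr_fun p3 measurableSet_Ioi)
  have h3 := sq_integral_mul_le h1 h2
  rw [← e1, ← setIntegral_congr_fun measurableSet_Ioi m1,
    ← setIntegral_congr_fun measurableSet_Ioi p3, integral_Ioi_rpow_of_lt (by norm_num) hr] at h3
  refine h3.trans (le_of_eq ?_)
  norm_num
  ring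

theorem lintegral_rpow_neg_half {s : ℝ} (hs : 0 < s) :
    ∫⁻ r in Ioo 0 s, ENNReal.ofReal (2 * r ^ (-(1 / 2) : ℝ)) =
      ENNReal.ofReal (4 * s ^ (1 / 2 : ℝ)) := by
  have hi : IntervalIntegrable (fun r : ℝ => 2 * r ^ (-(1 / 2) : ℝ)) volume 0 s :=
    (intervalIntegral.intervalIntegrable_rpow' (by norm_num)).const_mul 2
  rw [restrict_Ioo_eq_restrict_Ioc, ← ofReal_integral_eq_lintegral_ofReal
    ((intervalIntegrable_iff_integrableOn_Ioc_of_le hs.le).1 hi),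
    ← intervalIntegral.integral_of_le hs.le, intervalIntegral.integral_const_mul,
    integral_rpow (Or.inl (by norm_num))]
  · congr 1
    norm_num
    ring
  · refine (ae_restrict_mem measurableSet_Ioc).mono fun r hr => ?_
    have := hr.1
    simp only [Pi.zero_apply]
    positivity

/-- Hardy's inequality. -/
theorem lintegral_sq_tailIntegral_le (h : L2) :
    ∫⁻ r in Ioi 0, ENNReal.ofReal (tailIntegral h r ^ 2) ≤ ENNReal.ofReal (4 * ‖h‖ ^ 2) := by
  set F : ℝ → ℝ → ENNReal := fun r s => {q : ℝ × ℝ | 0 < q.1 ∧ q.1 < q.2}.indicator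
    (fun q => ENNReal.ofReal (2 * q.1 ^ (-(1 / 2) : ℝ)) *
      ENNReal.ofReal (h q.2 ^ 2 * q.2 ^ (-(1 / 2) : ℝ))) (r, s) with hF
  have hmeas : Measurable (Function.uncurry F) := by
    have hm := (Lp.stronglyMeasurable h).measurable
    refine Measurable.indicator ?_
      ((measurableSet_lt measurable_const measurable_fst).inter
        (measurableSet_lt measurable_fst measurable_snd))
    exact ((measurable_fst.pow_const _).const_mul _).ennreal_ofReal.mul
      (((hm.comp measurable_snd).pow_const _).mul
        (measurable_snd.pow_const _)).ennreal_ofReal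
  have h1 : ∀ r ∈ Ioi (0 : ℝ), ENNReal.ofReal (tailIntegral h r ^ 2) ≤ ∫⁻ s, F r s := by
    intro r (hr : 0 < r)
    have e : ∀ s, F r s = (Ioi r).indicator (fun s => ENNReal.ofReal (2 * r ^ (-(1 / 2) : ℝ)) *
        ENNReal.ofReal (h s ^ 2 * s ^ (-(1 / 2) : ℝ))) s := fun s => by
      simp only [hF, indicator, mem_ofPred_eq, hr, true_and, mem_Ioi]
    simp only [e]
    rw [lintegral_indicator measurableSet_Ioi, lintegral_const_mul' _ _ ENNReal.ofReal_ne_top,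
      ← ofReal_integral_eq_lintegral_ofReal (integrableOn_sq_mul_rpow h hr),
      ← ENNReal.ofReal_mul (by positivity)]
    · exact ENNReal.ofReal_le_ofReal (sq_tailIntegral_le h hr)
    · refine (ae_restrict_mem measurableSet_Ioi).mono fun s hs => ?_
      have : 0 < s := hr.trans hs
      simp only [Pi.zero_apply]
      positivity
  -- After Tonelli the inner integral is `∫_0^s 2 r^{-1/2} dr = 4 s^{1/2}`, which cancels the weight
  -- `s^{-1/2}`.
  have h2 : ∀ s, ∫⁻ r, F r s ≤ ENNReal.ofReal (4 * h s ^ 2) := by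
    intro s
    rcases le_or_gt s 0 with hs | hs
    · have e : ∀ r, F r s = 0 := fun r => by
        simp only [hF, indicator, mem_ofPred_eq]
        rw [if_neg]
        rintro ⟨h1, h2⟩
        linarith
      simp [e]
    · have e : ∀ r, F r s = (Ioo 0 s).indicator
          (fun r => ENNReal.ofReal (2 * r ^ (-(1 / 2) : ℝ))) r *
          ENNReal.ofReal (h s ^ 2 * s ^ (-(1 / 2) : ℝ)) := fun r => by
        simp only [hF, indicator, mem_ofPred_eq, mem_Ioo]
        split_ifs <;> simp
      simp only [e]
      rw [lintegral_mul_const' _ _ ENNReal.ofReal_ne_top, lintegral_indicator measurableSet_Ioo,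
        lintegral_rpow_neg_half hs, ← ENNReal.ofReal_mul (by positivity)]
      refine ENNReal.ofReal_le_ofReal (le_of_eq ?_)
      have : s ^ (1 / 2 : ℝ) * s ^ (-(1 / 2) : ℝ) = 1 := by
        rw [← Real.rpow_add hs]; norm_num
      linear_combination 4 * h s ^ 2 * this
  calc ∫⁻ r in Ioi 0, ENNReal.ofReal (tailIntegral h r ^ 2)
      ≤ ∫⁻ r in Ioi 0, ∫⁻ s, F r s := setLIntegral_mono' measurableSet_Ioi h1
    _ ≤ ∫⁻ r, ∫⁻ s, F r s := setLIntegral_le_lintegral _ _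
    _ = ∫⁻ s, ∫⁻ r, F r s := lintegral_lintegral_swap hmeas.aemeasurable
    _ ≤ ∫⁻ s, ENNReal.ofReal (4 * h s ^ 2) := lintegral_mono h2
    _ = ENNReal.ofReal (4 * ‖h‖ ^ 2) := by
        rw [← integral_sq_eq_norm, ← integral_const_mul, ofReal_integral_eq_lintegral_ofReal
          ((integrable_sq_L2 h).const_mul 4) (Eventually.of_forall fun s => by
            simp only [Pi.zero_apply]; positivity)]

theorem memLp_tailIntegral (h : L2) : MemLp ((Ioi 0).indicator (tailIntegral h)) 2 := by
  have hm := (continuousOn_tailIntegral_right h).aestronglyMeasurable measurableSet_Ioi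
    (μ := volume)
  rw [memLp_indicator_iff_restrict measurableSet_Ioi, memLp_two_iff_integrable_sq hm]
  refine ⟨hm.pow 2, ?_⟩
  rw [hasFiniteIntegral_iff_ofReal (Eventually.of_forall fun _ => sq_nonneg _)]
  exact (lintegral_sq_tailIntegral_le h).trans_lt ENNReal.ofReal_lt_top

/-- The bounded operator `h ↦ ∫_r^∞ h(s)/s ds` on `L²`. -/
noncomputable def hardy : L2 →L[ℝ] L2 :=
  LinearMap.mkContinuous
    { toFun := fun h => (memLp_tailIntegral h).toLp _
      map_add' := fun h k => by
        rw [← MemLp.toLp_add]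
        refine MemLp.toLp_congr _ _ (Eventually.of_forall fun r => ?_)
        by_cases hr : r ∈ Ioi (0 : ℝ) <;> simp [hr, tailIntegral, inner_add_right]
      map_smul' := fun c h => by
        rw [RingHom.id_apply, ← MemLp.toLp_const_smul]
        refine MemLp.toLp_congr _ _ (Eventually.of_forall fun r => ?_)
        by_cases hr : r ∈ Ioi (0 : ℝ) <;> simp [hr, tailIntegral, inner_smul_right] }
    2 fun h => by
      refine le_of_sq_le_sq ?_ (by positivity)
      have e : ∫ r, ((memLp_tailIntegral h).toLp _ r) ^ 2 =
          ∫ r in Ioi 0, tailIntegral h r ^ 2 := by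
        rw [← integral_indicator measurableSet_Ioi]
        refine integral_congr_ae ((memLp_tailIntegral h).coeFn_toLp.mono fun r hr => ?_)
        beta_reduce
        rw [hr]
        by_cases hr : r ∈ Ioi (0 : ℝ) <;> simp [hr]
      simp only [LinearMap.coe_mk, AddHom.coe_mk]
      rw [← integral_sq_eq_norm, e, integral_eq_lintegral_of_nonneg_ae
        (Eventually.of_forall fun _ => sq_nonneg _)
        ((continuousOn_tailIntegral_right h).aestronglyMeasurable measurableSet_Ioi |>.pow 2)]
      refine ENNReal.toReal_le_of_le_ofReal (by positivity)
        ((lintegral_sq_tailIntegral_le h).trans (le_of_eq ?_))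
      congr 1; ring

theorem coeFn_hardy (h : L2) : hardy h =ᵐ[volume] (Ioi 0).indicator (tailIntegral h) :=
  (memLp_tailIntegral h).coeFn_toLp

end RadialWave

/-! ### Radial `Ḣ¹` functions and their profiles -/

namespace RadialWave

theorem IsRadial.locallyIntegrableOn_profile {f : E3 → ℝ} (hf : IsRadial f)
    (hi : LocallyIntegrable f) : LocallyIntegrableOn (profile f) (Ioi 0) := by
  rw [locallyIntegrableOn_iff isOpen_Ioi.isLocallyClosed]
  intro K hK hKc
  obtain ⟨R, hR⟩ := hKc.isBounded.subset_ball 0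
  have h1 : IntegrableOn (fun x : E3 => profile f ‖x‖) (Metric.ball 0 R) := by
    simp only [← hf.eq_profile]
    exact (hi.integrableOn_isCompact (isCompact_closedBall 0 R)).mono_set
      Metric.ball_subset_closedBall
  rw [integrableOn_fun_norm_addHaar] at h1
  have h2 : K ⊆ Ioo 0 R := fun r hr => ⟨hK hr, lt_of_abs_lt (by simpa using hR hr)⟩
  have h3 : ContinuousOn (fun r : ℝ => (r ^ 2)⁻¹) K :=
    (continuousOn_id.pow 2).inv₀ fun r hr => pow_ne_zero _ (ne_of_gt (hK hr))
  refine (IntegrableOn.continuousOn_mul h3 (h1.mono_set h2) hKc).congr_fun ?_ hKc.measurableSet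
  intro r hr
  have : r ≠ 0 := ne_of_gt (hK hr)
  simp
  field_simp

/-- The factor `1/|x|` in the test function turns the polar weight `r²` into `r`, which is absorbed
in `r f(r)`. -/
theorem IsRadial.integral_mul_radial {f : E3 → ℝ} (hf : IsRadial f) (β : ℝ → ℝ) :
    ∫ x, f x * (β ‖x‖ * ‖x‖⁻¹) = sphereConst * ∫ r in Ioi 0, reduced f r * β r := by
  simp only [hf.eq_profile]
  rw [integral_radial fun r => profile f r * (β r * r⁻¹)]
  congr 1
  refine setIntegral_congr_fun measurableSet_Ioi fun r hr => ?_
  have : r ≠ 0 := ne_of_gt hr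
  simp only [reduced]
  field_simp

/-- A radial function in the homogeneous Sobolev space is determined by its radial derivative. -/
theorem IsWeakGradient.profile_eq {f : E3 → ℝ} {G : E3 → E3} (h : IsWeakGradient f G)
    (hf : IsRadial f) (hG : MemLp G 2) (h6 : MemLp f 6) :
    ∀ᵐ r, r ∈ Ioi (0 : ℝ) → profile f r = -tailIntegral (radialDeriv hG) r := by
  have hp := hf.locallyIntegrableOn_profile h.locallyIntegrable
  have hT : LocallyIntegrableOn (tailIntegral (radialDeriv hG)) (Ioi 0) :=
    (continuousOn_tailIntegral_right _).locallyIntegrableOn measurableSet_Ioi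
  obtain ⟨c, hc⟩ := exists_ae_eq_const isOpen_Ioi ordConnected_Ioi nonempty_Ioi (hp.add hT)
    fun a ha hac has => by
      have hβ : IsTest a := ⟨ha, hac, has⟩
      have hd := hβ.deriv_test
      have i1 := integrable_test_mul_locallyIntegrableOn hp hd.contDiff.continuous
        hd.hasCompactSupport hd.tsupport_subset
      have i2 := integrable_test_mul_locallyIntegrableOn hT hd.contDiff.continuous
        hd.hasCompactSupport hd.tsupport_subset
      simp only [Pi.add_apply, mul_add]
      rw [integral_add i1 i2]
      simp only [mul_comm (deriv a _)]
      rw [integral_tailIntegral_mul_deriv _ hβ, ← hd.setIntegral, h.integral_profile hf hG hβ]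
      ring
  -- The profile equals minus the tail integral up to a constant. The tail integral decays like
  -- `r^{-1/2}`, so a nonzero constant would keep `|f| ≥ |c|/2` far out and contradict `f ∈ L⁶`.
  have hc0 : c = 0 := by
    by_contra hne
    set N := ‖radialDeriv hG‖ with hN
    have hi : IntegrableOn (fun r => r ^ 2 * |profile f r| ^ 6) (Ioi 0) := by
      refine (integrable_radial_iff (k := fun r => |profile f r| ^ 6)).1 ?_
      simp only [← hf.eq_profile]
      have h6' : MemLp f ((6 : ℕ) : ENNReal) := by
        rw [Nat.cast_ofNat]
        exact h6
      exact h6'.integrable_norm_pow (by norm_num)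
    -- For `r > R` the bound `N/√r` on the tail integral is at most `|c|/2`, and `r² ≥ 1`.
    set R : ℝ := max 1 ((2 * N / |c|) ^ 2) with hR
    have hR1 : 1 ≤ R := le_max_left _ _
    have hcpos : 0 < |c| := abs_pos.2 hne
    have hsub : IntegrableOn (fun r => r ^ 2 * |profile f r| ^ 6) (Ioi R) :=
      hi.mono_set (Ioi_subset_Ioi (by linarith))
    have hconst : IntegrableOn (fun _ : ℝ => (|c| / 2) ^ 6) (Ioi R) := by
      refine hsub.mono' aestronglyMeasurable_const ?_
      filter_upwards [ae_restrict_of_ae hc, ae_restrict_mem measurableSet_Ioi] with r h1 h2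
      have hr : R < r := h2
      have hr1 : 1 < r := by linarith
      have h3 := h1 (show r ∈ Ioi 0 by simp only [mem_Ioi]; linarith)
      simp only [Pi.add_apply] at h3
      have h4 : |tailIntegral (radialDeriv hG) r| ≤ |c| / 2 := by
        refine (abs_tailIntegral_le _ (by linarith)).trans ?_
        have h5 : 2 * N / |c| ≤ √r := by
          refine Real.le_sqrt_of_sq_le ?_
          exact (le_max_right 1 _).trans hr.le
        rw [div_le_iff₀ hcpos] at h5
        rw [inv_mul_le_iff₀ (Real.sqrt_pos.2 (by linarith))]
        linarith
      have h5 : |c| / 2 ≤ |profile f r| := by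
        have : |c| ≤ |profile f r| + |tailIntegral (radialDeriv hG) r| := by
          rw [← h3]; exact abs_add_le _ _
        linarith
      rw [Real.norm_of_nonneg (by positivity)]
      have h6' : (|c| / 2) ^ 6 ≤ |profile f r| ^ 6 := by gcongr
      nlinarith [sq_nonneg (r - 1), pow_nonneg (abs_nonneg (profile f r)) 6]
    rw [integrableOn_const_iff] at hconst
    rcases hconst with h | h
    · have : (|c| / 2) ^ 6 = 0 := by simpa using h
      have h7 : 0 < (|c| / 2) ^ 6 := by positivity
      linarith
    · simp at h
  filter_upwards [hc] with r hr hr0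
  have := hr hr0
  simp only [Pi.add_apply, hc0] at this
  linarith

/-- `r` times the function with radial derivative `h(r)/r`. -/
noncomputable def waveOf (h : L2) (r : ℝ) : ℝ := -(r * tailIntegral h r)

/-- The weak derivative of `waveOf h`. -/
noncomputable def waveDeriv (h : L2) : L2 := h - hardy h

theorem IsWeakGradient.reduced_eq {f : E3 → ℝ} {G : E3 → E3} (h : IsWeakGradient f G)
    (hf : IsRadial f) (hG : MemLp G 2) (h6 : MemLp f 6) :
    ∀ᵐ r, r ∈ Ioi (0 : ℝ) → reduced f r = waveOf (radialDeriv hG) r := by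
  filter_upwards [h.profile_eq hf hG h6] with r hr hr0
  rw [reduced, hr hr0, waveOf]
  ring

theorem abs_waveOf_le (h : L2) {r : ℝ} (hr : 0 < r) : |waveOf h r| ≤ √r * ‖h‖ := by
  rw [waveOf, abs_neg, abs_mul, abs_of_pos hr]
  refine (mul_le_mul_of_nonneg_left (abs_tailIntegral_le h hr) hr.le).trans (le_of_eq ?_)
  have h1 : 0 < √r := Real.sqrt_pos.2 hr
  have h2 : √r * √r = r := Real.mul_self_sqrt hr.le
  field_simp
  linear_combination -‖h‖ * h2

theorem continuousOn_waveOf {h : ℝ → L2} (hh : Continuous h) :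
    ContinuousOn (fun q : ℝ × ℝ => waveOf (h q.1) q.2) (univ ×ˢ Ioi 0) :=
  (continuousOn_snd.mul (continuousOn_tailIntegral hh)).neg

theorem IsTest.integrable_mul_L2 {β : ℝ → ℝ} (hβ : IsTest β) (y : L2) :
    Integrable fun r => y r * β r := by
  simpa only [mul_comm] using
    integrable_test_mul hβ.contDiff.continuous hβ.hasCompactSupport y

theorem IsTest.integral_add_L2 {β : ℝ → ℝ} (hβ : IsTest β) (y z : L2) :
    ∫ r, (y + z) r * β r = (∫ r, y r * β r) + ∫ r, z r * β r := by
  rw [← integral_add (hβ.integrable_mul_L2 y) (hβ.integrable_mul_L2 z)]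
  exact integral_congr_ae ((Lp.coeFn_add y z).mono fun r hr => by simp only [hr, Pi.add_apply]; ring)

theorem IsTest.integral_sub_L2 {β : ℝ → ℝ} (hβ : IsTest β) (y z : L2) :
    ∫ r, (y - z) r * β r = (∫ r, y r * β r) - ∫ r, z r * β r := by
  rw [← integral_sub (hβ.integrable_mul_L2 y) (hβ.integrable_mul_L2 z)]
  exact integral_congr_ae ((Lp.coeFn_sub y z).mono fun r hr => by simp only [hr, Pi.sub_apply]; ring)

/-- The product rule for `-r ∫_r^∞ h/s ds` gives `h - ∫_r^∞ h/s ds`. Weakly, this is the derivative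
formula for the tail integral tested with `r β`. -/
theorem integral_waveOf_mul_deriv (h : L2) {β : ℝ → ℝ} (hβ : IsTest β) :
    ∫ r, waveOf h r * deriv β r = -∫ r, waveDeriv h r * β r := by
  have hγ : IsTest fun r => β r * r := hβ.mul contDiffOn_id
  have hT : LocallyIntegrableOn (tailIntegral h) (Ioi 0) :=
    (continuousOn_tailIntegral_right _).locallyIntegrableOn measurableSet_Ioi
  have hd : ∀ r, deriv (fun r => β r * r) r = deriv β r * r + β r := fun r => by
    have := ((hβ.contDiff.differentiable (by simp) r).hasDerivAt).mul (hasDerivAt_id r)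
    refine this.deriv.trans (by simp)
  have h1 := integral_tailIntegral_mul_deriv h hγ
  have h2 : ∫ r, β r * r * r⁻¹ * h r = ∫ r, h r * β r := by
    refine integral_congr_ae (Eventually.of_forall fun r => ?_)
    rcases eq_or_ne r 0 with rfl | hr
    · obtain ⟨δ, hδ, h0⟩ := hβ.exists_pos
      simp [h0 0 hδ.le]
    · beta_reduce
      field_simp
  have h3 : ∫ r, hardy h r * β r = ∫ r, β r * tailIntegral h r := by
    refine integral_congr_ae ((coeFn_hardy h).mono fun r hr => ?_)
    beta_reduce
    rw [hr]
    by_cases hr0 : r ∈ Ioi (0 : ℝ)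
    · simp [hr0, mul_comm]
    · obtain ⟨δ, hδ, h0⟩ := hβ.exists_pos
      have : r ≤ δ := (not_lt.1 hr0).trans hδ.le
      simp [h0 r this]
  have hdr : IsTest fun r => deriv β r * r := hβ.deriv_test.mul contDiffOn_id
  have h4 : ∫ r, tailIntegral h r * deriv (fun r => β r * r) r =
      (∫ r, deriv β r * r * tailIntegral h r) + ∫ r, β r * tailIntegral h r := by
    rw [← integral_add
      (integrable_test_mul_locallyIntegrableOn hT hdr.contDiff.continuous hdr.hasCompactSupport
        hdr.tsupport_subset)
      (integrable_test_mul_locallyIntegrableOn hT hβ.contDiff.continuous hβ.hasCompactSupport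
        hβ.tsupport_subset)]
    exact integral_congr_ae (Eventually.of_forall fun r => by simp only [hd]; ring)
  have h5 : ∫ r, waveOf h r * deriv β r = -∫ r, deriv β r * r * tailIntegral h r := by
    rw [← integral_neg]
    exact integral_congr_ae (Eventually.of_forall fun r => by simp only [waveOf]; ring)
  rw [waveDeriv, hβ.integral_sub_L2, h3, h5]
  linarith

theorem IsRadial.sub {f g : E3 → ℝ} (hf : IsRadial f) (hg : IsRadial g) : IsRadial (f - g) :=
  fun x y h => by simp only [Pi.sub_apply, hf x y h, hg x y h]

theorem IsRadial.integrableOn_reduced_sq {f : E3 → ℝ} (hf : IsRadial f) (h2 : MemLp f 2) :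
    IntegrableOn (fun r => reduced f r ^ 2) (Ioi 0) := by
  simp only [reduced, mul_pow]
  refine (integrable_radial_iff (k := fun r => profile f r ^ 2)).1 ?_
  simp only [← hf.eq_profile]
  exact h2.integrable_sq

theorem IsRadial.locallyIntegrableOn_reduced {f : E3 → ℝ} (hf : IsRadial f)
    (hi : LocallyIntegrable f) : LocallyIntegrableOn (reduced f) (Ioi 0) :=
  (hf.locallyIntegrableOn_profile hi).continuousOn_mul continuousOn_id isOpen_Ioi.isLocallyClosed

theorem IsRadial.memLp_reduced {f : E3 → ℝ} (hf : IsRadial f) (h2 : MemLp f 2) :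
    MemLp ((Ioi 0).indicator (reduced f)) 2 := by
  rw [memLp_indicator_iff_restrict measurableSet_Ioi, memLp_two_iff_integrable_sq]
  · exact hf.integrableOn_reduced_sq h2
  · exact (hf.locallyIntegrableOn_reduced
      (h2.locallyIntegrable (by norm_num))).aestronglyMeasurable

/-- Up to a constant, `f ↦ r f(r)` is an isometry from radial `L²(ℝ³)` to `L²`, so continuity in
time transfers. -/
theorem IsRadial.norm_reduced_sq {f : E3 → ℝ} (hf : IsRadial f) (h2 : MemLp f 2) :
    ‖(hf.memLp_reduced h2).toLp _‖ = √(sphereConst⁻¹) * ‖h2.toLp f‖ := by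
  have hc := sphereConst_pos
  rw [← sq_eq_sq₀ (norm_nonneg _) (by positivity), mul_pow, Real.sq_sqrt (by positivity),
    ← integral_sq_eq_norm, ← real_inner_self_eq_norm_sq, L2.inner_def]
  have e1 : ∫ x, inner ℝ (h2.toLp f x) (h2.toLp f x) = ∫ x, f x ^ 2 :=
    integral_congr_ae (h2.coeFn_toLp.mono fun x hx => by
      beta_reduce
      rw [hx, real_inner_self_eq_norm_sq, Real.norm_eq_abs, sq_abs])
  have e2 : ∫ r, (hf.memLp_reduced h2).toLp _ r ^ 2 = ∫ r in Ioi 0, r ^ 2 * profile f r ^ 2 := by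
    rw [← integral_indicator measurableSet_Ioi]
    refine integral_congr_ae ((hf.memLp_reduced h2).coeFn_toLp.mono fun r hr => ?_)
    beta_reduce
    rw [hr]
    by_cases hr : r ∈ Ioi (0 : ℝ) <;> simp [hr, reduced, mul_pow]
  rw [e1, e2]
  simp only [hf.eq_profile]
  rw [integral_radial fun r => profile f r ^ 2, inv_mul_cancel_left₀ hc.ne']

theorem continuous_reduced {f : ℝ → E3 → ℝ} (hf : ∀ t, IsRadial (f t)) (h2 : ∀ t, MemLp (f t) 2)
    (hc : ∀ t₀, Tendsto (fun t => eLpNorm (f t - f t₀) 2) (𝓝 t₀) (𝓝 0)) :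
    Continuous fun t => ((hf t).memLp_reduced (h2 t)).toLp _ := by
  rw [continuous_iff_continuousAt]
  intro t₀
  refine tendsto_iff_norm_sub_tendsto_zero.2 ?_
  have h1 := tendsto_iff_norm_sub_tendsto_zero.1
    ((Lp.tendsto_Lp_iff_tendsto_eLpNorm'' _ h2 _ (h2 t₀)).2 (hc t₀))
  have e : ∀ t, ‖((hf t).memLp_reduced (h2 t)).toLp _ - ((hf t₀).memLp_reduced (h2 t₀)).toLp _‖ =
      √(sphereConst⁻¹) * ‖(h2 t).toLp (f t) - (h2 t₀).toLp (f t₀)‖ := fun t => by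
    rw [← MemLp.toLp_sub, ← MemLp.toLp_sub,
      ← ((hf t).sub (hf t₀)).norm_reduced_sq ((h2 t).sub (h2 t₀))]
    congr 1
    refine MemLp.toLp_congr _ _ (Eventually.of_forall fun r => ?_)
    by_cases hr : r ∈ Ioi (0 : ℝ) <;> simp [hr, reduced, profile, mul_sub]
  simp only [e]
  simpa using h1.const_mul (√(sphereConst⁻¹))

end RadialWave

/-! ### From the wave equation on `ℝ³` to the half line -/

namespace RadialWave

/-- `w` solves `w_tt - w_rr = -|w|^(p-1) w r^(1-p)` weakly on the half line, with derivatives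
`w_r = R` and `w_t = T`. -/
structure LineWave (p : ℝ) (w : ℝ → ℝ → ℝ) (R T : ℝ → L2) : Prop where
  continuousOn : ContinuousOn (fun q : ℝ × ℝ => w q.1 q.2) (univ ×ˢ Ioi 0)
  growth : ∃ N : ℝ → ℝ, Continuous N ∧ ∀ t r, 0 < r → |w t r| ≤ √r * N t
  continuous_R : Continuous R
  continuous_T : Continuous T
  integral_R : ∀ t β, IsTest β → ∫ r, w t r * deriv β r = -∫ r, R t r * β r
  deriv_w : ∀ β, IsTest β → ∀ t,
    HasDerivAt (fun s => ∫ r, w s r * β r) (∫ r, T t r * β r) t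
  deriv_T : ∀ β, IsTest β → ∀ t, HasDerivAt (fun s => ∫ r, T s r * β r)
    (-(∫ r, R t r * deriv β r) - ∫ r, |w t r| ^ (p - 1) * w t r * r ^ (1 - p) * β r) t

theorem integral_neg_L2 (y : L2) (β : ℝ → ℝ) : ∫ r, (-y) r * β r = -∫ r, y r * β r := by
  rw [← integral_neg]
  exact integral_congr_ae ((Lp.coeFn_neg y).mono fun r hr => by
    simp only [hr, Pi.neg_apply, neg_mul])

/-- The equation is of second order in time, so reversal only flips the sign of `w_t`. This
exchanges inward and outward energies. -/
theorem LineWave.reverse {p : ℝ} {w : ℝ → ℝ → ℝ} {R T : ℝ → L2} (h : LineWave p w R T) :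
    LineWave p (fun t => w (-t)) (fun t => R (-t)) (fun t => -T (-t)) where
  continuousOn := h.continuousOn.comp (f := fun q : ℝ × ℝ => ((-q.1, q.2) : ℝ × ℝ))
    (by fun_prop) fun q hq => ⟨mem_univ _, hq.2⟩
  growth := by
    obtain ⟨N, hN, hb⟩ := h.growth
    exact ⟨fun t => N (-t), hN.comp continuous_neg, fun t r hr => hb (-t) r hr⟩
  continuous_R := h.continuous_R.comp continuous_neg
  continuous_T := (h.continuous_T.comp continuous_neg).neg
  integral_R := fun t => h.integral_R (-t)
  deriv_w := fun β hβ t => by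
    rw [integral_neg_L2]
    refine ((h.deriv_w β hβ (-t)).comp t (hasDerivAt_neg t)).congr_deriv ?_
    ring
  deriv_T := fun β hβ t => by
    simp only [integral_neg_L2]
    refine ((h.deriv_T β hβ (-t)).comp t (hasDerivAt_neg t)).neg.congr_deriv ?_
    ring

theorem LineWave.inwardWave {p : ℝ} {w : ℝ → ℝ → ℝ} {R T : ℝ → L2} (h : LineWave p w R T) :
    InwardWave p w fun t => R t + T t where
  continuousOn := h.continuousOn
  growth := h.growth
  continuous_V := h.continuous_R.add h.continuous_T
  deriv_w := fun β h1 h2 h3 t => by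
    have hβ : IsTest β := ⟨h1, h2, h3⟩
    refine (h.deriv_w β hβ t).congr_deriv ?_
    rw [hβ.integral_add_L2, h.integral_R t β hβ]
    ring
  deriv_V := fun β h1 h2 h3 t => by
    have hβ : IsTest β := ⟨h1, h2, h3⟩
    simp only [hβ.integral_add_L2, hβ.deriv_test.integral_add_L2]
    -- Mixed derivatives commute weakly: the time derivative of `w_r` is obtained by testing `w`
    -- with `β'`.
    have e : (fun s => ∫ r, R s r * β r) = fun s => -∫ r, w s r * deriv β r := by
      funext s
      rw [h.integral_R s β hβ, neg_neg]
    have h4 : HasDerivAt (fun s => ∫ r, R s r * β r) (-∫ r, T t r * deriv β r) t := by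
      rw [e]
      exact (h.deriv_w _ hβ.deriv_test t).neg
    refine (h4.add (h.deriv_T β hβ t)).congr_deriv ?_
    ring

theorem IsTest.continuous_integral_L2 {β : ℝ → ℝ} (hβ : IsTest β) {y : ℝ → L2}
    (hy : Continuous y) : Continuous fun t => ∫ r, y t r * β r := by
  have e : ∀ t, ∫ r, y t r * β r = inner ℝ (y t) (hβ.memLp.toLp β) := fun t => by
    rw [inner_eq_integral]
    exact integral_congr_ae (hβ.memLp.coeFn_toLp.mono fun r hr => by simp only [hr])
  simp only [e]
  fun_prop

theorem IsTest.continuous_integral {β : ℝ → ℝ} (hβ : IsTest β) {g : ℝ → ℝ → ℝ}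
    (hg : ContinuousOn (fun q : ℝ × ℝ => g q.1 q.2) (univ ×ˢ Ioi 0)) :
    Continuous fun t => ∫ r, g t r * β r := by
  have h1 := continuous_mul_cutoff hβ.contDiff.continuous hβ.tsupport_subset hg
  have h2 := continuous_parametric_integral_of_continuous (μ := volume)
    (f := fun t r => β r * g t r) h1 hβ.hasCompactSupport
  refine h2.congr fun t => ?_
  rw [setIntegral_eq_integral_of_forall_compl_eq_zero fun r hr => by
    rw [image_eq_zero_of_notMem_tsupport hr, zero_mul]]
  simp only [mul_comm]

theorem hasCompactSupport_prod {a : ℝ → ℝ} {k : E3 → ℝ} (ha : HasCompactSupport a)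
    (hk : HasCompactSupport k) : HasCompactSupport fun q : ℝ × E3 => a q.1 * k q.2 := by
  refine HasCompactSupport.intro (ha.isCompact.prod hk.isCompact) fun q hq => ?_
  by_contra h
  exact hq ⟨subset_tsupport _ (left_ne_zero_of_mul h), subset_tsupport _ (right_ne_zero_of_mul h)⟩

section Solution

variable {p : ℝ} {u ut : ℝ → E3 → ℝ}

/-- The separated test function `a(t) β(|x|)/|x|` reduces `∂ₜu = ut` to one space variable. -/
theorem IsSolution.integral_deriv_mul (hsol : IsSolution p u ut) (hu : ∀ t, IsRadial (u t))
    (hut : ∀ t, IsRadial (ut t)) {a β : ℝ → ℝ} (ha : ContDiff ℝ ∞ a) (hac : HasCompactSupport a)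
    (hβ : IsTest β) :
    ∫ t, deriv a t * ∫ r in Ioi 0, reduced (u t) r * β r =
      -∫ t, a t * ∫ r in Ioi 0, reduced (ut t) r * β r := by
  have hk := hβ.mul_inv
  have h1 := hsol.time_deriv (fun q => a q.1 * (β ‖q.2‖ * ‖q.2‖⁻¹))
    ((ha.comp contDiff_fst).mul (hk.contDiff_radial.comp contDiff_snd))
    (hasCompactSupport_prod hac hk.hasCompactSupport_radial)
  have e1 : ∀ t, ∫ x, u t x * deriv (fun s => a s * (β ‖x‖ * ‖x‖⁻¹)) t =
      sphereConst * (deriv a t * ∫ r in Ioi 0, reduced (u t) r * β r) := fun t => by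
    rw [mul_left_comm, ← (hu t).integral_mul_radial, ← integral_const_mul]
    refine integral_congr_ae (Eventually.of_forall fun x => ?_)
    beta_reduce
    rw [deriv_mul_const (ha.differentiable (by simp) t)]
    ring
  have e2 : ∀ t, ∫ x, ut t x * (a t * (β ‖x‖ * ‖x‖⁻¹)) =
      sphereConst * (a t * ∫ r in Ioi 0, reduced (ut t) r * β r) := fun t => by
    rw [mul_left_comm, ← (hut t).integral_mul_radial, ← integral_const_mul]
    exact integral_congr_ae (Eventually.of_forall fun x => by ring)
  simp only [e1, e2] at h1
  rw [integral_const_mul, integral_const_mul, ← mul_neg] at h1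
  exact mul_left_cancel₀ sphereConst_pos.ne' h1

/-- The same separated test functions work for the wave equation because the Laplacian of
`β(|x|)/|x|` is `β''(|x|)/|x|`, with no first-order term. -/
theorem IsSolution.integral_deriv_deriv_mul (hsol : IsSolution p u ut)
    (hu : ∀ t, IsRadial (u t)) {a β : ℝ → ℝ} (ha : ContDiff ℝ ∞ a) (hac : HasCompactSupport a)
    (hβ : IsTest β) :
    ∫ t, (deriv (deriv a) t * (∫ r in Ioi 0, reduced (u t) r * β r) -
        a t * ∫ r in Ioi 0, reduced (u t) r * deriv (deriv β) r) =
      -∫ t, a t * ∫ r in Ioi 0,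
        |reduced (u t) r| ^ (p - 1) * reduced (u t) r * r ^ (1 - p) * β r := by
  have hk := hβ.mul_inv
  have h1 := hsol.wave_eq (fun q => a q.1 * (β ‖q.2‖ * ‖q.2‖⁻¹))
    ((ha.comp contDiff_fst).mul (hk.contDiff_radial.comp contDiff_snd))
    (hasCompactSupport_prod hac hk.hasCompactSupport_radial)
  have had : ContDiff ℝ ∞ (deriv a) := ha.deriv'
  have d1 : ∀ t c, iteratedDeriv 2 (fun s => a s * c) t = deriv (deriv a) t * c := fun t c => by
    rw [iteratedDeriv_succ, iteratedDeriv_one]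
    have : (deriv fun s => a s * c) = fun s => deriv a s * c :=
      funext fun s => deriv_mul_const (ha.differentiable (by simp) s) _
    rw [this, deriv_mul_const (had.differentiable (by simp) t)]
  have d2 : ∀ t x, Laplacian.laplacian (fun y : E3 => a t * (β ‖y‖ * ‖y‖⁻¹)) x =
      a t * (deriv (deriv β) ‖x‖ * ‖x‖⁻¹) := fun t x => by
    rw [← hβ.laplacian_radial x, ← smul_eq_mul, ← InnerProductSpace.laplacian_smul]
    · rfl
    · exact (contDiff_infty.1 hk.contDiff_radial 2).contDiffAt
  have hli : ∀ t, LocallyIntegrable (u t) := fun t =>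
    (hsol.inEnergySpace.memLp_six t).locallyIntegrable (by norm_num)
  have hint : ∀ t {γ : ℝ → ℝ}, IsTest γ → Integrable fun x => u t x * (γ ‖x‖ * ‖x‖⁻¹) :=
    fun t γ hγ => by
      have := (hli t).integrable_smul_left_of_hasCompactSupport
        hγ.mul_inv.contDiff_radial.continuous hγ.mul_inv.hasCompactSupport_radial
      exact this.congr (Eventually.of_forall fun x => by simp only [smul_eq_mul]; ring)
  have e1 : ∀ t, ∫ x, u t x * (iteratedDeriv 2 (fun s => a s * (β ‖x‖ * ‖x‖⁻¹)) t -
        Laplacian.laplacian (fun y : E3 => a t * (β ‖y‖ * ‖y‖⁻¹)) x) =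
      sphereConst * (deriv (deriv a) t * (∫ r in Ioi 0, reduced (u t) r * β r) -
        a t * ∫ r in Ioi 0, reduced (u t) r * deriv (deriv β) r) := fun t => by
    rw [mul_sub, mul_left_comm, ← (hu t).integral_mul_radial, ← integral_const_mul,
      mul_left_comm, ← (hu t).integral_mul_radial, ← integral_const_mul,
      ← integral_sub ((hint t hβ).const_mul _) ((hint t hβ.deriv_test.deriv_test).const_mul _)]
    refine integral_congr_ae (Eventually.of_forall fun x => ?_)
    beta_reduce
    rw [d1, d2]
    ring
  have hN : ∀ t, IsRadial fun x => |u t x| ^ (p - 1) * u t x := fun t x y h => by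
    simp only [hu t x y h]
  have hNr : ∀ t r, 0 < r → reduced (fun x => |u t x| ^ (p - 1) * u t x) r =
      |reduced (u t) r| ^ (p - 1) * reduced (u t) r * r ^ (1 - p) := fun t r hr => by
    have : r ^ (p - 1) * r ^ (1 - p) = 1 := by
      rw [← Real.rpow_add hr]; simp
    simp only [reduced, profile, abs_mul, abs_of_pos hr]
    rw [Real.mul_rpow hr.le (abs_nonneg _)]
    linear_combination -(r * |u t (EuclideanSpace.single 0 r)| ^ (p - 1) *
      u t (EuclideanSpace.single 0 r)) * this
  have e2 : ∀ t, ∫ x, |u t x| ^ (p - 1) * u t x * (a t * (β ‖x‖ * ‖x‖⁻¹)) =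
      sphereConst * (a t * ∫ r in Ioi 0,
        |reduced (u t) r| ^ (p - 1) * reduced (u t) r * r ^ (1 - p) * β r) := fun t => by
    rw [← setIntegral_congr_fun measurableSet_Ioi (f := fun r =>
      reduced (fun x => |u t x| ^ (p - 1) * u t x) r * β r)
      (fun r hr => by simp only [hNr t r hr]),
      mul_left_comm, ← (hN t).integral_mul_radial, ← integral_const_mul]
    exact integral_congr_ae (Eventually.of_forall fun x => by ring)
  simp only [e1, e2] at h1
  rw [integral_const_mul, integral_const_mul, ← mul_neg] at h1
  exact mul_left_cancel₀ sphereConst_pos.ne' h1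

/-- The reduction of a radial solution to the half line. -/
theorem IsSolution.exists_lineWave (hp : 1 < p) (hsol : IsSolution p u ut)
    (hu : ∀ t, IsRadial (u t)) (hut : ∀ t, IsRadial (ut t)) :
    ∃ w R T, LineWave p w R T ∧ (∀ t, ∀ᵐ r, r ∈ Ioi (0 : ℝ) → reduced (u t) r = w t r) ∧
      ∀ t, ∀ᵐ r, r ∈ Ioi (0 : ℝ) → reduced (ut t) r = T t r := by
  obtain ⟨G, hgrad, hG, hGc⟩ := hsol.inEnergySpace.exists_grad
  set h : ℝ → L2 := fun t => radialDeriv (hG t) with hh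
  have hhc : Continuous h := continuous_radialDeriv hG hGc
  have h2 := hsol.inEnergySpace.memLp_time
  set T : ℝ → L2 := fun t => ((hut t).memLp_reduced (h2 t)).toLp _ with hT
  have hTc : Continuous T := continuous_reduced hut h2 hsol.inEnergySpace.continuous_time
  have hw : ∀ t, ∀ᵐ r, r ∈ Ioi (0 : ℝ) → reduced (u t) r = waveOf (h t) r := fun t =>
    (hgrad t).reduced_eq (hu t) (hG t) (hsol.inEnergySpace.memLp_six t)
  have hTe : ∀ t, ∀ᵐ r, r ∈ Ioi (0 : ℝ) → reduced (ut t) r = T t r := fun t =>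
    ((hut t).memLp_reduced (h2 t)).coeFn_toLp.mono fun r hr hr0 => by
      rw [hT, hr, indicator_of_mem hr0]
  have hwc : ContinuousOn (fun q : ℝ × ℝ => waveOf (h q.1) q.2) (univ ×ˢ Ioi 0) :=
    continuousOn_waveOf hhc
  have hNc : ContinuousOn (fun q : ℝ × ℝ =>
      |waveOf (h q.1) q.2| ^ (p - 1) * waveOf (h q.1) q.2 * q.2 ^ (1 - p)) (univ ×ˢ Ioi 0) :=
    ((hwc.abs.rpow_const fun _ _ => Or.inr (by linarith)).mul hwc).mul
      (continuousOn_snd.rpow_const fun q hq => Or.inl (ne_of_gt hq.2))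
  have c1 : ∀ {β : ℝ → ℝ}, IsTest β → ∀ t, ∫ r in Ioi 0, reduced (u t) r * β r =
      ∫ r, waveOf (h t) r * β r := fun hβ t => by
    rw [← hβ.setIntegral]
    refine setIntegral_congr_ae measurableSet_Ioi ((hw t).mono fun r hr hr0 => ?_)
    rw [hr hr0]
  have c2 : ∀ {β : ℝ → ℝ}, IsTest β → ∀ t, ∫ r in Ioi 0, reduced (ut t) r * β r =
      ∫ r, T t r * β r := fun hβ t => by
    rw [← hβ.setIntegral]
    refine setIntegral_congr_ae measurableSet_Ioi ((hTe t).mono fun r hr hr0 => ?_)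
    rw [hr hr0]
  have c3 : ∀ {β : ℝ → ℝ}, IsTest β → ∀ t, ∫ r in Ioi 0,
      |reduced (u t) r| ^ (p - 1) * reduced (u t) r * r ^ (1 - p) * β r =
      ∫ r, |waveOf (h t) r| ^ (p - 1) * waveOf (h t) r * r ^ (1 - p) * β r := fun hβ t => by
    rw [← hβ.setIntegral]
    refine setIntegral_congr_ae measurableSet_Ioi ((hw t).mono fun r hr hr0 => ?_)
    rw [hr hr0]
  have cT := fun {β : ℝ → ℝ} (hβ : IsTest β) => hβ.continuous_integral_L2 hTc
  have cw := fun {β : ℝ → ℝ} (hβ : IsTest β) => hβ.continuous_integral (g := fun t r => waveOf (h t) r) hwc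
  have cN := fun {β : ℝ → ℝ} (hβ : IsTest β) => hβ.continuous_integral (g := fun t r =>
    |waveOf (h t) r| ^ (p - 1) * waveOf (h t) r * r ^ (1 - p)) hNc
  have hfirst : ∀ {β : ℝ → ℝ}, IsTest β → ∀ a : ℝ → ℝ, ContDiff ℝ ∞ a → HasCompactSupport a →
      ∫ t, deriv a t * ∫ r, waveOf (h t) r * β r = -∫ t, a t * ∫ r, T t r * β r :=
    fun hβ a ha hac => by
      simpa only [c1 hβ, c2 hβ] using hsol.integral_deriv_mul hu hut ha hac hβ
  -- All pairings with `waveOf (h t)` and `T t` are continuous in `t`, so distributional identities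
  -- in time become classical derivatives at every `t`.
  refine ⟨fun t => waveOf (h t), fun t => waveDeriv (h t), T,
    ⟨hwc, ⟨fun t => ‖h t‖, hhc.norm, fun t r hr => abs_waveOf_le _ hr⟩,
      hhc.sub (hardy.continuous.comp hhc), hTc, fun t β hβ => integral_waveOf_mul_deriv _ hβ,
      fun β hβ t => hasDerivAt_of_weak_deriv (cw hβ) (cT hβ) (hfirst hβ) t,
      fun β hβ t => ?_⟩, hw, hTe⟩
  have hd := hβ.deriv_test
  rw [← integral_waveOf_mul_deriv _ hd]
  refine hasDerivAt_of_weak_deriv (n := fun t => (∫ r, waveOf (h t) r * deriv (deriv β) r) -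
    ∫ r, |waveOf (h t) r| ^ (p - 1) * waveOf (h t) r * r ^ (1 - p) * β r) (cT hβ)
    ((cw hd.deriv_test).sub (cN hβ)) (fun a ha hac => ?_) t
  have h3 := hsol.integral_deriv_deriv_mul hu ha hac hβ
  simp only [c1 hβ, c1 hd.deriv_test, c3 hβ] at h3
  have ca := ha.continuous
  have had : ContDiff ℝ ∞ (deriv a) := ha.deriv'
  have i1 : Integrable fun t => deriv (deriv a) t * ∫ r, waveOf (h t) r * β r :=
    ((had.continuous_deriv (by simp)).mul (cw hβ)).integrable_of_hasCompactSupport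
      hac.deriv.deriv.mul_right
  have i2 : Integrable fun t => a t * ∫ r, waveOf (h t) r * deriv (deriv β) r :=
    (ca.mul (cw hd.deriv_test)).integrable_of_hasCompactSupport hac.mul_right
  have i3 : Integrable fun t =>
      a t * ∫ r, |waveOf (h t) r| ^ (p - 1) * waveOf (h t) r * r ^ (1 - p) * β r :=
    (ca.mul (cN hβ)).integrable_of_hasCompactSupport hac.mul_right
  -- The first-order identity applied with `a'` replaces `∫ a'' ⟨w, β⟩` by `-∫ a' ⟨T, β⟩`, leaving a
  -- first-order equation for `⟨T, β⟩`.
  rw [integral_sub i1 i2, hfirst hβ _ had hac.deriv] at h3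
  simp only [mul_sub]
  rw [integral_sub i2 i3]
  linarith

end Solution

end RadialWave

/-! ### Finite energy and identification of the densities -/

namespace RadialWave

section Energy

variable {p : ℝ} {w : ℝ → ℝ → ℝ} {V : ℝ → L2}

/-- `V` is always in `L²`, so finiteness of the energy concerns the potential alone and does not
depend on the choice of inward or outward. -/
theorem InwardWave.integrableOn_density_iff (hp3 : 3 ≤ p) (t : ℝ) :
    IntegrableOn (waveDensity p w V t) (Ioi 0) ↔ IntegrableOn (potential p w t) (Ioi 0) := by
  have hV : IntegrableOn (fun r => V t r ^ 2) (Ioi 0) := (integrable_sq_L2 (V t)).integrableOn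
  have hc : (2 / (p + 1)) ≠ 0 := by positivity
  constructor
  · intro h
    refine ((h.sub hV).const_mul (2 / (p + 1))⁻¹).congr (Eventually.of_forall fun r => ?_)
    simp only [waveDensity, Pi.sub_apply]
    field_simp
    ring
  · exact fun h => hV.add (h.const_mul _)

theorem waveDensity_nonneg_ae (hp3 : 3 ≤ p) (t : ℝ) :
    0 ≤ᵐ[volume.restrict (Ioi 0)] waveDensity p w V t :=
  (ae_restrict_mem measurableSet_Ioi).mono fun _ hr => waveDensity_nonneg hp3 hr

theorem InwardWave.integral_density_eq (hp3 : 3 ≤ p) (h : InwardWave p w V) (t : ℝ) :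
    ∫ r in Ioi 0, waveDensity p w V t r =
      (∫⁻ r in Ioi 0, ENNReal.ofReal (waveDensity p w V t r)).toReal :=
  integral_eq_lintegral_of_nonneg_ae (waveDensity_nonneg_ae hp3 t)
    (h.aestronglyMeasurable_density hp3 t)

theorem lintegral_density_ne_top {t : ℝ} (hi : IntegrableOn (waveDensity p w V t) (Ioi 0)) :
    ∫⁻ r in Ioi 0, ENNReal.ofReal (waveDensity p w V t r) ≠ ⊤ :=
  hi.lintegral_lt_top.ne

theorem InwardWave.integrableOn_density_of_le (hp3 : 3 ≤ p) (hp5 : p < 5) (h : InwardWave p w V)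
    {t₀ t₁ : ℝ} (ht : t₀ ≤ t₁) (hi : IntegrableOn (waveDensity p w V t₀) (Ioi 0)) :
    IntegrableOn (waveDensity p w V t₁) (Ioi 0) := by
  refine ⟨h.aestronglyMeasurable_density hp3 t₁, ?_⟩
  rw [hasFiniteIntegral_iff_ofReal (waveDensity_nonneg_ae hp3 t₁)]
  exact (h.lintegral_density_le hp3 hp5 ht).trans_lt hi.lintegral_lt_top

theorem InwardWave.integral_density_le (hp3 : 3 ≤ p) (hp5 : p < 5) (h : InwardWave p w V)
    {t₀ t₁ : ℝ} (ht : t₀ ≤ t₁) (hi : IntegrableOn (waveDensity p w V t₀) (Ioi 0)) :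
    ∫ r in Ioi 0, waveDensity p w V t₁ r ≤ ∫ r in Ioi 0, waveDensity p w V t₀ r := by
  rw [h.integral_density_eq hp3, h.integral_density_eq hp3]
  exact ENNReal.toReal_mono (lintegral_density_ne_top hi) (h.lintegral_density_le hp3 hp5 ht)

theorem InwardWave.tendsto_integral_density (hp3 : 3 ≤ p) (hp5 : p < 5) (h : InwardWave p w V)
    {t₀ : ℝ} (hi : IntegrableOn (waveDensity p w V t₀) (Ioi 0)) :
    Tendsto (fun t => ∫ r in Ioi 0, waveDensity p w V t r) atTop (𝓝 0) := by
  simp only [h.integral_density_eq hp3]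
  exact (ENNReal.tendsto_toReal ENNReal.zero_ne_top).comp
    (h.tendsto_lintegral_density hp3 hp5 (lintegral_density_ne_top hi))

theorem InwardWave.integral_potential_le (hp3 : 3 ≤ p) {t : ℝ}
    (hi : IntegrableOn (potential p w t) (Ioi 0)) :
    ∫ r in Ioi 0, potential p w t r ≤ (p + 1) / 2 * ∫ r in Ioi 0, waveDensity p w V t r := by
  rw [← integral_const_mul]
  refine setIntegral_mono_on hi (((InwardWave.integrableOn_density_iff hp3 t).2 hi).const_mul _)
    measurableSet_Ioi fun r _ => ?_
  have : (p + 1) / 2 * waveDensity p w V t r = (p + 1) / 2 * V t r ^ 2 + potential p w t r := by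
    rw [waveDensity]
    field_simp
  rw [this]
  have : 0 ≤ (p + 1) / 2 * V t r ^ 2 := by positivity
  linarith

/-- Inward monotonicity carries finiteness forward. The reversed wave has the same potential and
carries it backward. -/
theorem LineWave.integrableOn_potential {R T : ℝ → L2} (hp3 : 3 ≤ p) (hp5 : p < 5)
    (h : LineWave p w R T) {t₀ : ℝ} (hi : IntegrableOn (potential p w t₀) (Ioi 0)) (t : ℝ) :
    IntegrableOn (potential p w t) (Ioi 0) := by
  rcases le_total t₀ t with ht | ht
  · exact (InwardWave.integrableOn_density_iff hp3 t).1
      (h.inwardWave.integrableOn_density_of_le hp3 hp5 ht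
        ((InwardWave.integrableOn_density_iff hp3 t₀).2 hi))
  · have e : ∀ s, potential p (fun t => w (-t)) (-s) = potential p w s := fun s => by
      funext r
      simp only [potential, neg_neg]
    rw [← e]
    refine (InwardWave.integrableOn_density_iff hp3 (-t)).1
      (h.reverse.inwardWave.integrableOn_density_of_le hp3 hp5 (neg_le_neg ht)
        ((InwardWave.integrableOn_density_iff hp3 (-t₀)).2 ?_))
    rwa [e]

end Energy

/-- Uniqueness of weak derivatives: it identifies the arbitrarily chosen `weakDeriv` with the `L²`
derivative of the reduction. -/
theorem IsWeakDeriv.ae_eq {f g g' : ℝ → ℝ} (h : IsWeakDeriv f g) (h' : IsWeakDeriv f g') :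
    ∀ᵐ r, r ∈ Ioi (0 : ℝ) → g r = g' r := by
  have := isOpen_Ioi.ae_eq_zero_of_integral_contDiff_smul_eq_zero
    (h.locallyIntegrableOn_deriv.sub h'.locallyIntegrableOn_deriv) fun φ hφ hφc hφs => ?_
  · filter_upwards [this] with r hr hr0
    have := hr hr0
    simp only [Pi.sub_apply] at this
    linarith
  have hβ : IsTest φ := ⟨hφ, hφc, hφs⟩
  have h1 := h.integral_eq φ hφ hφc hφs
  rw [h'.integral_eq φ hφ hφc hφs, hβ.setIntegral, hβ.setIntegral] at h1
  have i1 := integrable_test_mul_locallyIntegrableOn h.locallyIntegrableOn_deriv hφ.continuous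
    hφc hφs
  have i2 := integrable_test_mul_locallyIntegrableOn h'.locallyIntegrableOn_deriv hφ.continuous
    hφc hφs
  simp only [Pi.sub_apply, smul_eq_mul, mul_sub]
  rw [integral_sub i1 i2]
  simp only [mul_comm (φ _)]
  linarith

theorem isWeakDeriv_weakDeriv {f g : ℝ → ℝ} (h : IsWeakDeriv f g) :
    IsWeakDeriv f (weakDeriv f) := by
  have hex : ∃ g, IsWeakDeriv f g := ⟨g, h⟩
  rw [weakDeriv, dif_pos hex]
  exact hex.choose_spec

section Reduction

variable {p : ℝ} {u ut : ℝ → E3 → ℝ} {w : ℝ → ℝ → ℝ} {R T : ℝ → L2}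

theorem LineWave.isWeakDeriv (h : LineWave p w R T) {f : E3 → ℝ} (hf : IsRadial f)
    (hli : LocallyIntegrable f) {t : ℝ} (hw : ∀ᵐ r, r ∈ Ioi (0 : ℝ) → reduced f r = w t r) :
    IsWeakDeriv (reduced f) (R t) := by
  refine ⟨hf.locallyIntegrableOn_reduced hli,
    ((Lp.memLp (R t)).locallyIntegrable (by norm_num)).locallyIntegrableOn _,
    fun φ h1 h2 h3 => ?_⟩
  have hβ : IsTest φ := ⟨h1, h2, h3⟩
  rw [hβ.setIntegral, ← h.integral_R t φ hβ, ← hβ.deriv_test.setIntegral]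
  exact setIntegral_congr_ae measurableSet_Ioi (hw.mono fun r hr hr0 => by rw [hr hr0])

theorem inwardDensity_ae_eq {t : ℝ}
    (hw : ∀ᵐ r, r ∈ Ioi (0 : ℝ) → reduced (u t) r = w t r)
    (hR : ∀ᵐ r, r ∈ Ioi (0 : ℝ) → weakDeriv (reduced (u t)) r = R t r)
    (hT : ∀ᵐ r, r ∈ Ioi (0 : ℝ) → reduced (ut t) r = T t r) :
    inwardDensity p u ut t =ᵐ[volume.restrict (Ioi 0)] waveDensity p w (fun t => R t + T t) t := by
  filter_upwards [ae_restrict_of_ae hw, ae_restrict_of_ae hR, ae_restrict_of_ae hT,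
    ae_restrict_mem measurableSet_Ioi, ae_restrict_of_ae (Lp.coeFn_add (R t) (T t))]
    with r h1 h2 h3 h4 h5
  rw [inwardDensity, waveDensity, potential, h1 h4, h2 h4, h3 h4, h5, sq_abs, Pi.add_apply]

/-- Since time reversal flips `w_t`, the outward density at `t` is the inward density of the
reversed wave at `-t`. -/
theorem outwardDensity_ae_eq {t : ℝ}
    (hw : ∀ᵐ r, r ∈ Ioi (0 : ℝ) → reduced (u t) r = w t r)
    (hR : ∀ᵐ r, r ∈ Ioi (0 : ℝ) → weakDeriv (reduced (u t)) r = R t r)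
    (hT : ∀ᵐ r, r ∈ Ioi (0 : ℝ) → reduced (ut t) r = T t r) :
    outwardDensity p u ut t =ᵐ[volume.restrict (Ioi 0)]
      waveDensity p (fun t => w (-t)) (fun t => R (-t) + -T (-t)) (-t) := by
  filter_upwards [ae_restrict_of_ae hw, ae_restrict_of_ae hR, ae_restrict_of_ae hT,
    ae_restrict_mem measurableSet_Ioi, ae_restrict_of_ae (Lp.coeFn_sub (R t) (T t))]
    with r h1 h2 h3 h4 h5
  rw [outwardDensity, waveDensity, potential, h1 h4, h2 h4, h3 h4, neg_neg, ← sub_eq_add_neg, h5,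
    sq_abs, Pi.sub_apply]

theorem sq_mul_profile_rpow {f : E3 → ℝ} {t : ℝ}
    (hw : ∀ᵐ r, r ∈ Ioi (0 : ℝ) → reduced f r = w t r) :
    (fun r => r ^ 2 * |profile f r| ^ (p + 1)) =ᵐ[volume.restrict (Ioi 0)] potential p w t := by
  filter_upwards [ae_restrict_of_ae hw, ae_restrict_mem measurableSet_Ioi] with r h1 h2
  have hr : 0 < r := h2
  have h3 : r ^ (p + 1) = r ^ 2 * r ^ (p - 1) := by
    rw [← Real.rpow_natCast, ← Real.rpow_add hr]
    congr 1
    push_cast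
    ring
  rw [potential, ← h1 h2, reduced, abs_mul, abs_of_pos hr, Real.mul_rpow hr.le (abs_nonneg _), h3]
  field_simp

theorem IsRadial.integrable_rpow_iff {f : E3 → ℝ} (hf : IsRadial f) {t : ℝ}
    (hw : ∀ᵐ r, r ∈ Ioi (0 : ℝ) → reduced f r = w t r) :
    Integrable (fun x => |f x| ^ (p + 1)) ↔ IntegrableOn (potential p w t) (Ioi 0) := by
  simp only [hf.eq_profile]
  rw [integrable_radial_iff (k := fun r => |profile f r| ^ (p + 1))]
  exact integrable_congr (sq_mul_profile_rpow hw)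

theorem IsRadial.integral_rpow {f : E3 → ℝ} (hf : IsRadial f) {t : ℝ}
    (hw : ∀ᵐ r, r ∈ Ioi (0 : ℝ) → reduced f r = w t r) :
    ∫ x, |f x| ^ (p + 1) = sphereConst * ∫ r in Ioi 0, potential p w t r := by
  simp only [hf.eq_profile]
  rw [integral_radial fun r => |profile f r| ^ (p + 1),
    integral_congr_ae (sq_mul_profile_rpow hw)]

end Reduction

end RadialWave

/-! ### Conclusion for the radial solution -/

open RadialWave in
theorem mainTheorem4 (p : ℝ) (hp3 : 3 ≤ p) (hp5 : p < 5) (u ut : ℝ → E3 → ℝ)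
    (hsol : IsSolution p u ut)
    (hu : ∀ t, IsRadial (u t)) (hut : ∀ t, IsRadial (ut t))
    (hE : Integrable (fun x => |u 0 x| ^ (p + 1))) :
    (∀ t, IsWeakDeriv (reduced (u t)) (weakDeriv (reduced (u t)))) ∧
    (∀ t, IntegrableOn (inwardDensity p u ut t) (Ioi 0)) ∧
    (∀ t, IntegrableOn (outwardDensity p u ut t) (Ioi 0)) ∧
    Antitone (inwardEnergy p u ut) ∧
    Monotone (outwardEnergy p u ut) ∧
    Tendsto (inwardEnergy p u ut) atTop (𝓝 0) ∧
    Tendsto (outwardEnergy p u ut) atBot (𝓝 0) ∧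
    (∀ t, Integrable (fun x => |u t x| ^ (p + 1))) ∧
    Tendsto (fun t => ∫ x, |u t x| ^ (p + 1)) atTop (𝓝 0) ∧
    Tendsto (fun t => ∫ x, |u t x| ^ (p + 1)) atBot (𝓝 0) := by
  obtain ⟨w, R, T, h, hw, hT⟩ := hsol.exists_lineWave (by linarith) hu hut
  have hli : ∀ t, LocallyIntegrable (u t) := fun t =>
    (hsol.inEnergySpace.memLp_six t).locallyIntegrable (by norm_num)
  have hd := fun t => h.isWeakDeriv (hu t) (hli t) (hw t)
  have hwd := fun t => isWeakDeriv_weakDeriv (hd t)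
  have hR := fun t => (hwd t).ae_eq (hd t)
  have hP := h.integrableOn_potential hp3 hp5 (((hu 0).integrable_rpow_iff (hw 0)).1 hE)
  have hP' : ∀ t, IntegrableOn (potential p (fun t => w (-t)) t) (Ioi 0) := fun t => hP (-t)
  have hI := h.inwardWave
  have hO := h.reverse.inwardWave
  have iI : ∀ t, IntegrableOn (waveDensity p w (fun t => R t + T t) t) (Ioi 0) := fun t =>
    (InwardWave.integrableOn_density_iff hp3 t).2 (hP t)
  have iO : ∀ t, IntegrableOn
      (waveDensity p (fun t => w (-t)) (fun t => R (-t) + -T (-t)) t) (Ioi 0) := fun t =>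
    (InwardWave.integrableOn_density_iff hp3 t).2 (hP' t)
  have eI := fun t => inwardDensity_ae_eq (p := p) (hw t) (hR t) (hT t)
  have eO := fun t => outwardDensity_ae_eq (p := p) (hw t) (hR t) (hT t)
  have EI : inwardEnergy p u ut = fun t =>
      Real.pi * ∫ r in Ioi 0, waveDensity p w (fun t => R t + T t) t r :=
    funext fun t => by rw [inwardEnergy, integral_congr_ae (eI t)]
  have EO : outwardEnergy p u ut = fun t => Real.pi * ∫ r in Ioi 0,
      waveDensity p (fun t => w (-t)) (fun t => R (-t) + -T (-t)) (-t) r :=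
    funext fun t => by rw [outwardEnergy, integral_congr_ae (eO t)]
  have lI := hI.tendsto_integral_density hp3 hp5 (iI 0)
  have lO := (hO.tendsto_integral_density hp3 hp5 (iO 0)).comp tendsto_neg_atBot_atTop
  have hc := sphereConst_pos
  have eU := fun t => (hu t).integral_rpow (p := p) (hw t)
  have hnn : ∀ t, 0 ≤ ∫ x, |u t x| ^ (p + 1) := fun t =>
    integral_nonneg fun x => by positivity
  refine ⟨hwd, fun t => (iI t).congr (eI t).symm, fun t => (iO (-t)).congr (eO t).symm,
    fun s t hst => ?_, fun s t hst => ?_, ?_, ?_,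
    fun t => ((hu t).integrable_rpow_iff (hw t)).2 (hP t), ?_, ?_⟩
  · rw [EI]
    exact mul_le_mul_of_nonneg_left (hI.integral_density_le hp3 hp5 hst (iI s)) Real.pi_pos.le
  · rw [EO]
    exact mul_le_mul_of_nonneg_left
      (hO.integral_density_le hp3 hp5 (neg_le_neg hst) (iO (-t))) Real.pi_pos.le
  · rw [EI]
    simpa using lI.const_mul Real.pi
  · rw [EO]
    simpa using lO.const_mul Real.pi
  · refine squeeze_zero hnn (fun t => ?_)
      (by simpa using (lI.const_mul ((p + 1) / 2)).const_mul sphereConst)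
    rw [eU]
    exact mul_le_mul_of_nonneg_left (InwardWave.integral_potential_le hp3 (hP t)) hc.le
  -- As `t → -∞` the outward energy dominates the potential. The forward limit above used the inward
  -- energy.
  · refine squeeze_zero hnn (fun t => ?_)
      (by simpa using (lO.const_mul ((p + 1) / 2)).const_mul sphereConst)
    rw [eU]
    have e : potential p w t = potential p (fun t => w (-t)) (-t) := by
      funext r
      simp only [potential, neg_neg]
    rw [e]
    exact mul_le_mul_of_nonneg_left (InwardWave.integral_potential_le hp3 (hP' (-t))) hc.le
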